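/- Let $d\ge 2$, $\mathbb T^d=(\mathbb R/\mathbb Z)^d$ with its Euclidean (flat) distance $|\cdot|$, $\beta>0$ and $\mu\in\mathbb R$. There is $\delta_0>0$, depending only on $d,\beta,\mu$, such that the following holds for every continuous probability density $f_0\ge 0$ on $\mathbb T^d\times\mathbb R^d$ with $f_0(x,v)\,e^{\mu+\frac\beta2|v|^2}\le 1$ for all $(x,v)$, and every $\delta\in(0,\delta_0]$. For $r\ge 0$ and $n\ge 0$ let $\mathcal B^{n+}_r$ be the set of $Z_n=(x_i,v_i)_{1\le i\le n}\in(\mathbb T^d\times\mathbb R^d)^n$ such that $|x_i-x_k+u(v_i-v_k)|\le r$ for some $u\in[0,\delta]$ and some $i\ne k$. For $\varepsilon>0$ put $\mu_\varepsilon=\varepsilon^{-(d-1)}$ and $$W^n_{\varepsilon,0}(Z_n)=\frac{\mu_\varepsilon^n}{\mathcal Z_\varepsilon}\,f_0^{\otimes n}(Z_n)\,\mathbf 1_{\{Z_n\notin\mathcal B^{n+}_\varepsilon\}},\qquad \mathcal Z_\varepsilon=\sum_{n\ge 0}\frac{\mu_\varepsilon^n}{n!}\int f_0^{\otimes n}\,\mathbf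 1_{\{Z_n\notin\mathcal B^{n+}_\varepsilon\}}\,dZ_n ,$$ and define the rescaled correlation functions $$f^{(j)}_{\varepsilon,0}(Z_j)=\mu_\varepsilon^{-j}\sum_{n\ge 0}\frac1{n!}\int W^{j+n}_{\varepsilon,0}(Z_{j+n})\,dz_{j+1}\cdots dz_{j+n}.$$ 1. There is a measurable $f^{(1)}:\mathbb T^d\times\mathbb R^d\to[0,\infty)$ with $\displaystyle\lim_{\varepsilon\to0^+}\sup_z\big|f^{(1)}_{\varepsilon,0}(z)-f^{(1)}(z)\big|=0$. 2. For every $j\ge 2$, $\displaystyle\lim_{\varepsilon\to0^+}\ \sup_{Z_j\notin\mathcal B^{j+}_{\varepsilon|\log\varepsilon|}}\Big|f^{(j)}_{\varepsilon,0}(Z_j)-\prod_{i=1}^j f^{(1)}_{\varepsilon,0}(z_i)\Big|=0$. 3. For every $\varepsilon>0$ the state evolves by free transport on $[0,\delta]$: if $W^n_{\varepsilon,0}(Z_n)\neq0$, the free flow $t\mapsto(x_i+tv_i,v_i)_i$ is the unique trajectory on $[0,\delta]$, issued from $Z_n$, of the dynamics of hard spheres of diameter $\varepsilon$ with elastic collisions.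 Consequently, for $t\in[0,\delta]$, the image under this dynamics at time $t$ of the measure with density $W^n_{\varepsilon,0}$ has density $W^n_{\varepsilon}(t,Z_n)=W^n_{\varepsilon,0}((x_i-tv_i,v_i)_i)$, and the rescaled correlation functions of the family $(W^n_\varepsilon(t))_{n\ge0}$ are $f^{(j)}_\varepsilon(t,Z_j)=f^{(j)}_{\varepsilon,0}((x_i-tv_i,v_i)_{i\le j})$ for all $j$. -/

import Mathlib

open MeasureTheory Filter Topology
open scoped ENNReal BigOperators

noncomputable section

namespace HardSphere

/-- One-particle phase space `𝕋ᵈ × ℝᵈ`, with `𝕋ᵈ = (ℝ/ℤ)ᵈ` and Euclidean velocities. -/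
abbrev Phase (d : ℕ) : Type :=
  UnitAddTorus (Fin d) × EuclideanSpace ℝ (Fin d)

/-- Configurations of `n` labelled particles. -/
abbrev Config (d n : ℕ) : Type := Fin n → Phase d

/-- The flat (Euclidean) distance on the torus. (The metric of the product type
`Fin d → ℝ/ℤ` is the sup distance, so it is not used.) -/
def torusDist {d : ℕ} (x y : UnitAddTorus (Fin d)) : ℝ :=
  Real.sqrt (∑ a, ‖x a - y a‖ ^ 2)

/-- Translation of a point of the torus by a vector of `ℝᵈ`. -/
def torusShift {d : ℕ} (x : UnitAddTorus (Fin d)) (w : EuclideanSpace ℝ (Fin d)) :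
    UnitAddTorus (Fin d) :=
  fun a => x a + ((w a : ℝ) : UnitAddCircle)

/-- Free transport of `n` particles during a time `t` (of any sign):
`(x_i, v_i) ↦ (x_i + t v_i, v_i)`. -/
def freeFlow {d n : ℕ} (t : ℝ) (Z : Config d n) : Config d n :=
  fun i => (torusShift (Z i).1 (t • (Z i).2), (Z i).2)

/-- The bad set `𝓑_r^{n+}` with time horizon `δ`: along the forward free flow, two distinct
particles come within distance `r` of each other at some time of `[0, δ]`. -/
def badSet (d : ℕ) (δ r : ℝ) (n : ℕ) : Set (Config d n) :=
  {Z | ∃ u ∈ Set.Icc (0 : ℝ) δ, ∃ i k : Fin n, i ≠ k ∧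
    torusDist (freeFlow u Z i).1 (freeFlow u Z k).1 ≤ r}

/-- The Boltzmann-Grad activity `μ_ε = ε^{-(d-1)}`. -/
def activity (d : ℕ) (ε : ℝ) : ℝ := (ε ^ (d - 1))⁻¹

/-- The tensor product `f₀^{⊗ n}`. -/
def tensor {d : ℕ} (f₀ : Phase d → ℝ) (n : ℕ) (Z : Config d n) : ℝ := ∏ i, f₀ (Z i)

open Classical in
/-- `f₀^{⊗ n}` restricted to the configurations without collision on `[0, δ]`. -/
def restrictedTensor {d : ℕ} (f₀ : Phase d → ℝ) (δ ε : ℝ) (n : ℕ) (Z : Config d n) : ℝ :=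
  if Z ∈ badSet d δ ε n then 0 else tensor f₀ n Z

/-- The grand-canonical normalization constant `𝒵_ε`. -/
def partitionFunction {d : ℕ} (f₀ : Phase d → ℝ) (δ ε : ℝ) : ℝ :=
  ∑' n : ℕ, activity d ε ^ n / (n.factorial : ℝ) * ∫ Z, restrictedTensor f₀ δ ε n Z

/-- The grand-canonical densities `W_{ε,0}^n`, so that `W_{ε,0}^n / n!` is the density of the
`n`-particle configurations. -/
def gcDensity {d : ℕ} (f₀ : Phase d → ℝ) (δ ε : ℝ) (n : ℕ) (Z : Config d n) : ℝ :=
  (partitionFunction f₀ δ ε)⁻¹ * activity d ε ^ n * restrictedTensor f₀ δ ε n Z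

/-- The `j`-particle correlation function `ρ^{(j)}` of a grand-canonical family of densities. -/
def correlation {d : ℕ} (W : (n : ℕ) → Config d n → ℝ) (j : ℕ) (Z : Config d j) : ℝ :=
  ∑' n : ℕ, ((n.factorial : ℝ))⁻¹ * ∫ Y : Config d n, W (j + n) (Fin.append Z Y)

/-- The rescaled correlation function `μ_ε^{-j} ρ^{(j)}`. -/
def rescaledCorrelation {d : ℕ} (ε : ℝ) (W : (n : ℕ) → Config d n → ℝ) (j : ℕ)
    (Z : Config d j) : ℝ :=
  (activity d ε ^ j)⁻¹ * correlation W j Z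

/-- `Z'` arises from `Z` by an elastic collision of the particles `i` and `k`: these two are at
distance exactly `ε` and are approaching each other, no other pair is in contact, the positions
are unchanged, and the velocities of `i` and `k` are reflected (`ω` represents `x_i - x_k`). -/
def IsCollision {d n : ℕ} (ε : ℝ) (i k : Fin n) (Z Z' : Config d n) : Prop :=
  i ≠ k ∧ torusDist (Z i).1 (Z k).1 = ε ∧
  (∀ a b : Fin n, a ≠ b → (a, b) ≠ (i, k) → (a, b) ≠ (k, i) →
    ε < torusDist (Z a).1 (Z b).1) ∧
  (∀ a, (Z' a).1 = (Z a).1) ∧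
  ∃ ω : EuclideanSpace ℝ (Fin d), ‖ω‖ = ε ∧ (Z i).1 = torusShift (Z k).1 ω ∧
    inner ℝ ((Z i).2 - (Z k).2) ω < 0 ∧
    (Z' i).2 = (Z i).2 - ((ε ^ 2)⁻¹ * inner ℝ ((Z i).2 - (Z k).2) ω) • ω ∧
    (Z' k).2 = (Z k).2 + ((ε ^ 2)⁻¹ * inner ℝ ((Z i).2 - (Z k).2) ω) • ω ∧
    ∀ a, a ≠ i → a ≠ k → (Z' a).2 = (Z a).2

/-- `Y` is a trajectory on `[0, T]` of the hard-sphere dynamics with diameter `ε`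
(with right-continuous velocities). There are finitely many collision times, which form `S`;
away from them all the particles are at distance larger than `ε`; between them the motion is
free; at each of them the state just before, which is obtained by free transport from any
time `s` after the previous collision, is changed by an elastic binary collision. -/
def IsHardSphereTrajectory {d n : ℕ} (ε T : ℝ) (Y : ℝ → Config d n) : Prop :=
  ∃ S : Finset ℝ, (∀ τ ∈ S, τ ∈ Set.Ioc (0 : ℝ) T) ∧
    (∀ t ∈ Set.Icc (0 : ℝ) T, t ∉ S → ∀ i k : Fin n, i ≠ k →
      ε < torusDist (Y t i).1 (Y t k).1) ∧
    (∀ s t : ℝ, 0 ≤ s → s ≤ t → t ≤ T → (∀ τ ∈ S, τ ∉ Set.Ioc s t) →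
      Y t = freeFlow (t - s) (Y s)) ∧
    (∀ τ ∈ S, ∃ i k : Fin n, ∀ s ∈ Set.Ico (0 : ℝ) τ, (∀ r ∈ S, r ∉ Set.Ioo s τ) →
      IsCollision ε i k (freeFlow (τ - s) (Y s)) (Y τ))

end HardSphere

end

/-! The state is a hard-core gas in phase space: two particles exclude each other when their free
paths come within ε during [0, δ] (`Hits`). Let 𝒵(g) be its partition function for a one-particle
weight g. Freezing particles at Z_j turns the rescaled correlation function into f₀^{⊗j}(Z_j), times
the indicator of admissibility, times 𝒵(g ∏ᵢ avoid_{zᵢ}) / 𝒵(g) with g = μ_ε f₀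
(`rescaledCorrelation_gcDensity`). Everything thus reduces to the one-particle ratios r_g(z) =
𝒵(avoid_z g) / 𝒵(g), which lie in [0, 1].

No cluster expansion is used. Differentiating log 𝒵 while the exclusion by z is switched on, the
mean value theorem gives r_g(z) = exp(-∫ 1_{z,z' collide} g(z') r_{g_s}(z') dz'), where g_s carries
a partial exclusion by z (`exists_hcRatio_eq_exp`). Were g_s replaced by g, this would be a fixed
point equation r = exp(-A_ε r). The operator A_ε integrates over a collision tube of volume about κ
ε^{d-1} |v - v'| δ, and μ_ε cancels ε^{d-1}. Hence A_ε is of order δ, sends the weight 1 + |v| to at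
most half of itself for small δ (`collisionOp_one_add_norm_le`), and converges to an operator A of
line integrals (`exists_abs_collisionInt_sub_limitOp_le`).

The replacement of g_s by g is controlled by induction. The claim is that |r - r_N| ≤ 2^{-N} (1 +
|v|) + η, where r_0 = 1 and r_{N+1} = exp(-A r_N), even if finitely many extra obstacles act,
provided that collisions with z and an obstacle at once are rare
(`exists_abs_hcRatio_sub_limitRatio_le`). Each use of the mean value identity adds z to the
obstacles; for all z' but those with velocities in a small set, simultaneous collisions with z' and
an obstacle are rare, so the induction hypothesis applies. The case N = 0 holds because both
quantities lie in [0, 1].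

The geometric input is that a third particle rarely meets two given ones. If their velocities differ
by at least K ε, their collision tubes are transversal for most third velocities and overlap in
volume O(ε^{d-1} / K), up to a term of order ε^d. If the velocities are closer but the positions are
ε |log ε| apart, the tubes are disjoint unless the third relative velocity is nearly parallel to the
separation, which is a rare event since d ≥ 2.

Without obstacles the claim gives the limit of the one-particle function; with the other particles
as obstacles it shows that freezing them barely changes a ratio, and a telescoping product of ratios
gives the factorization. Large velocities are handled by the Gaussian bound on f₀. The dynamical
statement is elementary: on the support of the state no pair reaches distance ε before time δ, so no
collision can occur. -/

open MeasureTheory Filter Topology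
open scoped ENNReal BigOperators

noncomputable section

namespace HardSphere

/-! ### The abstract hard-core gas -/

section HardCore

variable {X : Type*} {H : X → X → Prop}

/-- No two distinct particles of the configuration are related by `H`. -/
def Admissible (H : X → X → Prop) {n : ℕ} (Z : Fin n → X) : Prop :=
  ∀ i k, i ≠ k → ¬ H (Z i) (Z k)

open Classical in
/-- The factor `1 - 𝟙_H`. -/
def avoid (H : X → X → Prop) (z z' : X) : ℝ := if H z z' then 0 else 1

open Classical in
/-- The product weight `g^{⊗ n}` restricted to admissible configurations. -/
def hcWeight (H : X → X → Prop) (g : X → ℝ) (n : ℕ) (Z : Fin n → X) : ℝ :=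
  if Admissible H Z then ∏ i, g (Z i) else 0

lemma avoid_nonneg (z z' : X) : 0 ≤ avoid H z z' := by
  unfold avoid; split_ifs <;> norm_num

lemma avoid_le_one (z z' : X) : avoid H z z' ≤ 1 := by
  unfold avoid; split_ifs <;> norm_num

open Classical in
lemma prod_avoid {n : ℕ} (z : X) (Z : Fin n → X) :
    ∏ i, avoid H z (Z i) = if ∀ i, ¬ H z (Z i) then 1 else 0 := by
  split_ifs with h
  · exact Finset.prod_eq_one fun i _ => by simp [avoid, h i]
  · push Not at h
    obtain ⟨i, hi⟩ := h
    exact Finset.prod_eq_zero (Finset.mem_univ i) (by simp [avoid, hi])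

lemma hcWeight_zero (g : X → ℝ) (Z : Fin 0 → X) : hcWeight H g 0 Z = 1 := by
  simp [hcWeight, Admissible]

lemma hcWeight_nonneg {g : X → ℝ} (hg : ∀ z, 0 ≤ g z) (n : ℕ) (Z : Fin n → X) :
    0 ≤ hcWeight H g n Z := by
  unfold hcWeight; split_ifs
  exacts [Finset.prod_nonneg fun i _ => hg _, le_rfl]

lemma abs_hcWeight_le (g : X → ℝ) (n : ℕ) (Z : Fin n → X) :
    |hcWeight H g n Z| ≤ ∏ i, |g (Z i)| := by
  unfold hcWeight; split_ifs
  · rw [Finset.abs_prod]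
  · simpa using Finset.prod_nonneg fun i _ => abs_nonneg (g (Z i))

lemma hcWeight_mono {g g' : X → ℝ} (hg : ∀ z, 0 ≤ g z) (h : ∀ z, g z ≤ g' z) (n : ℕ)
    (Z : Fin n → X) : hcWeight H g n Z ≤ hcWeight H g' n Z := by
  unfold hcWeight; split_ifs
  exacts [Finset.prod_le_prod (fun i _ => hg _) (fun i _ => h _), le_rfl]

lemma admissible_insertNth (hs : ∀ z z', H z z' → H z' z) {n : ℕ} (i : Fin (n + 1)) (z : X)
    (Z : Fin n → X) :
    Admissible H (i.insertNth z Z : Fin (n + 1) → X) ↔ (∀ k, ¬ H z (Z k)) ∧ Admissible H Z := by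
  constructor
  · intro h
    refine ⟨fun k => ?_, fun k l hkl => ?_⟩
    · simpa using h i (i.succAbove k) (Fin.succAbove_ne i k).symm
    · simpa using h (i.succAbove k) (i.succAbove l) (by simpa using hkl)
  · rintro ⟨h1, h2⟩ a b hab
    rcases Fin.eq_self_or_eq_succAbove i a with ha | ⟨a', rfl⟩ <;>
    rcases Fin.eq_self_or_eq_succAbove i b with hb | ⟨b', rfl⟩
    · exact absurd (ha.trans hb.symm) hab
    · subst ha; simpa using h1 b'
    · subst hb; simpa using fun h => h1 a' (hs _ _ h)
    · simpa using h2 a' b' (by rintro rfl; exact hab rfl)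

open Classical in
lemma hcWeight_avoid_mul (g : X → ℝ) (n : ℕ) (z : X) (Z : Fin n → X) :
    hcWeight H (fun z' => avoid H z z' * g z') n Z =
      if (∀ k, ¬ H z (Z k)) ∧ Admissible H Z then ∏ i, g (Z i) else 0 := by
  unfold hcWeight
  rw [Finset.prod_mul_distrib, prod_avoid]
  by_cases h1 : ∀ k, ¬ H z (Z k) <;> by_cases h2 : Admissible H Z <;> simp [h1, h2]

variable [MeasureSpace X]

lemma measurableSet_admissible (hm : MeasurableSet {p : X × X | H p.1 p.2}) (n : ℕ) :
    MeasurableSet {Z : Fin n → X | Admissible H Z} := by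
  have : {Z : Fin n → X | Admissible H Z} =
      ⋂ i, ⋂ k, ⋂ (_ : i ≠ k), {Z : Fin n → X | H (Z i) (Z k)}ᶜ := by
    ext Z; simp [Admissible]
  rw [this]
  refine MeasurableSet.iInter fun i => MeasurableSet.iInter fun k => MeasurableSet.iInter fun _ => ?_
  have h : Measurable fun Z : Fin n → X => (Z i, Z k) :=
    (measurable_pi_apply i).prodMk (measurable_pi_apply k)
  exact (h hm).compl

lemma measurable_avoid (hm : MeasurableSet {p : X × X | H p.1 p.2}) :
    Measurable fun p : X × X => avoid H p.1 p.2 :=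
  Measurable.ite hm measurable_const measurable_const

lemma measurable_avoid_right (hm : MeasurableSet {p : X × X | H p.1 p.2}) (z : X) :
    Measurable (avoid H z) :=
  (measurable_avoid hm).comp measurable_prodMk_left

lemma measurable_hcWeight (hm : MeasurableSet {p : X × X | H p.1 p.2}) {g : X → ℝ}
    (hg : Measurable g) (n : ℕ) : Measurable (hcWeight H g n) := by
  refine Measurable.ite (measurableSet_admissible hm n) ?_ measurable_const
  exact Finset.measurable_prod _ fun i _ => hg.comp (measurable_pi_apply i)

lemma measurable_hcWeight_param {Y : Type*} [MeasurableSpace Y]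
    (hm : MeasurableSet {p : X × X | H p.1 p.2}) {g : Y → X → ℝ}
    (hg : Measurable (Function.uncurry g)) (n : ℕ) :
    Measurable fun p : Y × (Fin n → X) => hcWeight H (g p.1) n p.2 := by
  refine Measurable.ite (measurable_snd (measurableSet_admissible hm n)) ?_ measurable_const
  refine Finset.measurable_prod _ fun i _ => ?_
  exact hg.comp (measurable_fst.prodMk ((measurable_pi_apply i).comp measurable_snd))

lemma integrable_avoid_mul (hm : MeasurableSet {p : X × X | H p.1 p.2}) {g : X → ℝ}
    (hi : Integrable g) (z : X) : Integrable fun z' => avoid H z z' * g z' :=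
  hi.bdd_mul (c := 1) (measurable_avoid_right hm z).aestronglyMeasurable
    (Eventually.of_forall fun z' => by
      rw [Real.norm_eq_abs, abs_of_nonneg (avoid_nonneg _ _)]; exact avoid_le_one _ _)

lemma integral_abs_avoid_mul_le (hm : MeasurableSet {p : X × X | H p.1 p.2}) {g : X → ℝ}
    (hi : Integrable g) (z : X) : ∫ z', |avoid H z z' * g z'| ≤ ∫ z', |g z'| := by
  refine integral_mono (integrable_avoid_mul hm hi z).abs hi.abs fun z' => ?_
  simp only [abs_mul, abs_of_nonneg (avoid_nonneg z z')]
  exact mul_le_of_le_one_left (abs_nonneg _) (avoid_le_one _ _)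

variable [SigmaFinite (volume : Measure X)]

/-- The grand-canonical partition function of the hard-core gas with weight `g`. -/
def hcPartition (H : X → X → Prop) (g : X → ℝ) : ℝ :=
  ∑' n : ℕ, ((n.factorial : ℝ))⁻¹ * ∫ Z, hcWeight H g n Z

lemma integrable_hcWeight (hm : MeasurableSet {p : X × X | H p.1 p.2}) {g : X → ℝ}
    (hg : Measurable g) (hi : Integrable g) (n : ℕ) : Integrable (hcWeight H g n) := by
  refine Integrable.mono' (g := fun Z => ∏ i, |g (Z i)|)
    (Integrable.fintype_prod (f := fun _ z => |g z|) fun _ => hi.abs)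
    (measurable_hcWeight hm hg n).aestronglyMeasurable
    (Eventually.of_forall fun Z => ?_)
  rw [Real.norm_eq_abs]; exact abs_hcWeight_le g n Z

lemma integral_abs_hcWeight_le (hm : MeasurableSet {p : X × X | H p.1 p.2}) {g : X → ℝ}
    (hg : Measurable g) (hi : Integrable g) (n : ℕ) :
    ∫ Z, |hcWeight H g n Z| ≤ (∫ z, |g z|) ^ n := by
  calc ∫ Z, |hcWeight H g n Z| ≤ ∫ Z : Fin n → X, ∏ i, |g (Z i)| :=
        integral_mono (integrable_hcWeight hm hg hi n).abs
          (Integrable.fintype_prod (f := fun _ z => |g z|) fun _ => hi.abs)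
          (fun Z => abs_hcWeight_le g n Z)
    _ = _ := by rw [integral_fintype_prod_volume_eq_pow (fun z => |g z|)]; simp

lemma abs_integral_hcWeight_le (hm : MeasurableSet {p : X × X | H p.1 p.2}) {g : X → ℝ}
    (hg : Measurable g) (hi : Integrable g) (n : ℕ) :
    |∫ Z, hcWeight H g n Z| ≤ (∫ z, |g z|) ^ n :=
  abs_integral_le_integral_abs.trans (integral_abs_hcWeight_le hm hg hi n)

lemma summable_hcPartition (hm : MeasurableSet {p : X × X | H p.1 p.2}) {g : X → ℝ}
    (hg : Measurable g) (hi : Integrable g) :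
    Summable fun n : ℕ => ((n.factorial : ℝ))⁻¹ * ∫ Z, hcWeight H g n Z := by
  refine Summable.of_norm_bounded (Real.summable_pow_div_factorial (∫ z, |g z|)) fun n => ?_
  rw [Real.norm_eq_abs, abs_mul, abs_of_nonneg (by positivity : (0:ℝ) ≤ (n.factorial : ℝ)⁻¹),
    div_eq_inv_mul]
  exact mul_le_mul_of_nonneg_left (abs_integral_hcWeight_le hm hg hi n) (by positivity)

omit [SigmaFinite (volume : Measure X)] in
lemma integral_hcWeight_zero (g : X → ℝ) : ∫ Z, hcWeight H g 0 Z = 1 := by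
  simp only [hcWeight_zero, integral_const, smul_eq_mul, mul_one]
  simp [Measure.real, volume_pi]

lemma one_le_hcPartition (hm : MeasurableSet {p : X × X | H p.1 p.2}) {g : X → ℝ}
    (hg : Measurable g) (hi : Integrable g) (h0 : ∀ z, 0 ≤ g z) : 1 ≤ hcPartition H g := by
  have := (summable_hcPartition hm hg hi).le_tsum 0 (fun n _ =>
    mul_nonneg (by positivity) (integral_nonneg (hcWeight_nonneg h0 n)))
  rw [integral_hcWeight_zero] at this
  simpa [hcPartition] using this

lemma hcPartition_mono (hm : MeasurableSet {p : X × X | H p.1 p.2}) {g g' : X → ℝ}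
    (hg : Measurable g) (hi : Integrable g) (hg' : Measurable g') (hi' : Integrable g')
    (h0 : ∀ z, 0 ≤ g z) (h : ∀ z, g z ≤ g' z) : hcPartition H g ≤ hcPartition H g' := by
  refine (summable_hcPartition hm hg hi).tsum_le_tsum (fun n => ?_) (summable_hcPartition hm hg' hi')
  exact mul_le_mul_of_nonneg_left (integral_mono (integrable_hcWeight hm hg hi n)
    (integrable_hcWeight hm hg' hi' n) (hcWeight_mono h0 h n)) (by positivity)

lemma measurable_hcPartition_param {Y : Type*} [MeasurableSpace Y]
    (hm : MeasurableSet {p : X × X | H p.1 p.2}) {g : Y → X → ℝ}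
    (hg : Measurable (Function.uncurry g)) :
    Measurable fun y => hcPartition H (g y) := by
  refine Measurable.tsum fun n => Measurable.const_mul ?_ _
  exact (StronglyMeasurable.integral_prod_right (f := fun y Z => hcWeight H (g y) n Z)
    (measurable_hcWeight_param hm hg n).stronglyMeasurable).measurable

end HardCore

end HardSphere
end

/-! ### Directional derivatives of the partition function -/

open MeasureTheory Filter Topology
open scoped ENNReal BigOperators

noncomputable section

namespace HardSphere

section HardCore

variable {X : Type*} {H : X → X → Prop}

/-- The derivative along `h` of the product weight, as a sum over the differentiated factor. -/
def hcVariation (H : X → X → Prop) (g h : X → ℝ) (n : ℕ) (i : Fin (n + 1))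
    (Z : Fin (n + 1) → X) : ℝ :=
  -- With constant weight 1, `hcWeight` is the indicator of the admissible configurations.
  h (Z i) * (∏ k, g (Z (i.succAbove k))) * hcWeight H (fun _ => 1) (n + 1) Z

lemma prod_erase_eq_prod_succAbove {n : ℕ} (f : Fin (n + 1) → ℝ) (i : Fin (n + 1)) :
    ∏ j ∈ Finset.univ.erase i, f j = ∏ k, f (i.succAbove k) := by
  rw [← Finset.compl_singleton, ← Fin.image_succAbove_univ, Finset.prod_image]
  exact fun a _ b _ h => Fin.succAbove_right_injective h

lemma hasDerivAt_hcWeight (g h : X → ℝ) (n : ℕ) (Z : Fin (n + 1) → X) (s : ℝ) :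
    HasDerivAt (fun s => hcWeight H (fun z => g z + s * h z) (n + 1) Z)
      (∑ i, hcVariation H (fun z => g z + s * h z) h n i Z) s := by
  unfold hcVariation hcWeight
  split_ifs with hZ
  · refine (HasDerivAt.fun_finsetProd (u := Finset.univ) (x := s)
      (f := fun (i : Fin (n + 1)) s => g (Z i) + s * h (Z i)) (f' := fun i => h (Z i))
      (fun i _ => by
        simpa using ((hasDerivAt_id s).mul_const (h (Z i))).const_add (g (Z i)))).congr_deriv ?_
    refine Finset.sum_congr rfl fun i _ => ?_
    rw [prod_erase_eq_prod_succAbove (fun j => g (Z j) + s * h (Z j)), smul_eq_mul]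
    simp [mul_comm]
  · simpa using hasDerivAt_const s (0 : ℝ)

lemma abs_hcVariation_le (g h : X → ℝ) (n : ℕ) (i : Fin (n + 1)) (Z : Fin (n + 1) → X) :
    |hcVariation H g h n i Z| ≤ |h (Z i)| * ∏ k, |g (Z (i.succAbove k))| := by
  unfold hcVariation
  rw [abs_mul, abs_mul, Finset.abs_prod]
  refine mul_le_of_le_one_right (by positivity) ?_
  exact (abs_hcWeight_le _ _ _).trans (by simp)

/-- Once particle `i` is frozen at `z`, its exclusions act on each remaining particle separately and
can be absorbed in the one-particle weight. This is why derivatives of partition functions are again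
partition functions. -/
lemma hcVariation_insertNth (hs : ∀ z z', H z z' → H z' z) (g h : X → ℝ) (n : ℕ)
    (i : Fin (n + 1)) (z : X) (Z : Fin n → X) :
    hcVariation H g h n i (i.insertNth z Z) =
      h z * hcWeight H (fun z' => avoid H z z' * g z') n Z := by
  rw [hcWeight_avoid_mul, hcVariation, hcWeight, admissible_insertNth hs]
  split_ifs <;> simp

variable [MeasureSpace X]

lemma measurable_hcVariation (hm : MeasurableSet {p : X × X | H p.1 p.2}) {g h : X → ℝ}
    (hg : Measurable g) (hh : Measurable h) (n : ℕ) (i : Fin (n + 1)) :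
    Measurable (hcVariation H g h n i) := by
  refine Measurable.mul (Measurable.mul (hh.comp (measurable_pi_apply i)) ?_)
    (measurable_hcWeight hm measurable_const _)
  exact Finset.measurable_prod _ fun k _ => hg.comp (measurable_pi_apply _)

variable [SigmaFinite (volume : Measure X)]

lemma integral_insertNth {n : ℕ} (i : Fin (n + 1)) (F : (Fin (n + 1) → X) → ℝ)
    (hF : Integrable F) :
    ∫ Z, F Z = ∫ z : X, ∫ Z : Fin n → X, F (i.insertNth z Z) := by
  have h := (volume_preserving_piFinSuccAbove (fun _ : Fin (n + 1) => X) i).symm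
  rw [← h.integral_comp', Measure.volume_eq_prod, integral_prod]
  · simp [MeasurableEquiv.piFinSuccAbove_symm_apply, Fin.insertNthEquiv]
  · exact (h.integrable_comp_emb (MeasurableEquiv.measurableEmbedding _)).2 hF

lemma integrable_mul_prod_succAbove {g h : X → ℝ} (hg : Integrable g) (hh : Integrable h)
    {n : ℕ} (i : Fin (n + 1)) :
    Integrable fun Z : Fin (n + 1) → X => h (Z i) * ∏ k, g (Z (i.succAbove k)) := by
  have := Integrable.fintype_prod (ι := Fin (n + 1)) (E := X) (μ := fun _ => volume)
    (f := fun j => if j = i then h else g) (fun j => by split_ifs <;> assumption)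
  refine this.congr (Eventually.of_forall fun Z => ?_)
  simp [Fin.prod_univ_succAbove _ i]

lemma integrable_hcVariation (hm : MeasurableSet {p : X × X | H p.1 p.2}) {g h : X → ℝ}
    (hg : Measurable g) (hgi : Integrable g) (hh : Measurable h) (hhi : Integrable h) (n : ℕ)
    (i : Fin (n + 1)) : Integrable (hcVariation H g h n i) :=
  Integrable.mono' (integrable_mul_prod_succAbove hgi.abs hhi.abs i)
    (measurable_hcVariation hm hg hh n i).aestronglyMeasurable
    (Eventually.of_forall fun Z => abs_hcVariation_le g h n i Z)

lemma integral_hcVariation (hs : ∀ z z', H z z' → H z' z)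
    (hm : MeasurableSet {p : X × X | H p.1 p.2}) {g h : X → ℝ}
    (hg : Measurable g) (hgi : Integrable g) (hh : Measurable h) (hhi : Integrable h) (n : ℕ)
    (i : Fin (n + 1)) : ∫ Z, hcVariation H g h n i Z =
      ∫ z, h z * ∫ Z, hcWeight H (fun z' => avoid H z z' * g z') n Z := by
  rw [integral_insertNth i _ (integrable_hcVariation hm hg hgi hh hhi n i)]
  simp_rw [hcVariation_insertNth hs, integral_const_mul]

/-- By symmetry each of the n + 1 differentiated factors contributes the same integral; the
resulting factor n + 1 later turns 1/(n+1)! into 1/n!. -/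
lemma hasDerivAt_integral_hcWeight (hs : ∀ z z', H z z' → H z' z)
    (hm : MeasurableSet {p : X × X | H p.1 p.2}) {g h : X → ℝ}
    (hg : Measurable g) (hgi : Integrable g) (hh : Measurable h) (hhi : Integrable h) (n : ℕ)
    (s : ℝ) :
    HasDerivAt (fun s => ∫ Z, hcWeight H (fun z => g z + s * h z) (n + 1) Z)
      ((n + 1) * ∫ z, h z * ∫ Z, hcWeight H (fun z' => avoid H z z' * (g z' + s * h z')) n Z)
      s := by
  have hgs : ∀ s : ℝ, Measurable fun z => g z + s * h z := fun s => hg.add (hh.const_mul s)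
  have hgsi : ∀ s : ℝ, Integrable fun z => g z + s * h z := fun s => hgi.add (hhi.const_mul s)
  have key := (hasDerivAt_integral_of_dominated_loc_of_deriv_le (μ := volume)
    (F := fun s Z => hcWeight H (fun z => g z + s * h z) (n + 1) Z) (x₀ := s)
    (F' := fun s Z => ∑ i, hcVariation H (fun z => g z + s * h z) h n i Z)
    (s := Metric.ball s 1)
    -- For |t - s| < 1 one has |g + t h| ≤ |g| + (|s| + 1) |h|, which gives an integrable majorant
    -- independent of t.
    (bound := fun Z => ∑ i, |h (Z i)| * ∏ k, (|g (Z (i.succAbove k))|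
      + (|s| + 1) * |h (Z (i.succAbove k))|))
    (Metric.ball_mem_nhds s one_pos)
    (Eventually.of_forall fun s => (measurable_hcWeight hm (hgs s) _).aestronglyMeasurable)
    (integrable_hcWeight hm (hgs s) (hgsi s) _)
    (Finset.measurable_sum _ fun i _ =>
      measurable_hcVariation hm (hgs s) hh n i).aestronglyMeasurable
    (Eventually.of_forall fun Z t ht => ?_)
    (integrable_finsetSum _ fun i _ => integrable_mul_prod_succAbove
      (g := fun z => |g z| + (|s| + 1) * |h z|) (hgi.abs.add (hhi.abs.const_mul _)) hhi.abs i)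
    (Eventually.of_forall fun Z t _ => hasDerivAt_hcWeight g h n Z t)).2
  · refine key.congr_deriv ?_
    rw [integral_finsetSum _ fun i _ => integrable_hcVariation hm (hgs s) (hgsi s) hh hhi n i]
    simp_rw [integral_hcVariation hs hm (hgs s) (hgsi s) hh hhi]
    simp
  · refine (Finset.abs_sum_le_sum_abs _ _).trans (Finset.sum_le_sum fun i _ => ?_)
    refine (abs_hcVariation_le _ _ _ _ _).trans ?_
    refine mul_le_mul_of_nonneg_left (Finset.prod_le_prod (fun _ _ => abs_nonneg _) fun k _ => ?_)
      (abs_nonneg _)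
    refine (abs_add_le _ _).trans ?_
    rw [abs_mul]
    gcongr
    have : |t - s| < 1 := by simpa [Real.dist_eq] using ht
    have := abs_sub_abs_le_abs_sub t s
    linarith

/-- Termwise differentiation, with derivatives dominated by a shifted exponential series; summing
over n inside the integral reassembles the partition function of the gas with one particle frozen at
`z`. -/
lemma hasDerivAt_hcPartition (hs : ∀ z z', H z z' → H z' z)
    (hm : MeasurableSet {p : X × X | H p.1 p.2}) {g h : X → ℝ}
    (hg : Measurable g) (hgi : Integrable g) (hh : Measurable h) (hhi : Integrable h) (s : ℝ) :
    HasDerivAt (fun s => hcPartition H (fun z => g z + s * h z))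
      (∫ z, h z * hcPartition H (fun z' => avoid H z z' * (g z' + s * h z'))) s := by
  have hgs : ∀ s : ℝ, Measurable fun z => g z + s * h z := fun s => hg.add (hh.const_mul s)
  have hgsi : ∀ s : ℝ, Integrable fun z => g z + s * h z := fun s => hgi.add (hhi.const_mul s)
  have hav : ∀ (s : ℝ) (z : X), Measurable fun z' => avoid H z z' * (g z' + s * h z') :=
    fun s z => (measurable_avoid_right hm z).mul (hgs s)
  have havi : ∀ (s : ℝ) (z : X), Integrable fun z' => avoid H z z' * (g z' + s * h z') :=
    fun s z => integrable_avoid_mul hm (hgsi s) z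
  have hunc : ∀ s : ℝ, Measurable (Function.uncurry fun z z' => avoid H z z' * (g z' + s * h z')) :=
    fun s => (measurable_avoid hm).mul ((hgs s).comp measurable_snd)
  set J : ℕ → ℝ → ℝ := fun n s =>
    ∫ z, h z * ∫ Z, hcWeight H (fun z' => avoid H z z' * (g z' + s * h z')) n Z with hJ
  set M : ℝ := (∫ z, |g z|) + (|s| + 1) * ∫ z, |h z| with hM
  have hM0 : 0 ≤ M := add_nonneg (integral_nonneg fun _ => abs_nonneg _)
    (mul_nonneg (by positivity) (integral_nonneg fun _ => abs_nonneg _))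
  have hgM : ∀ t ∈ Metric.ball s 1, ∫ z, |g z + t * h z| ≤ M := by
    intro t ht
    have : |t - s| < 1 := by simpa [Real.dist_eq] using ht
    have := abs_sub_abs_le_abs_sub t s
    calc ∫ z, |g z + t * h z| ≤ ∫ z, (|g z| + (|s| + 1) * |h z|) := by
          refine integral_mono (hgsi t).abs (hgi.abs.add (hhi.abs.const_mul _)) fun z => ?_
          refine (abs_add_le _ _).trans ?_
          rw [abs_mul]
          have := abs_nonneg (h z)
          gcongr
          linarith
      _ = M := by rw [integral_add hgi.abs (hhi.abs.const_mul _), integral_const_mul]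
  have hin : ∀ (t : ℝ) (z : X) (n : ℕ), t ∈ Metric.ball s 1 →
      |∫ Z, hcWeight H (fun z' => avoid H z z' * (g z' + t * h z')) n Z| ≤ M ^ n := by
    intro t z n ht
    refine (abs_integral_hcWeight_le hm (hav t z) (havi t z) n).trans ?_
    exact pow_le_pow_left₀ (integral_nonneg fun _ => abs_nonneg _)
      ((integral_abs_avoid_mul_le hm (hgsi t) z).trans (hgM t ht)) n
  have hmeas : ∀ (t : ℝ) (n : ℕ), Measurable fun z =>
      ∫ Z, hcWeight H (fun z' => avoid H z z' * (g z' + t * h z')) n Z := fun t n =>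
    (StronglyMeasurable.integral_prod_right
      (f := fun z Z => hcWeight H (fun z' => avoid H z z' * (g z' + t * h z')) n Z)
      (measurable_hcWeight_param hm (hunc t) n).stronglyMeasurable).measurable
  have hint : ∀ (t : ℝ) (n : ℕ), t ∈ Metric.ball s 1 → Integrable fun z =>
      h z * ∫ Z, hcWeight H (fun z' => avoid H z z' * (g z' + t * h z')) n Z := fun t n ht =>
    hhi.mul_bdd (c := M ^ n) (hmeas t n).aestronglyMeasurable
      (Eventually.of_forall fun z => hin t z n ht)
  have hJb : ∀ (t : ℝ) (n : ℕ), t ∈ Metric.ball s 1 →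
      ∫ z, |h z * ∫ Z, hcWeight H (fun z' => avoid H z z' * (g z' + t * h z')) n Z|
        ≤ (∫ z, |h z|) * M ^ n := by
    intro t n ht
    rw [← integral_mul_const]
    refine integral_mono (hint t n ht).abs (hhi.abs.mul_const _) fun z => ?_
    simp only [abs_mul]
    exact mul_le_mul_of_nonneg_left (hin t z n ht) (abs_nonneg _)
  have hsmem : s ∈ Metric.ball s 1 := Metric.mem_ball_self one_pos
  have hsum : Summable fun n : ℕ => (∫ z, |h z|) * (M ^ n / n.factorial) :=
    (Real.summable_pow_div_factorial M).mul_left _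
  -- The term n = 0 is the constant 1, so its derivative is 0, and the derivative of term m + 1
  -- carries 1/m!; hence the case distinctions in `g'` and `u`.
  have key := hasDerivAt_tsum_of_isPreconnected
    (g := fun (n : ℕ) t => ((n.factorial : ℝ))⁻¹ * ∫ Z, hcWeight H (fun z => g z + t * h z) n Z)
    (g' := fun (n : ℕ) t => Nat.casesOn n 0 fun m => ((m.factorial : ℝ))⁻¹ * J m t)
    (u := fun n : ℕ => Nat.casesOn n 0 fun m => (∫ z, |h z|) * (M ^ m / m.factorial))
    (t := Metric.ball s 1) ((summable_nat_add_iff 1).1 hsum)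
    Metric.isOpen_ball (convex_ball s 1).isPreconnected ?_ ?_ hsmem
    (summable_hcPartition hm (hgs s) (hgsi s)) hsmem
  · refine key.congr_deriv ?_
    have hs1 : Summable fun n : ℕ => (Nat.casesOn n 0 fun m => ((m.factorial : ℝ))⁻¹ * J m s : ℝ) := by
      refine (summable_nat_add_iff 1).1 (Summable.of_norm_bounded hsum fun n => ?_)
      rw [Real.norm_eq_abs, abs_mul, abs_of_nonneg (by positivity : (0:ℝ) ≤ (n.factorial : ℝ)⁻¹)]
      calc _ ≤ ((n.factorial : ℝ))⁻¹ * ((∫ z, |h z|) * M ^ n) :=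
            mul_le_mul_of_nonneg_left (abs_integral_le_integral_abs.trans (hJb s n hsmem))
              (by positivity)
        _ = _ := by ring
    rw [hs1.tsum_eq_zero_add]
    set F : ℕ → X → ℝ := fun n z => ((n.factorial : ℝ))⁻¹ *
        (h z * ∫ Z, hcWeight H (fun z' => avoid H z z' * (g z' + s * h z')) n Z) with hF
    have hFs : Summable fun n => ∫ z, ‖F n z‖ := by
      refine Summable.of_nonneg_of_le (fun n => integral_nonneg fun _ => norm_nonneg _)
        (fun n => ?_) hsum
      simp_rw [hF, norm_mul, Real.norm_eq_abs, integral_const_mul,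
        abs_of_nonneg (by positivity : (0:ℝ) ≤ (n.factorial : ℝ)⁻¹), ← abs_mul]
      calc _ ≤ ((n.factorial : ℝ))⁻¹ * ((∫ z, |h z|) * M ^ n) :=
            mul_le_mul_of_nonneg_left (hJb s n hsmem) (by positivity)
        _ = _ := by ring
    have hFt : ∑' n, ∫ z, F n z = ∫ z, ∑' n, F n z :=
      (hasSum_integral_of_summable_integral_norm
        (fun n => (hint s n hsmem).const_mul _) hFs).tsum_eq
    calc _ = ∑' n, ∫ z, F n z := by
          exact (zero_add _).trans (tsum_congr fun n => (integral_const_mul _ _).symm)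
      _ = _ := by
          rw [hFt]
          refine integral_congr_ae (Eventually.of_forall fun z => ?_)
          simp only [hcPartition, hF]
          rw [← tsum_mul_left]
          exact tsum_congr fun n => by ring
  · rintro (_ | n) t ht
    · simp only [integral_hcWeight_zero]
      exact hasDerivAt_const _ _
    · have := (hasDerivAt_integral_hcWeight hs hm hg hgi hh hhi n t).const_mul
        (((n + 1).factorial : ℝ))⁻¹
      refine this.congr_deriv ?_
      rw [Nat.factorial_succ]
      push_cast
      field_simp
      rfl
  · rintro (_ | n) t ht
    · simp
    · simp only [Real.norm_eq_abs]
      rw [abs_mul, abs_of_nonneg (by positivity : (0:ℝ) ≤ (n.factorial : ℝ)⁻¹)]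
      calc _ ≤ ((n.factorial : ℝ))⁻¹ * ((∫ z, |h z|) * M ^ n) :=
            mul_le_mul_of_nonneg_left (abs_integral_le_integral_abs.trans (hJb t n ht))
              (by positivity)
        _ = _ := by ring

end HardCore

end HardSphere
end

/-! ### Ratios of partition functions: the mean value identity and factorization -/

open MeasureTheory Filter Topology
open scoped ENNReal BigOperators

noncomputable section

namespace HardSphere

section HardCore

variable {X : Type*} {H : X → X → Prop}

lemma admissible_append (hs : ∀ z z', H z z' → H z' z) {j n : ℕ} (Z : Fin j → X) (Y : Fin n → X) :
    Admissible H (Fin.append Z Y) ↔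
      Admissible H Z ∧ Admissible H Y ∧ ∀ i k, ¬ H (Z i) (Y k) := by
  constructor
  · intro h
    refine ⟨fun i k hik => ?_, fun i k hik => ?_, fun i k => ?_⟩
    · simpa using h (Fin.castAdd n i) (Fin.castAdd n k) (by simpa using hik)
    · simpa using h (Fin.natAdd j i) (Fin.natAdd j k) (by simpa using hik)
    · simpa using h (Fin.castAdd n i) (Fin.natAdd j k) (by
        intro h; have := congrArg Fin.val h; simp at this; omega)
  · rintro ⟨h1, h2, h3⟩ a b
    refine Fin.addCases (fun a => ?_) (fun a => ?_) a <;>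
      refine Fin.addCases (fun b => ?_) (fun b => ?_) b <;> intro hab <;> simp only [Fin.append_left,
        Fin.append_right]
    · exact h1 a b (by rintro rfl; exact hab rfl)
    · exact h3 a b
    · exact fun h => h3 b a (hs _ _ h)
    · exact h2 a b (by rintro rfl; exact hab rfl)

-- The exclusions between the frozen and the free particles factor over the free ones, so they only
-- modify the weight of the latter. Summed over n, this exhibits the correlation functions as ratios
-- of partition functions.
open Classical in
lemma hcWeight_append (hs : ∀ z z', H z z' → H z' z) (g : X → ℝ) {j n : ℕ} (Z : Fin j → X)
    (Y : Fin n → X) : hcWeight H g (j + n) (Fin.append Z Y) =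
      hcWeight H g j Z * hcWeight H (fun w => (∏ i, avoid H (Z i) w) * g w) n Y := by
  unfold hcWeight
  rw [admissible_append hs, Finset.prod_mul_distrib, Finset.prod_comm, Fin.prod_univ_add]
  simp_rw [prod_avoid]
  by_cases h3 : ∀ i k, ¬ H (Z i) (Y k)
  · have : ∏ i : Fin j, (if ∀ k, ¬ H (Z i) (Y k) then (1 : ℝ) else 0) = 1 :=
      Finset.prod_eq_one fun i _ => by simp [h3 i]
    rw [this]
    by_cases h1 : Admissible H Z <;> by_cases h2 : Admissible H Y <;> simp [h1, h2, h3]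
  · have : ∏ i : Fin j, (if ∀ k, ¬ H (Z i) (Y k) then (1 : ℝ) else 0) = 0 := by
      push Not at h3
      obtain ⟨i, k, hik⟩ := h3
      exact Finset.prod_eq_zero (Finset.mem_univ i) (if_neg fun h => h k hik)
    rw [this]
    simp [h3]

variable [MeasureSpace X] [SigmaFinite (volume : Measure X)]

omit [SigmaFinite (volume : Measure X)] in
lemma tsum_integral_hcWeight_append (hs : ∀ z z', H z z' → H z' z) (g : X → ℝ) {j : ℕ}
    (Z : Fin j → X) :
    ∑' n : ℕ, ((n.factorial : ℝ))⁻¹ * ∫ Y : Fin n → X, hcWeight H g (j + n) (Fin.append Z Y) =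
      hcWeight H g j Z * hcPartition H (fun w => (∏ i, avoid H (Z i) w) * g w) := by
  simp_rw [hcWeight_append hs, integral_const_mul, hcPartition]
  rw [← tsum_mul_left]
  exact tsum_congr fun n => by ring

/-- The ratio of the partition functions with and without a particle frozen at `z`. -/
def hcRatio (H : X → X → Prop) (g : X → ℝ) (z : X) : ℝ :=
  hcPartition H (fun w => avoid H z w * g w) / hcPartition H g

section

variable (hm : MeasurableSet {p : X × X | H p.1 p.2}) {g : X → ℝ}
  (hg : Measurable g) (hgi : Integrable g) (h0 : ∀ z, 0 ≤ g z)

include hm hg hgi h0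

lemma hcPartition_pos : 0 < hcPartition H g :=
  one_pos.trans_le (one_le_hcPartition hm hg hgi h0)

lemma hcRatio_nonneg (z : X) : 0 ≤ hcRatio H g z :=
  div_nonneg (hcPartition_pos hm ((measurable_avoid_right hm z).mul hg)
    (integrable_avoid_mul hm hgi z) fun w => mul_nonneg (avoid_nonneg _ _) (h0 w)).le
    (hcPartition_pos hm hg hgi h0).le

lemma hcRatio_le_one (z : X) : hcRatio H g z ≤ 1 :=
  div_le_one_of_le₀ (hcPartition_mono hm ((measurable_avoid_right hm z).mul hg)
    (integrable_avoid_mul hm hgi z) hg hgi (fun w => mul_nonneg (avoid_nonneg _ _) (h0 w))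
    fun w => mul_le_of_le_one_left (h0 w) (avoid_le_one _ _))
    (hcPartition_pos hm hg hgi h0).le

omit hgi h0 in
lemma measurable_hcRatio : Measurable (hcRatio H g) :=
  (measurable_hcPartition_param (g := fun z w => avoid H z w * g w) hm
    ((measurable_avoid hm).mul (hg.comp measurable_snd))).div_const _

/-- The mean value theorem for the logarithm of the partition function, when the exclusion by a
particle at `z` is switched on. -/
theorem exists_hcRatio_eq_exp (hs : ∀ z z', H z z' → H z' z) (z : X) :
    ∃ s ∈ Set.Ioo (0 : ℝ) 1, hcRatio H g z = Real.exp (-∫ z', (1 - avoid H z z') * g z' *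
      hcRatio H (fun w => (1 - s * (1 - avoid H z w)) * g w) z') := by
  -- The segment g + s h runs from g at s = 0 to avoid_z · g at s = 1.
  set h : X → ℝ := fun w => -((1 - avoid H z w) * g w) with hh
  have hav : Integrable fun w => (1 - avoid H z w) * g w :=
    (hgi.sub (integrable_avoid_mul hm hgi z)).congr (Eventually.of_forall fun w => by
      simp only [Pi.sub_apply]; ring)
  have havm : Measurable fun w => (1 - avoid H z w) * g w :=
    (measurable_const.sub (measurable_avoid_right hm z)).mul hg
  have hhm : Measurable h := havm.neg
  have hhi : Integrable h := hav.neg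
  have hgh : ∀ s : ℝ, (fun w => g w + s * h w) = fun w => (1 - s * (1 - avoid H z w)) * g w :=
    fun s => by ext w; simp only [hh]; ring
  have hpos : ∀ s ∈ Set.Icc (0 : ℝ) 1, 0 < hcPartition H (fun w => g w + s * h w) := by
    intro s hs'
    refine hcPartition_pos hm (hg.add (hhm.const_mul s)) (hgi.add (hhi.const_mul s)) fun w => ?_
    rw [congrFun (hgh s) w]
    refine mul_nonneg ?_ (h0 w)
    have h1 := avoid_nonneg (H := H) z w
    have h2 := avoid_le_one (H := H) z w
    nlinarith [hs'.1, hs'.2]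
  have hder : ∀ s ∈ Set.Icc (0 : ℝ) 1,
      HasDerivAt (fun s => Real.log (hcPartition H (fun w => g w + s * h w)))
        ((∫ z', h z' * hcPartition H (fun w => avoid H z' w * (g w + s * h w))) /
          hcPartition H (fun w => g w + s * h w)) s := fun s hs' =>
    (hasDerivAt_hcPartition hs hm hg hgi hhm hhi s).log (hpos s hs').ne'
  -- The slope of log 𝒵 over [0, 1] is the logarithm of the ratio. At the intermediate s, dividing
  -- the derivative by 𝒵(g + s h) turns its integrand into h times the ratio for the intermediate
  -- weight.
  obtain ⟨s, hs', he⟩ := exists_hasDerivAt_eq_slope _ _ one_pos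
    (fun s hs' => (hder s hs').continuousAt.continuousWithinAt)
    fun s hs' => hder s (Set.Ioo_subset_Icc_self hs')
  refine ⟨s, hs', ?_⟩
  have e0 : (fun w => g w + 0 * h w) = g := by ext; simp
  have e1 : (fun w => g w + 1 * h w) = fun w => avoid H z w * g w := by
    ext; simp only [hh]; ring
  have p0 := hpos 0 (by simp)
  have p1 := hpos 1 (by simp)
  rw [e0] at p0; rw [e1] at p1
  rw [e0, e1, sub_zero, div_one, ← Real.log_div p1.ne' p0.ne', ← integral_div] at he
  rw [hcRatio, ← Real.exp_log (div_pos p1 p0), ← he, ← integral_neg]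
  congr 2
  ext z'
  rw [hgh, hcRatio]
  simp only [hh]
  have e2 : (fun w => avoid H z' w * (g w + s * -((1 - avoid H z w) * g w))) =
      fun w => avoid H z' w * ((1 - s * (1 - avoid H z w)) * g w) := by
    ext w; ring
  rw [e2]
  ring

omit [SigmaFinite (volume : Measure X)] hgi h0 in
lemma measurable_prod_avoid_mul {ι : Type*} (s : Finset ι) (Z : ι → X) :
    Measurable fun w => (∏ i ∈ s, avoid H (Z i) w) * g w :=
  (Finset.measurable_prod _ fun i _ => measurable_avoid_right hm (Z i)).mul hg

omit [SigmaFinite (volume : Measure X)] hg h0 in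
lemma integrable_prod_avoid_mul {ι : Type*} (s : Finset ι) (Z : ι → X) :
    Integrable fun w => (∏ i ∈ s, avoid H (Z i) w) * g w := by
  refine hgi.bdd_mul (c := 1) (Finset.measurable_prod _ fun i _ =>
    measurable_avoid_right hm (Z i)).aestronglyMeasurable (Eventually.of_forall fun w => ?_)
  rw [Real.norm_eq_abs, abs_of_nonneg (Finset.prod_nonneg fun i _ => avoid_nonneg _ _)]
  exact Finset.prod_le_one (fun i _ => avoid_nonneg _ _) fun i _ => avoid_le_one _ _

/-- If freezing further particles changes the one-particle ratios by at most `η`, then the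
many-particle ratio factorizes up to a multiple of `η`. -/
lemma abs_hcPartition_div_sub_prod_le {ι : Type*} [DecidableEq ι] (Z : ι → X) {η : ℝ}
    (S : Finset ι)
    (hη : ∀ s ⊆ S, ∀ a ∈ S, a ∉ s →
      |hcRatio H (fun w => (∏ i ∈ s, avoid H (Z i) w) * g w) (Z a) - hcRatio H g (Z a)| ≤ η) :
    |hcPartition H (fun w => (∏ i ∈ S, avoid H (Z i) w) * g w) / hcPartition H g
      - ∏ i ∈ S, hcRatio H g (Z i)| ≤ S.card * η := by
  have hpos := hcPartition_pos hm hg hgi h0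
  suffices ∀ s ⊆ S, |hcPartition H (fun w => (∏ i ∈ s, avoid H (Z i) w) * g w) / hcPartition H g
      - ∏ i ∈ s, hcRatio H g (Z i)| ≤ s.card * η from this S subset_rfl
  intro s
  induction s using Finset.induction_on with
  | empty => simp [div_self hpos.ne']
  | insert a s ha ih =>
    intro hsS
    have hs' : s ⊆ S := (Finset.subset_insert a s).trans hsS
    have haS : a ∈ S := hsS (Finset.mem_insert_self a s)
    have hgs := measurable_prod_avoid_mul hm hg s Z
    have hgsi := integrable_prod_avoid_mul hm hgi s Z
    have h0s : ∀ w, 0 ≤ (∏ i ∈ s, avoid H (Z i) w) * g w := fun w =>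
      mul_nonneg (Finset.prod_nonneg fun i _ => avoid_nonneg _ _) (h0 w)
    set Q := hcPartition H (fun w => (∏ i ∈ s, avoid H (Z i) w) * g w)
    have hQ : 0 < Q := hcPartition_pos hm hgs hgsi h0s
    have hr := hη s hs' a haS ha
    have e : hcPartition H (fun w => (∏ i ∈ insert a s, avoid H (Z i) w) * g w) =
        hcRatio H (fun w => (∏ i ∈ s, avoid H (Z i) w) * g w) (Z a) * Q := by
      rw [hcRatio, div_mul_cancel₀ _ hQ.ne']
      simp_rw [Finset.prod_insert ha, mul_assoc]
    rw [e, Finset.prod_insert ha, Finset.card_insert_of_notMem ha]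
    set r := hcRatio H (fun w => (∏ i ∈ s, avoid H (Z i) w) * g w) (Z a)
    have r0 : 0 ≤ r := hcRatio_nonneg hm hgs hgsi h0s _
    have r1 : r ≤ 1 := hcRatio_le_one hm hgs hgsi h0s _
    have hP0 : 0 ≤ ∏ i ∈ s, hcRatio H g (Z i) :=
      Finset.prod_nonneg fun i _ => hcRatio_nonneg hm hg hgi h0 _
    have hP1 : ∏ i ∈ s, hcRatio H g (Z i) ≤ 1 :=
      Finset.prod_le_one (fun i _ => hcRatio_nonneg hm hg hgi h0 _)
        fun i _ => hcRatio_le_one hm hg hgi h0 _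
    have ih' := ih hs'
    -- Freezing one more particle multiplies the quotient by a ratio r in [0, 1], and the product of
    -- the other ratios is at most 1; so errors add up without amplification.
    have split : r * Q / hcPartition H g - hcRatio H g (Z a) * ∏ i ∈ s, hcRatio H g (Z i) =
        r * (Q / hcPartition H g - ∏ i ∈ s, hcRatio H g (Z i)) +
          (r - hcRatio H g (Z a)) * ∏ i ∈ s, hcRatio H g (Z i) := by ring
    rw [split]
    refine (abs_add_le _ _).trans ?_
    rw [abs_mul, abs_mul, abs_of_nonneg r0, abs_of_nonneg hP0]
    push_cast
    have h1 : r * |Q / hcPartition H g - ∏ i ∈ s, hcRatio H g (Z i)| ≤ s.card * η :=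
      (mul_le_of_le_one_left (abs_nonneg _) r1).trans ih'
    have h2 := (mul_le_of_le_one_right (abs_nonneg _) hP1).trans hr
    linarith

end

end HardCore

end HardSphere
end

open MeasureTheory Filter Topology
open scoped ENNReal BigOperators

noncomputable section

namespace HardSphere

/-! ### Free transport -/

variable {d : ℕ}

instance : SigmaFinite (volume : Measure (Phase d)) := inferInstance

instance : BorelSpace (Phase d) := inferInstance

instance : SecondCountableTopology (Phase d) := inferInstance

lemma torusShift_zero (x : UnitAddTorus (Fin d)) : torusShift x 0 = x := by
  ext a; simp [torusShift]

lemma torusShift_add (x : UnitAddTorus (Fin d)) (a b : EuclideanSpace ℝ (Fin d)) :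
    torusShift x (a + b) = torusShift (torusShift x a) b := by
  ext i; simp [torusShift, add_assoc]

lemma continuous_torusShift :
    Continuous fun p : UnitAddTorus (Fin d) × EuclideanSpace ℝ (Fin d) =>
      torusShift p.1 p.2 := by
  refine continuous_pi fun a => ?_
  have h1 : Continuous fun p : UnitAddTorus (Fin d) × EuclideanSpace ℝ (Fin d) => p.1 a :=
    (continuous_apply a).comp continuous_fst
  have h2 : Continuous fun p : UnitAddTorus (Fin d) × EuclideanSpace ℝ (Fin d) => p.2 a :=
    (EuclideanSpace.proj a : EuclideanSpace ℝ (Fin d) →L[ℝ] ℝ).continuous.comp continuous_snd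
  exact h1.add ((AddCircle.continuous_mk' 1).comp h2)

lemma continuous_torusDist_comp {Y : Type*} [TopologicalSpace Y] {f g : Y → UnitAddTorus (Fin d)}
    (hf : Continuous f) (hg : Continuous g) : Continuous fun y => torusDist (f y) (g y) := by
  unfold torusDist
  fun_prop

/-- The free flow of one particle. -/
def advance (t : ℝ) (z : Phase d) : Phase d := (torusShift z.1 (t • z.2), z.2)

lemma freeFlow_eq {n : ℕ} (t : ℝ) (Z : Config d n) : freeFlow t Z = fun i => advance t (Z i) := rfl

lemma continuous_advance_uncurry : Continuous fun p : ℝ × Phase d => advance p.1 p.2 := by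
  refine Continuous.prodMk (continuous_torusShift.comp (Continuous.prodMk ?_ ?_)) ?_ <;> fun_prop

lemma advance_advance (s t : ℝ) (z : Phase d) : advance s (advance t z) = advance (t + s) z := by
  simp [advance, add_smul, torusShift_add]

lemma advance_zero (z : Phase d) : advance 0 z = z := by
  simp [advance, torusShift_zero]

lemma freeFlow_freeFlow {n : ℕ} (s t : ℝ) (Z : Config d n) :
    freeFlow s (freeFlow t Z) = freeFlow (t + s) Z := by
  simp [freeFlow_eq, advance_advance]

lemma freeFlow_zero {n : ℕ} (Z : Config d n) : freeFlow 0 Z = Z := by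
  simp [freeFlow_eq, advance_zero]

lemma measurePreserving_torusShift (w : EuclideanSpace ℝ (Fin d)) :
    MeasurePreserving (fun x : UnitAddTorus (Fin d) => torusShift x w) :=
  volume_preserving_pi (α' := fun _ : Fin d => UnitAddCircle) (β' := fun _ : Fin d => UnitAddCircle)
    (f := fun a x => x + ((w a : ℝ) : UnitAddCircle))
    fun a => measurePreserving_add_right volume ((w a : ℝ) : UnitAddCircle)

/-- The flow is a shear: at fixed velocity it is a translation of the torus. The swaps put the
velocity first, as a skew product requires. -/
lemma measurePreserving_advance (t : ℝ) : MeasurePreserving (advance t : Phase d → Phase d) := by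
  have h : MeasurePreserving
      (fun p : EuclideanSpace ℝ (Fin d) × UnitAddTorus (Fin d) => (p.1, torusShift p.2 (t • p.1)))
      (volume.prod volume) (volume.prod volume) := by
    refine (MeasurePreserving.id volume).skew_product
      (g := fun (v : EuclideanSpace ℝ (Fin d)) (x : UnitAddTorus (Fin d)) => torusShift x (t • v))
      ?_ (Eventually.of_forall fun v => (measurePreserving_torusShift (t • v)).map_eq)
    exact (continuous_torusShift.comp (by fun_prop : Continuous fun
      p : EuclideanSpace ℝ (Fin d) × UnitAddTorus (Fin d) => (p.2, t • p.1))).measurable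
  exact (Measure.measurePreserving_swap.comp h).comp Measure.measurePreserving_swap

lemma measurePreserving_freeFlow {n : ℕ} (t : ℝ) :
    MeasurePreserving (freeFlow t : Config d n → Config d n) :=
  volume_preserving_pi (α' := fun _ : Fin n => Phase d) (β' := fun _ : Fin n => Phase d)
    (f := fun _ => advance t) fun _ => measurePreserving_advance t

/-- The free flow as a measurable equivalence. -/
def freeFlowEquiv {n : ℕ} (t : ℝ) : Config d n ≃ᵐ Config d n where
  toFun := freeFlow t
  invFun := freeFlow (-t)
  left_inv Z := by simp [freeFlow_freeFlow, freeFlow_zero]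
  right_inv Z := by simp [freeFlow_freeFlow, freeFlow_zero]
  measurable_toFun := (measurePreserving_freeFlow t).measurable
  measurable_invFun := (measurePreserving_freeFlow (-t)).measurable

lemma freeFlow_append {j n : ℕ} (t : ℝ) (Z : Config d j) (Y : Config d n) :
    freeFlow t (Fin.append Z Y) = Fin.append (freeFlow t Z) (freeFlow t Y) := by
  ext1 i
  refine Fin.addCases (fun i => ?_) (fun i => ?_) i <;> simp [freeFlow_eq]

/-- Free transport moves each particle independently, so the motion of the integrated particles
disappears by a measure-preserving change of variables. -/
lemma rescaledCorrelation_freeFlow (ε : ℝ) (W : (n : ℕ) → Config d n → ℝ) (t : ℝ) (j : ℕ)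
    (Z : Config d j) :
    rescaledCorrelation ε (fun n Y => W n (freeFlow t Y)) j Z =
      rescaledCorrelation ε W j (freeFlow t Z) := by
  unfold rescaledCorrelation correlation
  congr 1
  refine tsum_congr fun n => ?_
  congr 1
  simp_rw [freeFlow_append]
  exact (measurePreserving_freeFlow (n := n) t).integral_comp (freeFlowEquiv t).measurableEmbedding
    (fun Y => W (j + n) (Fin.append (freeFlow t Z) Y))

/-! ### The collision relation -/

/-- The free trajectories of `z` and `z'` come within distance `r` during `[0, δ]`. -/
def Hits (δ r : ℝ) (z z' : Phase d) : Prop :=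
  ∃ u ∈ Set.Icc (0 : ℝ) δ, torusDist (advance u z).1 (advance u z').1 ≤ r

lemma torusDist_comm (x y : UnitAddTorus (Fin d)) : torusDist x y = torusDist y x := by
  unfold torusDist
  simp_rw [norm_sub_rev]

lemma Hits.symm {δ r : ℝ} (z z' : Phase d) (h : Hits δ r z z') : Hits δ r z' z := by
  obtain ⟨u, hu, h⟩ := h
  exact ⟨u, hu, by rwa [torusDist_comm]⟩

/-- Projection along a compact factor is a closed map. It is applied to the contact time in [0, δ]
for the collision relation, and to the segment parameter for tubes. -/
lemma isClosed_exists_le {K Y : Type*} [TopologicalSpace K] [CompactSpace K] [TopologicalSpace Y]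
    {F : K × Y → ℝ} (hF : Continuous F) (r : ℝ) : IsClosed {y | ∃ k, F (k, y) ≤ r} := by
  have h := isClosedMap_snd_of_compactSpace (X := K) (Y := Y) _
    (isClosed_Iic.preimage hF : IsClosed (F ⁻¹' Set.Iic r))
  convert h using 1
  ext y
  simp

lemma isClosed_hits (δ r : ℝ) : IsClosed {p : Phase d × Phase d | Hits δ r p.1 p.2} := by
  let F : Set.Icc (0 : ℝ) δ × (Phase d × Phase d) → ℝ := fun q =>
    torusDist (advance q.1 q.2.1).1 (advance q.1 q.2.2).1
  have hF : Continuous F := by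
    have h0 : Continuous fun q : Set.Icc (0 : ℝ) δ × (Phase d × Phase d) => (q.1 : ℝ) :=
      continuous_subtype_val.comp continuous_fst
    have h1 : Continuous fun q : Set.Icc (0 : ℝ) δ × (Phase d × Phase d) =>
        (advance q.1 q.2.1).1 := continuous_fst.comp
      (continuous_advance_uncurry.comp (h0.prodMk (continuous_fst.comp continuous_snd)))
    have h2 : Continuous fun q : Set.Icc (0 : ℝ) δ × (Phase d × Phase d) =>
        (advance q.1 q.2.2).1 := continuous_fst.comp
      (continuous_advance_uncurry.comp (h0.prodMk (continuous_snd.comp continuous_snd)))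
    exact continuous_torusDist_comp h1 h2
  have hc : IsClosed {p | ∃ u, F (u, p) ≤ r} := isClosed_exists_le hF r
  have e : {p : Phase d × Phase d | Hits δ r p.1 p.2} = {p | ∃ u, F (u, p) ≤ r} := by
    ext p
    exact ⟨fun ⟨u, hu, h⟩ => ⟨⟨u, hu⟩, h⟩, fun ⟨u, h⟩ => ⟨u, u.2, h⟩⟩
  rw [e]
  exact hc

lemma measurableSet_hits (δ r : ℝ) : MeasurableSet {p : Phase d × Phase d | Hits δ r p.1 p.2} :=
  (isClosed_hits δ r).measurableSet

lemma notMem_badSet_iff {δ r : ℝ} {n : ℕ} {Z : Config d n} :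
    Z ∉ badSet d δ r n ↔ Admissible (Hits δ r) Z := by
  simp only [badSet, Set.mem_ofPred_eq, Admissible, Hits, freeFlow_eq]
  push Not
  exact ⟨fun h i k hik u hu => h u hu i k hik, fun h u hu i k hik => h i k hik u hu⟩

lemma activity_pow_mul_restrictedTensor (f₀ : Phase d → ℝ) (δ ε : ℝ) (n : ℕ) (Z : Config d n) :
    activity d ε ^ n * restrictedTensor f₀ δ ε n Z =
      hcWeight (Hits δ ε) (fun z => activity d ε * f₀ z) n Z := by
  unfold restrictedTensor hcWeight tensor
  by_cases h : Z ∈ badSet d δ ε n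
  · rw [if_pos h, if_neg fun h' => notMem_badSet_iff.2 h' h, mul_zero]
  · rw [if_neg h, if_pos (notMem_badSet_iff.1 h)]
    simp [Finset.prod_mul_distrib]

lemma partitionFunction_eq (f₀ : Phase d → ℝ) (δ ε : ℝ) :
    partitionFunction f₀ δ ε = hcPartition (Hits δ ε) (fun z => activity d ε * f₀ z) := by
  unfold partitionFunction hcPartition
  refine tsum_congr fun n => ?_
  simp_rw [← activity_pow_mul_restrictedTensor, integral_const_mul]
  ring

lemma gcDensity_eq (f₀ : Phase d → ℝ) (δ ε : ℝ) (n : ℕ) (Z : Config d n) :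
    gcDensity f₀ δ ε n Z = (hcPartition (Hits δ ε) (fun z => activity d ε * f₀ z))⁻¹ *
      hcWeight (Hits δ ε) (fun z => activity d ε * f₀ z) n Z := by
  rw [gcDensity, partitionFunction_eq, mul_assoc, activity_pow_mul_restrictedTensor]

lemma admissible_of_gcDensity_ne_zero {f₀ : Phase d → ℝ} {δ ε : ℝ} {n : ℕ} {Z : Config d n}
    (h : gcDensity f₀ δ ε n Z ≠ 0) : Admissible (Hits δ ε) Z := by
  by_contra hZ
  exact h (by rw [gcDensity_eq, hcWeight, if_neg hZ, mul_zero])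

lemma measurable_gcDensity {f₀ : Phase d → ℝ} (hf : Measurable f₀) (δ ε : ℝ) (n : ℕ) :
    Measurable (gcDensity f₀ δ ε n) := by
  have : gcDensity f₀ δ ε n = fun Z => _ := funext (gcDensity_eq f₀ δ ε n)
  rw [this]
  exact (measurable_hcWeight (measurableSet_hits δ ε) (hf.const_mul _) n).const_mul _

/-! ### Hard-sphere dynamics without collisions -/

/-- Before the earliest collision time the motion from Z is free, so that collision would put two
freely moving particles at distance exactly ε, contrary to admissibility. Hence there is no
collision time, and the clause on free motion from time 0 determines the trajectory. -/
theorem isHardSphereTrajectory_iff {n : ℕ} {δ ε : ℝ} (hδ : 0 ≤ δ) {Z : Config d n}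
    (hZ : Admissible (Hits δ ε) Z) (Y : ℝ → Config d n) :
    (Y 0 = Z ∧ IsHardSphereTrajectory ε δ Y) ↔ ∀ t ∈ Set.Icc (0 : ℝ) δ, Y t = freeFlow t Z := by
  have hfar : ∀ t ∈ Set.Icc (0 : ℝ) δ, ∀ i k : Fin n, i ≠ k →
      ε < torusDist (freeFlow t Z i).1 (freeFlow t Z k).1 := fun t ht i k hik =>
    not_le.1 fun h => hZ i k hik ⟨t, ht, h⟩
  constructor
  · rintro ⟨h0, S, hS, -, hfree, hcoll⟩
    have hSe : S = ∅ := by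
      by_contra hne
      obtain ⟨τ, hτ, hmin⟩ := S.exists_min_image id (Finset.nonempty_iff_ne_empty.2 hne)
      obtain ⟨i, k, h⟩ := hcoll τ hτ
      obtain ⟨hik, hd, -⟩ := h 0 ⟨le_rfl, (hS τ hτ).1⟩
        fun r hr hr' => (hmin r hr).not_gt hr'.2
      rw [h0, sub_zero] at hd
      exact (hfar τ ⟨(hS τ hτ).1.le, (hS τ hτ).2⟩ i k hik).ne' hd
    subst hSe
    intro t ht
    have := hfree 0 t le_rfl ht.1 ht.2 (by simp)
    rwa [h0, sub_zero] at this
  · intro h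
    refine ⟨by rw [h 0 ⟨le_rfl, hδ⟩, freeFlow_zero], ∅, by simp, ?_, ?_, by simp⟩
    · intro t ht _ i k hik
      rw [h t ht]
      exact hfar t ht i k hik
    · intro s t hs hst ht _
      rw [h t ⟨hs.trans hst, ht⟩, h s ⟨hs, hst.trans ht⟩, freeFlow_freeFlow]
      congr 1; ring

/-- Only the values of Φ on the support of the density matter, and there Φ is the free flow.
Almost-everywhere equality with a measurable map also makes any measurability assumption on Φ
superfluous. -/
theorem map_withDensity_gcDensity {f₀ : Phase d → ℝ} (hf : Measurable f₀) {δ ε : ℝ} {n : ℕ}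
    (hδ : 0 ≤ δ) {t : ℝ} (ht : t ∈ Set.Icc (0 : ℝ) δ) (Φ : Config d n → Config d n)
    (hΦ : ∀ Z, gcDensity f₀ δ ε n Z ≠ 0 → ∃ Y : ℝ → Config d n,
      Y 0 = Z ∧ IsHardSphereTrajectory ε δ Y ∧ Y t = Φ Z) :
    Measure.map Φ (volume.withDensity fun Z => ENNReal.ofReal (gcDensity f₀ δ ε n Z)) =
      volume.withDensity fun Z => ENNReal.ofReal (gcDensity f₀ δ ε n (freeFlow (-t) Z)) := by
  have hW := measurable_gcDensity hf δ ε n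
  have hflow := measurePreserving_freeFlow (d := d) (n := n) t
  have hae : Φ =ᵐ[volume.withDensity fun Z => ENNReal.ofReal (gcDensity f₀ δ ε n Z)]
      freeFlow t := by
    rw [EventuallyEq, ae_withDensity_iff hW.ennreal_ofReal]
    refine Eventually.of_forall fun Z hZ => ?_
    have hZ' : gcDensity f₀ δ ε n Z ≠ 0 := fun h => hZ (by simp [h])
    obtain ⟨Y, hY0, hY, hYt⟩ := hΦ Z hZ'
    rw [← hYt]
    exact (isHardSphereTrajectory_iff hδ (admissible_of_gcDensity_ne_zero hZ') Y).1 ⟨hY0, hY⟩ t ht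
  rw [Measure.map_congr hae]
  ext s hs
  rw [Measure.map_apply hflow.measurable hs, withDensity_apply _ (hflow.measurable hs),
    withDensity_apply _ hs]
  have h := hflow.setLIntegral_comp_preimage hs
    (f := fun Z => ENNReal.ofReal (gcDensity f₀ δ ε n (freeFlow (-t) Z)))
    (hW.comp (measurePreserving_freeFlow (-t)).measurable).ennreal_ofReal
  rw [← h]
  simp [freeFlow_freeFlow, freeFlow_zero]

end HardSphere
end

open MeasureTheory Filter Topology
open scoped ENNReal BigOperators Pointwise

noncomputable section

namespace HardSphere

/-! ### Tubes in Euclidean space -/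

variable {d : ℕ}

/-- The closed `ε`-neighbourhood of the segment `{u e : a ≤ u ≤ b}`. -/
def tube (ε : ℝ) (e : EuclideanSpace ℝ (Fin d)) (a b : ℝ) : Set (EuclideanSpace ℝ (Fin d)) :=
  {X | ∃ u ∈ Set.Icc a b, ‖X - u • e‖ ≤ ε}

lemma isClosed_tube (ε : ℝ) (e : EuclideanSpace ℝ (Fin d)) (a b : ℝ) :
    IsClosed (tube ε e a b) := by
  have hF : Continuous fun q : Set.Icc a b × EuclideanSpace ℝ (Fin d) =>
      ‖q.2 - (q.1 : ℝ) • e‖ := by fun_prop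
  simpa only [tube, Subtype.exists, exists_prop] using isClosed_exists_le hF ε

lemma measurableSet_tube (ε : ℝ) (e : EuclideanSpace ℝ (Fin d)) (a b : ℝ) :
    MeasurableSet (tube ε e a b) :=
  (isClosed_tube ε e a b).measurableSet

lemma tube_subset_closedBall (ε : ℝ) (e : EuclideanSpace ℝ (Fin d)) (a b : ℝ) :
    tube ε e a b ⊆ Metric.closedBall 0 (ε + max |a| |b| * ‖e‖) := by
  rintro X ⟨u, hu, h⟩
  rw [mem_closedBall_zero_iff]
  have h1 : |u| ≤ max |a| |b| := abs_le_max_abs_abs hu.1 hu.2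
  calc ‖X‖ = ‖(X - u • e) + u • e‖ := by simp
    _ ≤ ‖X - u • e‖ + ‖u • e‖ := norm_add_le _ _
    _ ≤ ε + max |a| |b| * ‖e‖ := by
        rw [norm_smul, Real.norm_eq_abs]; gcongr

lemma volume_tube_lt_top (ε : ℝ) (e : EuclideanSpace ℝ (Fin d)) (a b : ℝ) :
    volume (tube ε e a b) < ∞ :=
  (measure_mono (tube_subset_closedBall ε e a b)).trans_lt measure_closedBall_lt_top

lemma tube_self (ε : ℝ) (e : EuclideanSpace ℝ (Fin d)) (a : ℝ) :
    tube ε e a a = Metric.closedBall (a • e) ε := by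
  ext X; simp [tube, dist_eq_norm]

lemma tube_union_tube (ε : ℝ) (e : EuclideanSpace ℝ (Fin d)) {a b c : ℝ} (hab : a ≤ b)
    (hbc : b ≤ c) : tube ε e a b ∪ tube ε e b c = tube ε e a c := by
  ext X
  constructor
  · rintro (⟨u, hu, h⟩ | ⟨u, hu, h⟩)
    · exact ⟨u, ⟨hu.1, hu.2.trans hbc⟩, h⟩
    · exact ⟨u, ⟨hab.trans hu.1, hu.2⟩, h⟩
  · rintro ⟨u, hu, h⟩
    rcases le_total u b with hub | hub
    · exact Or.inl ⟨u, ⟨hu.1, hub⟩, h⟩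
    · exact Or.inr ⟨u, ⟨hub, hu.2⟩, h⟩

/-- A point close to the segment on both sides of b • e is close to b • e itself, because the
parameters of the line within ε of the point form a convex set. -/
lemma tube_inter_tube (ε : ℝ) (e : EuclideanSpace ℝ (Fin d)) {a b c : ℝ} (hab : a ≤ b)
    (hbc : b ≤ c) : tube ε e a b ∩ tube ε e b c = tube ε e b b := by
  ext X
  constructor
  · rintro ⟨⟨u, hu, h⟩, ⟨u', hu', h'⟩⟩
    refine ⟨b, ⟨le_rfl, le_rfl⟩, ?_⟩
    have hconv := convex_closedBall X ε
    have hm : u • e ∈ Metric.closedBall X ε := by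
      rwa [Metric.mem_closedBall, dist_eq_norm, norm_sub_rev]
    have hm' : u' • e ∈ Metric.closedBall X ε := by
      rwa [Metric.mem_closedBall, dist_eq_norm, norm_sub_rev]
    have hb : b ∈ segment ℝ u u' := by
      rw [segment_eq_Icc (hu.2.trans hu'.1)]; exact ⟨hu.2, hu'.1⟩
    obtain ⟨p, q, hp, hq, hpq, rfl⟩ := hb
    have := hconv hm hm' hp hq hpq
    rw [Metric.mem_closedBall, dist_eq_norm, norm_sub_rev] at this
    simpa [add_smul, mul_smul] using this
  · rintro ⟨u, hu, h⟩
    exact ⟨⟨u, ⟨hab.trans hu.1, hu.2⟩, h⟩, ⟨u, ⟨hu.1, hu.2.trans hbc⟩, h⟩⟩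

lemma volume_real_tube_translate (ε : ℝ) (e : EuclideanSpace ℝ (Fin d)) (a b c : ℝ) :
    volume.real (tube ε e (a + c) (b + c)) = volume.real (tube ε e a b) := by
  have : tube ε e a b = (fun X => X + c • e) ⁻¹' tube ε e (a + c) (b + c) := by
    ext X
    constructor
    · rintro ⟨u, hu, h⟩
      exact ⟨u + c, ⟨by linarith [hu.1], by linarith [hu.2]⟩, by simpa [add_smul] using h⟩
    · rintro ⟨u, hu, h⟩
      refine ⟨u - c, ⟨by linarith [hu.1], by linarith [hu.2]⟩, ?_⟩
      convert h using 2
      simp only [sub_smul]; abel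
  rw [this, measureReal_def, measureReal_def, measure_preimage_add_right]

/-- Two consecutive tubes overlap exactly in the ball at their common end, so the excess of the
volume over that of the ball is additive in the length. With monotonicity this forces linearity, and
no coordinates along the tube are needed. -/
lemma volume_real_tube_add (ε : ℝ) (e : EuclideanSpace ℝ (Fin d)) {s t : ℝ} (hs : 0 ≤ s)
    (ht : 0 ≤ t) : volume.real (tube ε e 0 (s + t)) + volume.real (tube ε e 0 0) =
      volume.real (tube ε e 0 s) + volume.real (tube ε e 0 t) := by
  have h := measureReal_union_add_inter (μ := volume) (s := tube ε e 0 s)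
    (measurableSet_tube ε e s (s + t)) (volume_tube_lt_top ε e _ _).ne
    (volume_tube_lt_top ε e _ _).ne
  rw [tube_union_tube ε e hs (by linarith), tube_inter_tube ε e hs (by linarith)] at h
  have h1 := volume_real_tube_translate ε e 0 0 s
  have h2 := volume_real_tube_translate ε e 0 t s
  rw [zero_add] at h1 h2
  rw [add_comm t s] at h2
  rw [h1, h2] at h
  exact h

lemma volume_real_tube_mono (ε : ℝ) (e : EuclideanSpace ℝ (Fin d)) {s t : ℝ} (hst : s ≤ t) :
    volume.real (tube ε e 0 s) ≤ volume.real (tube ε e 0 t) :=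
  measureReal_mono (fun _ ⟨u, hu, h⟩ => ⟨u, ⟨hu.1, hu.2.trans hst⟩, h⟩)
    (volume_tube_lt_top ε e _ _).ne

/-- A monotone additive function on the half-line is linear. -/
lemma eq_mul_of_additive_of_monotone {G : ℝ → ℝ}
    (hadd : ∀ s t, 0 ≤ s → 0 ≤ t → G (s + t) = G s + G t)
    (hmono : ∀ s t, 0 ≤ s → s ≤ t → G s ≤ G t) {t : ℝ} (ht : 0 ≤ t) : G t = t * G 1 := by
  have h0 : G 0 = 0 := by have := hadd 0 0 le_rfl le_rfl; simp at this; linarith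
  have hn : ∀ (n : ℕ) (t : ℝ), 0 ≤ t → G (n * t) = n * G t := by
    intro n t ht
    induction n with
    | zero => simp [h0]
    | succ n ih =>
      push_cast
      rw [add_mul, one_mul, hadd _ _ (by positivity) ht, ih]; ring
  have hG1 : 0 ≤ G 1 := h0 ▸ hmono 0 1 le_rfl zero_le_one
  -- Comparison of G (n t) with G at the integers around n t bounds n |G t - t G 1| independently of
  -- n.
  have hb : ∀ n : ℕ, (n : ℝ) * |G t - t * G 1| ≤ G 1 := by
    intro n
    have hnt : 0 ≤ (n : ℝ) * t := by positivity
    have h1 := hmono _ _ (by positivity) (Nat.floor_le hnt)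
    have h2 := hmono _ _ hnt (Nat.lt_floor_add_one ((n : ℝ) * t)).le
    have e1 := hn ⌊(n : ℝ) * t⌋₊ 1 zero_le_one
    have e2 := hn (⌊(n : ℝ) * t⌋₊ + 1) 1 zero_le_one
    push_cast at e2
    rw [mul_one] at e1 e2
    rw [e1, hn n t ht] at h1
    rw [e2, hn n t ht] at h2
    have h3 := mul_le_mul_of_nonneg_right (Nat.floor_le hnt) hG1
    have h4 := mul_le_mul_of_nonneg_right (Nat.lt_floor_add_one ((n : ℝ) * t)).le hG1
    rw [← abs_of_nonneg (Nat.cast_nonneg (α := ℝ) n), ← abs_mul, abs_le]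
    constructor <;> nlinarith
  by_contra hne
  have hpos : 0 < |G t - t * G 1| := abs_pos.2 (sub_ne_zero.2 hne)
  obtain ⟨n, hn'⟩ := exists_nat_gt (G 1 / |G t - t * G 1|)
  rw [div_lt_iff₀ hpos] at hn'
  linarith [hb n]

lemma volume_real_tube_linear (ε : ℝ) (e : EuclideanSpace ℝ (Fin d)) {t : ℝ} (ht : 0 ≤ t) :
    volume.real (tube ε e 0 t) - volume.real (tube ε e 0 0) =
      t * (volume.real (tube ε e 0 1) - volume.real (tube ε e 0 0)) := by
  refine eq_mul_of_additive_of_monotone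
    (G := fun t => volume.real (tube ε e 0 t) - volume.real (tube ε e 0 0)) ?_ ?_ ht
  · intro s t hs ht
    have := volume_real_tube_add ε e hs ht
    linarith
  · intro s t _ hst
    have := volume_real_tube_mono ε e hst
    linarith

lemma volume_real_tube_scale {ε : ℝ} (hε : 0 < ε) (e : EuclideanSpace ℝ (Fin d)) (t : ℝ) :
    volume.real (tube ε e 0 t) = ε ^ d * volume.real (tube 1 e 0 (t / ε)) := by
  have : tube ε e 0 t = ε • tube 1 e 0 (t / ε) := by
    ext X
    rw [Set.mem_smul_set_iff_inv_smul_mem₀ hε.ne']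
    have key : ∀ u : ℝ, ‖ε⁻¹ • X - (u / ε) • e‖ = ε⁻¹ * ‖X - u • e‖ := fun u => by
      rw [div_eq_inv_mul, mul_smul, ← smul_sub, norm_smul, Real.norm_of_nonneg (by positivity)]
    constructor
    · rintro ⟨u, hu, h⟩
      refine ⟨u / ε, ⟨by have := hu.1; positivity, by have := hu.2; gcongr⟩, ?_⟩
      rw [key, inv_mul_le_iff₀ hε]; simpa using h
    · rintro ⟨u, hu, h⟩
      refine ⟨u * ε, ⟨by have := hu.1; positivity, by have := hu.2; rwa [le_div_iff₀ hε] at this⟩, ?_⟩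
      have := key (u * ε)
      rw [mul_div_cancel_right₀ _ hε.ne'] at this
      rw [this, inv_mul_le_iff₀ hε] at h
      simpa using h
  rw [this, measureReal_def, Measure.addHaar_smul, ENNReal.toReal_mul, measureReal_def,
    ENNReal.toReal_ofReal (abs_nonneg _)]
  simp [abs_of_pos hε]

lemma tube_smul (ε : ℝ) (e : EuclideanSpace ℝ (Fin d)) {c : ℝ} (hc : 0 < c) (t : ℝ) :
    tube ε (c • e) 0 t = tube ε e 0 (t * c) := by
  ext X
  constructor
  · rintro ⟨u, hu, h⟩
    refine ⟨u * c, ⟨by have := hu.1; positivity, by have := hu.2; gcongr⟩, by rwa [mul_smul]⟩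
  · rintro ⟨u, hu, h⟩
    refine ⟨u / c, ⟨by have := hu.1; positivity, by have := hu.2; rwa [div_le_iff₀ hc]⟩, ?_⟩
    rwa [smul_smul, div_mul_cancel₀ _ hc.ne']

/-- The reflection that exchanges the two vectors is an isometry carrying one tube to the other. -/
lemma volume_real_tube_eq_of_norm_eq (ε : ℝ) {e e' : EuclideanSpace ℝ (Fin d)}
    (h : ‖e‖ = ‖e'‖) (a b : ℝ) : volume.real (tube ε e a b) = volume.real (tube ε e' a b) := by
  set L := (ℝ ∙ (e - e'))ᗮ.reflection with hL
  have hLe : L e = e' := Submodule.reflection_sub h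
  have : tube ε e a b = L ⁻¹' tube ε e' a b := by
    ext X
    have key : ∀ u : ℝ, ‖L X - u • e'‖ = ‖X - u • e‖ := fun u => by
      rw [← hLe, ← map_smul, ← map_sub, L.norm_map]
    simp [tube, key]
  rw [this, measureReal_def, measureReal_def,
    L.measurePreserving.measure_preimage (measurableSet_tube _ _ _ _).nullMeasurableSet]

/-- The volume of a tube, with the constant `κ` (the volume of the unit ball in one dimension
less). -/
theorem exists_volume_real_tube (hd : 0 < d) : ∃ κ : ℝ, 0 ≤ κ ∧
    ∀ (ε : ℝ) (e : EuclideanSpace ℝ (Fin d)) (t : ℝ), 0 < ε → 0 ≤ t →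
      volume.real (tube ε e 0 t) =
        volume.real (Metric.closedBall (0 : EuclideanSpace ℝ (Fin d)) 1) * ε ^ d +
          κ * ε ^ (d - 1) * ‖e‖ * t := by
  set e₀ : EuclideanSpace ℝ (Fin d) := EuclideanSpace.single ⟨0, hd⟩ 1 with he₀
  have hn : ‖e₀‖ = 1 := by simp [he₀]
  -- κ is the excess volume, over the unit ball, of the tube of radius one around a unit segment.
  refine ⟨volume.real (tube 1 e₀ 0 1) - volume.real (tube 1 e₀ 0 0),
    sub_nonneg.2 (volume_real_tube_mono _ _ zero_le_one), fun ε e t hε ht => ?_⟩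
  have hball : ∀ e : EuclideanSpace ℝ (Fin d), volume.real (tube 1 e 0 0) =
      volume.real (Metric.closedBall (0 : EuclideanSpace ℝ (Fin d)) 1) := fun e => by
    rw [tube_self, zero_smul]
  have hε' : ε ^ d = ε ^ (d - 1) * ε := by rw [← pow_succ, Nat.sub_add_cancel hd]
  rw [volume_real_tube_scale hε]
  have key : volume.real (tube 1 e 0 (t / ε)) - volume.real (tube 1 e 0 0) =
      (t / ε * ‖e‖) * (volume.real (tube 1 e₀ 0 1) - volume.real (tube 1 e₀ 0 0)) := by
    rcases eq_or_ne e 0 with rfl | hne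
    · have := volume_real_tube_linear 1 (0 : EuclideanSpace ℝ (Fin d)) (t := t / ε) (by positivity)
      rw [this]
      have h1 : tube 1 (0 : EuclideanSpace ℝ (Fin d)) 0 1 = tube 1 0 0 0 := by
        ext X
        constructor
        · rintro ⟨u, hu, h⟩; exact ⟨0, by simp, by simpa using h⟩
        · rintro ⟨u, hu, h⟩; exact ⟨0, by simp, by simpa using h⟩
      rw [h1]; simp
    · have hp : 0 < ‖e‖ := norm_pos_iff.2 hne
      rw [volume_real_tube_eq_of_norm_eq 1 (e := e) (e' := ‖e‖ • e₀)
        (by rw [norm_smul, hn]; simp), tube_smul 1 e₀ hp, hball e, ← hball e₀]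
      exact volume_real_tube_linear 1 e₀ (by positivity)
  rw [hball] at key
  rw [sub_eq_iff_eq_add.1 key, hε']
  field_simp
  ring

end HardSphere
end

open MeasureTheory Filter Topology
open scoped ENNReal BigOperators

noncomputable section

namespace HardSphere

/-! ### The covering of the torus by Euclidean space -/

variable {d : ℕ}

/-- An integer vector, as a point of Euclidean space. -/
def latticeVec (m : Fin d → ℤ) : EuclideanSpace ℝ (Fin d) := WithLp.toLp 2 fun a => (m a : ℝ)

lemma torusShift_latticeVec (x : UnitAddTorus (Fin d)) (m : Fin d → ℤ) :
    torusShift x (latticeVec m) = x := by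
  ext a
  have : ((m a : ℝ) : UnitAddCircle) = 0 :=
    (AddCircle.coe_eq_zero_iff 1).2 ⟨m a, by simp⟩
  simp [torusShift, latticeVec, this]

lemma torusShift_add_latticeVec (x : UnitAddTorus (Fin d)) (w : EuclideanSpace ℝ (Fin d))
    (m : Fin d → ℤ) : torusShift x (w + latticeVec m) = torusShift x w := by
  rw [torusShift_add, torusShift_latticeVec]

lemma torusShift_eq_iff (x : UnitAddTorus (Fin d)) (w w' : EuclideanSpace ℝ (Fin d)) :
    torusShift x w = torusShift x w' ↔ ∃ m : Fin d → ℤ, w = w' + latticeVec m := by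
  constructor
  · intro h
    have : ∀ a, ∃ n : ℤ, n • (1 : ℝ) = w a - w' a := fun a => by
      rw [← AddCircle.coe_eq_zero_iff (1 : ℝ), AddCircle.coe_sub, sub_eq_zero]
      exact add_left_cancel (congrFun h a)
    choose m hm using this
    refine ⟨m, ?_⟩
    ext a
    have := hm a
    simp only [zsmul_eq_mul, mul_one] at this
    simp [latticeVec, this]
  · rintro ⟨m, rfl⟩
    exact torusShift_add_latticeVec _ _ _

/-- In each coordinate the representative r - round r realizes the norm on the circle. -/
lemma exists_torusShift_eq (x y : UnitAddTorus (Fin d)) :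
    ∃ w : EuclideanSpace ℝ (Fin d), ‖w‖ = torusDist x y ∧ x = torusShift y w := by
  have : ∀ a, ∃ r : ℝ, (r : UnitAddCircle) = x a - y a ∧ |r| = ‖x a - y a‖ := fun a => by
    obtain ⟨r, hr⟩ := QuotientAddGroup.mk_surjective (x a - y a)
    refine ⟨r - round r, ?_, ?_⟩
    · have : ((round r : ℝ) : UnitAddCircle) = 0 :=
        (AddCircle.coe_eq_zero_iff 1).2 ⟨round r, by simp⟩
      rw [AddCircle.coe_sub, this, sub_zero]
      exact hr
    · rw [← hr]
      exact (UnitAddCircle.norm_eq (x := r)).symm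
  choose r hr hr' using this
  refine ⟨WithLp.toLp 2 r, ?_, ?_⟩
  · rw [EuclideanSpace.norm_eq, torusDist]
    simp [hr']
  · ext a
    simp [torusShift, hr]

lemma torusDist_torusShift_le (y : UnitAddTorus (Fin d)) (w : EuclideanSpace ℝ (Fin d)) :
    torusDist (torusShift y w) y ≤ ‖w‖ := by
  rw [EuclideanSpace.norm_eq, torusDist]
  refine Real.sqrt_le_sqrt (Finset.sum_le_sum fun a _ => ?_)
  simp only [torusShift, add_sub_cancel_left, Real.norm_eq_abs]
  refine pow_le_pow_left₀ (norm_nonneg _) ?_ 2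
  rw [UnitAddCircle.norm_eq]
  simpa using round_le (w a) 0

lemma torusDist_le_iff {x y : UnitAddTorus (Fin d)} {r : ℝ} :
    torusDist x y ≤ r ↔ ∃ w : EuclideanSpace ℝ (Fin d), ‖w‖ ≤ r ∧ x = torusShift y w := by
  constructor
  · intro h
    obtain ⟨w, hw, hx⟩ := exists_torusShift_eq x y
    exact ⟨w, hw.le.trans h, hx⟩
  · rintro ⟨w, hw, rfl⟩
    exact (torusDist_torusShift_le y w).trans hw

/-- The unit cell with lower corner `m`. -/
def cell (m : Fin d → ℤ) : Set (EuclideanSpace ℝ (Fin d)) :=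
  {X | ∀ a, X a ∈ Set.Ioc (m a : ℝ) (m a + 1)}

lemma measurableSet_cell (m : Fin d → ℤ) : MeasurableSet (cell m) := by
  have : cell m = ⋂ a, (fun X : EuclideanSpace ℝ (Fin d) => X a) ⁻¹' Set.Ioc (m a : ℝ) (m a + 1) := by
    ext X; simp [cell]
  rw [this]
  refine MeasurableSet.iInter fun a => ?_
  exact (EuclideanSpace.proj a : EuclideanSpace ℝ (Fin d) →L[ℝ] ℝ).measurable measurableSet_Ioc

lemma mem_cell_iff {m : Fin d → ℤ} {X : EuclideanSpace ℝ (Fin d)} :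
    X ∈ cell m ↔ ∀ a, m a = ⌈X a⌉ - 1 := by
  refine forall_congr' fun a => ?_
  rw [eq_sub_iff_add_eq, eq_comm, Int.ceil_eq_iff, Set.mem_Ioc]
  push_cast
  rw [add_sub_cancel_right]

lemma lintegral_eq_tsum_cell (F : EuclideanSpace ℝ (Fin d) → ℝ≥0∞) :
    ∫⁻ X, F X = ∑' m : Fin d → ℤ, ∫⁻ X in cell m, F X := by
  rw [← lintegral_iUnion measurableSet_cell]
  · have : ⋃ m : Fin d → ℤ, cell m = Set.univ := by
      refine Set.eq_univ_of_forall fun X => Set.mem_iUnion.2 ⟨fun a => ⌈X a⌉ - 1, ?_⟩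
      exact mem_cell_iff.2 fun a => rfl
    rw [this, Measure.restrict_univ]
  · intro m m' hne
    refine Set.disjoint_left.2 fun X h h' => hne ?_
    ext a
    rw [mem_cell_iff.1 h a, mem_cell_iff.1 h' a]

lemma setLIntegral_cell_eq (F : EuclideanSpace ℝ (Fin d) → ℝ≥0∞) (m : Fin d → ℤ) :
    ∫⁻ X in cell m, F X = ∫⁻ X in cell 0, F (X + latticeVec m) := by
  have h := (measurePreserving_add_right (volume : Measure (EuclideanSpace ℝ (Fin d)))
    (latticeVec m)).setLIntegral_comp_preimage_emb
    (MeasurableEquiv.addRight (latticeVec m)).measurableEmbedding F (cell m)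
  rw [← h]
  congr 2
  ext X
  simp [cell, latticeVec, add_comm]

lemma measurePreserving_coe_pi : MeasurePreserving
    (fun (X : Fin d → ℝ) i => (X i : UnitAddCircle))
    (volume.restrict (Set.univ.pi fun _ : Fin d => Set.Ioc (0 : ℝ) (0 + 1)))
    (volume : Measure (UnitAddTorus (Fin d))) := by
  rw [volume_pi, Measure.restrict_pi_pi]
  exact measurePreserving_pi _ _ fun _ => AddCircle.measurePreserving_mk 1 0

/-- Translation invariance moves the origin to `x`, and the half-open unit cube is a fundamental
domain. -/
lemma lintegral_torus_eq {h : UnitAddTorus (Fin d) → ℝ≥0∞} (hh : Measurable h)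
    (x : UnitAddTorus (Fin d)) :
    ∫⁻ y, h y = ∫⁻ X in cell 0, h (torusShift x X) := by
  have h1 : ∫⁻ y, h y = ∫⁻ y, h (x + y) := (lintegral_add_left_eq_self h x).symm
  have h2 := measurePreserving_coe_pi.lintegral_comp (f := fun y : UnitAddTorus (Fin d) => h (x + y))
    (hh.comp (measurable_const_add x))
  rw [h1, ← h2, ← (PiLp.volume_preserving_ofLp (Fin d)).setLIntegral_comp_preimage_emb
      (MeasurableEquiv.toLp 2 (Fin d → ℝ)).symm.measurableEmbedding]
  have : (cell 0 : Set (EuclideanSpace ℝ (Fin d))) =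
      WithLp.ofLp ⁻¹' (Set.univ.pi fun _ : Fin d => Set.Ioc (0 : ℝ) (0 + 1)) := by
    ext X; simp [cell]
  rw [this]
  rfl

lemma lintegral_eq_lintegral_cell_tsum {F : EuclideanSpace ℝ (Fin d) → ℝ≥0∞} (hF : Measurable F) :
    ∫⁻ X, F X = ∫⁻ X in cell 0, ∑' m : Fin d → ℤ, F (X + latticeVec m) := by
  have hm : ∀ m : Fin d → ℤ, AEMeasurable (fun X => F (X + latticeVec m))
      (volume.restrict (cell 0)) := fun m => (hF.comp (measurable_add_const _)).aemeasurable
  rw [lintegral_eq_tsum_cell, lintegral_tsum hm]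
  exact tsum_congr fun m => setLIntegral_cell_eq F m

lemma measurable_torusShift (x : UnitAddTorus (Fin d)) :
    Measurable fun X : EuclideanSpace ℝ (Fin d) => torusShift x X :=
  (continuous_torusShift.comp (Continuous.prodMk continuous_const continuous_id)).measurable

/-- Integrals over a subset of the torus are bounded by integrals over any set covering it. -/
lemma setLIntegral_torus_le {h : UnitAddTorus (Fin d) → ℝ≥0∞} (hh : Measurable h)
    (x : UnitAddTorus (Fin d)) {T : Set (UnitAddTorus (Fin d))} (hT : MeasurableSet T)
    {S : Set (EuclideanSpace ℝ (Fin d))} (hS : MeasurableSet S)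
    (hTS : ∀ y ∈ T, ∃ X ∈ S, y = torusShift x X) :
    ∫⁻ y in T, h y ≤ ∫⁻ X in S, h (torusShift x X) := by
  have hm : Measurable (S.indicator fun X => h (torusShift x X)) :=
    (hh.comp (measurable_torusShift x)).indicator hS
  rw [← lintegral_indicator hT, lintegral_torus_eq (hh.indicator hT) x, ← lintegral_indicator hS,
    lintegral_eq_lintegral_cell_tsum hm]
  refine lintegral_mono fun X => ?_
  by_cases hX : torusShift x X ∈ T
  -- Some lattice translate of X lies in S, and a single term of the sum over translates already
  -- dominates.
  · obtain ⟨Y, hY, he⟩ := hTS _ hX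
    obtain ⟨m, rfl⟩ := (torusShift_eq_iff x Y X).1 he.symm
    rw [Set.indicator_of_mem hX]
    refine le_trans ?_ (ENNReal.le_tsum m)
    rw [Set.indicator_of_mem hY]
    simp [torusShift_add_latticeVec]
  · rw [Set.indicator_of_notMem hX]; exact zero_le

/-- Integrals over the image of a set on which the covering map is injective. -/
lemma setLIntegral_torus_eq {h : UnitAddTorus (Fin d) → ℝ≥0∞} (hh : Measurable h)
    (x : UnitAddTorus (Fin d)) {T : Set (UnitAddTorus (Fin d))} (hT : MeasurableSet T)
    {S : Set (EuclideanSpace ℝ (Fin d))} (hS : MeasurableSet S)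
    (hTS : ∀ y, y ∈ T ↔ ∃ X ∈ S, y = torusShift x X)
    (hinj : ∀ X ∈ S, ∀ m : Fin d → ℤ, X + latticeVec m ∈ S → latticeVec m = 0) :
    ∫⁻ y in T, h y = ∫⁻ X in S, h (torusShift x X) := by
  have hm : Measurable (S.indicator fun X => h (torusShift x X)) :=
    (hh.comp (measurable_torusShift x)).indicator hS
  rw [← lintegral_indicator hT, lintegral_torus_eq (hh.indicator hT) x, ← lintegral_indicator hS,
    lintegral_eq_lintegral_cell_tsum hm]
  refine lintegral_congr fun X => ?_
  by_cases hX : torusShift x X ∈ T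
  · obtain ⟨Y, hY, he⟩ := (hTS _).1 hX
    obtain ⟨m, rfl⟩ := (torusShift_eq_iff x Y X).1 he.symm
    rw [Set.indicator_of_mem hX, tsum_eq_single m, Set.indicator_of_mem hY]
    · simp [torusShift_add_latticeVec]
    -- Injectivity of the covering on S leaves only one nonzero term in the sum over translates.
    · intro m' hm'
      refine Set.indicator_of_notMem (fun hm => hm' ?_) _
      have hdiff : latticeVec m' = latticeVec m + latticeVec (m' - m) := by
        ext a; simp [latticeVec]
      rw [hdiff, ← add_assoc] at hm
      have h0 := hinj _ hY _ hm
      ext a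
      have := congrArg (fun v : EuclideanSpace ℝ (Fin d) => v a) h0
      simp only [latticeVec, Pi.sub_apply, Int.cast_sub, PiLp.zero_apply] at this
      exact_mod_cast sub_eq_zero.1 this
  · rw [Set.indicator_of_notMem hX]
    symm
    refine ENNReal.tsum_eq_zero.2 fun m => Set.indicator_of_notMem (fun hm => hX ?_) _
    exact (hTS _).2 ⟨_, hm, (torusShift_add_latticeVec x X m).symm⟩

end HardSphere
end

/-! ### Cylinders of directions and the overlap of collision tubes -/

open MeasureTheory Filter Topology
open scoped ENNReal BigOperators

noncomputable section

namespace HardSphere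

variable {d : ℕ}

/-- The volume of the Euclidean unit ball. -/
def ballVol (d : ℕ) : ℝ := volume.real (Metric.closedBall (0 : EuclideanSpace ℝ (Fin d)) 1)

/-- The volume of the cross-section of a tube of radius one. -/
def tubeConst (d : ℕ) : ℝ := if h : 0 < d then (exists_volume_real_tube h).choose else 0

lemma ballVol_nonneg : 0 ≤ ballVol d := measureReal_nonneg

lemma tubeConst_nonneg : 0 ≤ tubeConst d := by
  unfold tubeConst
  split_ifs with h
  exacts [(exists_volume_real_tube h).choose_spec.1, le_rfl]

lemma volume_real_tube_zero (hd : 0 < d) {ε t : ℝ} (e : EuclideanSpace ℝ (Fin d)) (hε : 0 < ε)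
    (ht : 0 ≤ t) : volume.real (tube ε e 0 t) =
      ballVol d * ε ^ d + tubeConst d * ε ^ (d - 1) * ‖e‖ * t := by
  unfold tubeConst
  rw [dif_pos hd]
  exact (exists_volume_real_tube hd).choose_spec.2 ε e t hε ht

lemma volume_real_tube (hd : 0 < d) {ε a b : ℝ} (e : EuclideanSpace ℝ (Fin d)) (hε : 0 < ε)
    (hab : a ≤ b) : volume.real (tube ε e a b) =
      ballVol d * ε ^ d + tubeConst d * ε ^ (d - 1) * ‖e‖ * (b - a) := by
  rw [← volume_real_tube_zero hd e hε (sub_nonneg.2 hab), ← volume_real_tube_translate ε e 0 (b - a) a]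
  simp

lemma volume_tube (hd : 0 < d) {ε a b : ℝ} (e : EuclideanSpace ℝ (Fin d)) (hε : 0 < ε)
    (hab : a ≤ b) : volume (tube ε e a b) =
      ENNReal.ofReal (ballVol d * ε ^ d + tubeConst d * ε ^ (d - 1) * ‖e‖ * (b - a)) := by
  rw [← volume_real_tube hd e hε hab, measureReal_def,
    ENNReal.ofReal_toReal (volume_tube_lt_top _ _ _ _).ne]

/-- Being nearly parallel is a symmetric relation. -/
lemma exists_norm_sub_smul_le {q e : EuclideanSpace ℝ (Fin d)} {θ t : ℝ} (hq : q ≠ 0)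
    (hθ : θ ≤ 1 / 2) (h : ‖q - t • e‖ ≤ θ * ‖q‖) : ∃ s : ℝ, ‖e - s • q‖ ≤ 2 * θ * ‖e‖ := by
  have hqp : 0 < ‖q‖ := norm_pos_iff.2 hq
  have hθ0 : 0 ≤ θ := nonneg_of_mul_nonneg_left ((norm_nonneg _).trans h) hqp
  have ht : t ≠ 0 := by
    rintro rfl
    rw [zero_smul, sub_zero] at h
    nlinarith
  -- Since θ ≤ 1/2, the error θ ‖q‖ is absorbed in the left-hand side. The bound 2 θ ‖e‖ then comes
  -- from division by |t|.
  have h2 : ‖q‖ ≤ 2 * (|t| * ‖e‖) := by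
    have h3 : ‖q‖ ≤ ‖q - t • e‖ + ‖t • e‖ := by
      simpa using norm_add_le (q - t • e) (t • e)
    rw [norm_smul, Real.norm_eq_abs] at h3
    nlinarith
  refine ⟨t⁻¹, ?_⟩
  have e1 : e - t⁻¹ • q = -(t⁻¹ • (q - t • e)) := by
    rw [smul_sub, smul_smul, inv_mul_cancel₀ ht, one_smul]; abel
  have htp : 0 < |t| := abs_pos.2 ht
  rw [e1, norm_neg, norm_smul, norm_inv, Real.norm_eq_abs, inv_mul_le_iff₀ htp]
  nlinarith

/-- The vectors of norm at most `R` within distance `θ` of the line spanned by `n`. -/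
def cylinder (θ R : ℝ) (n : EuclideanSpace ℝ (Fin d)) : Set (EuclideanSpace ℝ (Fin d)) :=
  {e | ‖e‖ ≤ R ∧ ∃ t : ℝ, ‖e - t • n‖ ≤ θ}

/-- A point of the line within θ of a vector of norm at most R has norm at most R + θ, so a bounded
segment suffices. Allowing norm at most one, rather than exactly one, covers the degenerate axis n =
0. -/
lemma exists_cylinder_subset_tube {θ R : ℝ} (hθ : 0 ≤ θ) (hR : 0 ≤ R)
    (n : EuclideanSpace ℝ (Fin d)) :
    ∃ (n' : EuclideanSpace ℝ (Fin d)) (a : ℝ), ‖n'‖ ≤ 1 ∧ a = R + θ ∧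
      cylinder θ R n ⊆ tube θ n' (-a) a := by
  rcases eq_or_ne n 0 with rfl | hn
  · refine ⟨0, R + θ, by simp, rfl, ?_⟩
    rintro e ⟨-, t, ht⟩
    exact ⟨0, ⟨by linarith, by linarith⟩, by simpa using ht⟩
  · have hnp : 0 < ‖n‖ := norm_pos_iff.2 hn
    have hunit : ‖‖n‖⁻¹ • n‖ = 1 := by
      rw [norm_smul, norm_inv, norm_norm, inv_mul_cancel₀ hnp.ne']
    refine ⟨‖n‖⁻¹ • n, R + θ, hunit.le, rfl, ?_⟩
    rintro e ⟨he, t, ht⟩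
    have e1 : (t * ‖n‖) • (‖n‖⁻¹ • n) = t • n := by
      rw [smul_smul, mul_assoc, mul_inv_cancel₀ hnp.ne', mul_one]
    have h1 : |t * ‖n‖| ≤ R + θ := by
      have : ‖t • n‖ ≤ ‖e‖ + ‖e - t • n‖ := by
        simpa using norm_sub_le e (e - t • n)
      rw [norm_smul, Real.norm_eq_abs] at this
      rw [abs_mul, abs_norm]
      linarith
    exact ⟨t * ‖n‖, abs_le.1 h1, by rwa [e1]⟩

/-- In dimension at least two, a thin cylinder of bounded length has small volume. -/
lemma volume_cylinder_le (hd : 2 ≤ d) {θ R : ℝ} (hθ : 0 < θ) (hθ1 : θ ≤ 1) (hR : 0 ≤ R)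
    (n : EuclideanSpace ℝ (Fin d)) : volume (cylinder θ R n) ≤
      ENNReal.ofReal ((ballVol d + tubeConst d * (2 * (R + 1))) * θ) := by
  obtain ⟨n', a, hn', rfl, hsub⟩ := exists_cylinder_subset_tube hθ.le hR n
  refine (measure_mono hsub).trans ?_
  rw [volume_tube (by omega) n' hθ (by linarith)]
  refine ENNReal.ofReal_le_ofReal ?_
  have h1 : θ ^ d ≤ θ := pow_le_of_le_one hθ.le hθ1 (by omega)
  -- This needs d - 1 ≥ 1: in dimension one being parallel to a given direction is not a
  -- restriction.
  have h2 : θ ^ (d - 1) ≤ θ := pow_le_of_le_one hθ.le hθ1 (by omega)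
  have hb := ballVol_nonneg (d := d)
  have hk := tubeConst_nonneg (d := d)
  have h3 : tubeConst d * θ ^ (d - 1) * ‖n'‖ * (R + θ - -(R + θ)) ≤
      tubeConst d * θ * 1 * (2 * (R + 1)) := by
    have : R + θ - -(R + θ) ≤ 2 * (R + 1) := by linarith
    have h0 : 0 ≤ R + θ - -(R + θ) := by linarith
    gcongr
  nlinarith [mul_le_mul_of_nonneg_left h1 hb]

lemma finite_latticeVec_le (B : ℝ) : {m : Fin d → ℤ | ‖latticeVec m‖ ≤ B}.Finite := by
  refine (Set.Finite.pi' fun _ : Fin d => Set.finite_Icc (-⌈B⌉) ⌈B⌉).subset fun m hm a => ?_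
  have h1 : |(m a : ℝ)| ≤ B := by
    have := PiLp.norm_apply_le (latticeVec m) a
    simp only [latticeVec, Real.norm_eq_abs] at this
    exact this.trans hm
  have h2 := h1.trans (Int.le_ceil B)
  rw [abs_le] at h2
  exact ⟨by exact_mod_cast h2.1, by exact_mod_cast h2.2⟩

lemma one_le_norm_latticeVec {m : Fin d → ℤ} (hm : latticeVec m ≠ 0) : 1 ≤ ‖latticeVec m‖ := by
  obtain ⟨a, ha⟩ : ∃ a, m a ≠ 0 := by
    by_contra! h
    exact hm (by ext a; simp [latticeVec, h])
  have h1 : (1 : ℝ) ≤ |(m a : ℝ)| := by exact_mod_cast Int.one_le_abs ha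
  have := PiLp.norm_apply_le (latticeVec m) a
  simp only [latticeVec, Real.norm_eq_abs] at this
  exact h1.trans this

/-- Any bound depending on d alone would do; it limits the lattice translates that can matter to a
finite set independent of the particles. -/
lemma torusDist_le_dim (x y : UnitAddTorus (Fin d)) : torusDist x y ≤ d := by
  unfold torusDist
  have h : ∑ a, ‖x a - y a‖ ^ 2 ≤ (d : ℝ) ^ 2 := by
    calc ∑ a, ‖x a - y a‖ ^ 2 ≤ ∑ _a : Fin d, (1 : ℝ) := by
          refine Finset.sum_le_sum fun a _ => ?_
          have h1 : ‖x a - y a‖ ≤ 1 / 2 := by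
            simpa using AddCircle.norm_le_half_period (1 : ℝ) one_ne_zero (x := x a - y a)
          nlinarith [norm_nonneg (x a - y a)]
      _ = d := by simp
      _ ≤ (d : ℝ) ^ 2 := by exact_mod_cast Nat.le_self_pow two_ne_zero d
  exact (Real.sqrt_le_sqrt h).trans (by simp)

/-! ### Collision tubes on the torus -/

/-- In the frame of the second particle the first one moves along u (v - v'). Contact therefore
means that the initial separation lies in the tube around this segment, modulo the lattice. -/
lemma hits_iff {δ r : ℝ} {z z' : Phase d} :
    Hits δ r z z' ↔ ∃ X ∈ tube r (z.2 - z'.2) 0 δ, z'.1 = torusShift z.1 X := by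
  constructor
  · rintro ⟨u, hu, h⟩
    obtain ⟨w, hw, he⟩ := torusDist_le_iff.1 h
    refine ⟨u • (z.2 - z'.2) - w, ⟨u, hu, by simpa using hw⟩, ?_⟩
    simp only [advance] at he
    have : torusShift z.1 (u • (z.2 - z'.2) - w) =
        torusShift (torusShift z.1 (u • z.2)) (-(u • z'.2) - w) := by
      rw [← torusShift_add]; congr 1; rw [smul_sub]; abel
    rw [this, he, ← torusShift_add, ← torusShift_add]
    have : u • z'.2 + (w + (-(u • z'.2) - w)) = 0 := by abel
    rw [this, torusShift_zero]
  · rintro ⟨X, ⟨u, hu, h⟩, he⟩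
    refine ⟨u, hu, torusDist_le_iff.2 ⟨u • (z.2 - z'.2) - X, by rwa [norm_sub_rev], ?_⟩⟩
    simp only [advance]
    rw [he, ← torusShift_add, ← torusShift_add]
    congr 1
    rw [smul_sub]; abel

lemma measurableSet_hits_section (δ r : ℝ) (z : Phase d) (v' : EuclideanSpace ℝ (Fin d)) :
    MeasurableSet {x' : UnitAddTorus (Fin d) | Hits δ r z (x', v')} := by
  have h : Measurable fun x' : UnitAddTorus (Fin d) => (z, ((x', v') : Phase d)) :=
    measurable_const.prodMk (measurable_id.prodMk measurable_const)
  exact h (measurableSet_hits δ r)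

lemma setLIntegral_hits_section_le {h : UnitAddTorus (Fin d) → ℝ≥0∞} (hh : Measurable h)
    (δ r : ℝ) (z : Phase d) (v' : EuclideanSpace ℝ (Fin d)) :
    ∫⁻ x' in {x' : UnitAddTorus (Fin d) | Hits δ r z (x', v')}, h x' ≤
      ∫⁻ X in tube r (z.2 - v') 0 δ, h (torusShift z.1 X) := by
  refine setLIntegral_torus_le hh z.1 (measurableSet_hits_section δ r z v')
    (measurableSet_tube r (z.2 - v') 0 δ) ?_
  intro y hy
  have hy' : Hits δ r z (y, v') := hy
  obtain ⟨X, hX, he⟩ := hits_iff.1 hy'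
  exact ⟨X, hX, he⟩

lemma volume_hits_section_le (hd : 0 < d) {δ ε : ℝ} (hδ : 0 ≤ δ) (hε : 0 < ε) (z : Phase d)
    (v' : EuclideanSpace ℝ (Fin d)) :
    volume {x' : UnitAddTorus (Fin d) | Hits δ ε z (x', v')} ≤
      ENNReal.ofReal (ballVol d * ε ^ d + tubeConst d * ε ^ (d - 1) * ‖z.2 - v'‖ * δ) := by
  have := setLIntegral_hits_section_le (h := fun _ => 1) measurable_const δ ε z v'
  simpa [volume_tube hd _ hε hδ] using this

/-- The lift to Euclidean space of a common point of two collision tubes. -/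
lemma exists_lattice_of_hits {δ ε R : ℝ} {x y x' : UnitAddTorus (Fin d)}
    {v w v' P : EuclideanSpace ℝ (Fin d)} (hP : y = torusShift x P)
    (hv : ‖v - v'‖ ≤ R) (hw : ‖w - v'‖ ≤ R)
    (h1 : Hits δ ε (x, v) (x', v')) (h2 : Hits δ ε (y, w) (x', v')) :
    ∃ m : Fin d → ℤ, ‖latticeVec m‖ ≤ 2 * (ε + δ * R) + ‖P‖ ∧ ∃ X, x' = torusShift x X ∧
      ∃ u ∈ Set.Icc (0 : ℝ) δ, ∃ u' ∈ Set.Icc (0 : ℝ) δ, ‖X - u • (v - v')‖ ≤ ε ∧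
        ‖u • (v - v') - u' • (w - v') - (P + latticeVec m)‖ ≤ 2 * ε := by
  obtain ⟨X, ⟨u, hu, hX⟩, hx⟩ := hits_iff.1 h1
  obtain ⟨X', ⟨u', hu', hX'⟩, hx'⟩ := hits_iff.1 h2
  simp only at hx hx' hX hX'
  rw [hP, ← torusShift_add, hx, torusShift_eq_iff] at hx'
  obtain ⟨m, hm⟩ := hx'
  have hδ : 0 ≤ δ := hu.1.trans hu.2
  have hR : 0 ≤ R := (norm_nonneg _).trans hv
  -- A point of a collision tube has norm at most ε + δ R, which bounds the lattice vector relating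
  -- the two lifts.
  have bd : ∀ (Y e : EuclideanSpace ℝ (Fin d)) (s : ℝ), s ∈ Set.Icc 0 δ → ‖e‖ ≤ R →
      ‖Y - s • e‖ ≤ ε → ‖Y‖ ≤ ε + δ * R := by
    intro Y e s hs he hY
    have : ‖Y‖ ≤ ‖Y - s • e‖ + ‖s • e‖ := by simpa using norm_add_le (Y - s • e) (s • e)
    rw [norm_smul, Real.norm_of_nonneg hs.1] at this
    have : s * ‖e‖ ≤ δ * R := mul_le_mul hs.2 he (norm_nonneg _) hδ
    linarith
  refine ⟨m, ?_, X, hx, u, hu, u', hu', hX, ?_⟩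
  · have e1 : latticeVec m = X - (P + X') := by rw [hm]; abel
    have b1 := bd X _ u hu hv hX
    have b2 := bd X' _ u' hu' hw hX'
    rw [e1]
    have := norm_sub_le X (P + X')
    have := norm_add_le P X'
    linarith
  · have e1 : u • (v - v') - u' • (w - v') - (P + latticeVec m) =
        (X' - u' • (w - v')) - (X - u • (v - v')) := by rw [hm]; abel
    rw [e1]
    have := norm_sub_le (X' - u' • (w - v')) (X - u • (v - v'))
    linarith

/-- Two collision tubes with transversal directions have a small intersection. -/
lemma volume_hits_inter_le (hd : 0 < d) {δ ε R θ : ℝ} (hε : 0 < ε) (hε1 : ε ≤ 1)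
    {z y : Phase d} {v' : EuclideanSpace ℝ (Fin d)} (hv : ‖z.2 - v'‖ ≤ R) (hw : ‖y.2 - v'‖ ≤ R)
    (hθ : 0 < θ * ‖z.2 - y.2‖)
    (hq : ∀ t : ℝ, θ * ‖z.2 - y.2‖ ≤ ‖(z.2 - y.2) - t • (y.2 - v')‖) :
    volume {x' : UnitAddTorus (Fin d) | Hits δ ε z (x', v') ∧ Hits δ ε y (x', v')} ≤
      (finite_latticeVec_le (d := d) (2 * (1 + δ * R) + d)).toFinset.card *
        ENNReal.ofReal (ballVol d * ε ^ d +
          tubeConst d * ε ^ (d - 1) * R * (8 * ε / (θ * ‖z.2 - y.2‖))) := by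
  obtain ⟨x, v⟩ := z
  obtain ⟨y, w⟩ := y
  simp only at hv hw hθ hq ⊢
  obtain ⟨P, hP, hy⟩ := exists_torusShift_eq y x
  set ℓ : ℝ := 4 * ε / (θ * ‖v - w‖) with hℓ
  have hℓ0 : 0 ≤ ℓ := by positivity
  set J : (Fin d → ℤ) → Set ℝ := fun m => {u | u ∈ Set.Icc (0 : ℝ) δ ∧ ∃ u' ∈ Set.Icc (0 : ℝ) δ,
    ‖u • (v - v') - u' • (w - v') - (P + latticeVec m)‖ ≤ 2 * ε} with hJ
  -- For a fixed lattice vector, subtracting the near-contact relations at two times u, t eliminates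
  -- the separation P + m. Transversality then gives |u - t| θ ‖v - w‖ ≤ 4 ε, so the intersection
  -- lies in short pieces of the first tube, one for each admissible m.
  have hJd : ∀ m, ∀ u ∈ J m, ∀ t ∈ J m, |u - t| ≤ ℓ := by
    rintro m u ⟨-, u', -, hu⟩ t ⟨-, t', -, ht⟩
    have h4 : ‖(u - t) • (v - w) - (u' - t' - (u - t)) • (w - v')‖ ≤ 4 * ε := by
      have e1 : (u - t) • (v - w) - (u' - t' - (u - t)) • (w - v') =
          (u • (v - v') - u' • (w - v') - (P + latticeVec m)) -
          (t • (v - v') - t' • (w - v') - (P + latticeVec m)) := by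
        module
      rw [e1]
      refine (norm_sub_le _ _).trans (by linarith)
    rcases eq_or_ne u t with rfl | hne
    · simpa using hℓ0
    · have hp : 0 < |u - t| := abs_pos.2 (sub_ne_zero.2 hne)
      have e2 : (u - t) • (v - w) - (u' - t' - (u - t)) • (w - v') =
          (u - t) • ((v - w) - ((u' - t' - (u - t)) / (u - t)) • (w - v')) := by
        rw [smul_sub (u - t) (v - w), smul_smul, mul_div_cancel₀ _ (sub_ne_zero.2 hne)]
      rw [e2, norm_smul, Real.norm_eq_abs] at h4
      rw [hℓ, le_div_iff₀ hθ]
      exact (mul_le_mul_of_nonneg_left (hq _) hp.le).trans h4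
  have hA : ∀ m, ∃ a : ℝ, ∀ u ∈ J m, u ∈ Set.Icc (a - ℓ) (a + ℓ) := by
    intro m
    rcases (J m).eq_empty_or_nonempty with h | ⟨a, ha⟩
    · exact ⟨0, by simp [h]⟩
    · refine ⟨a, fun u hu => ?_⟩
      have := abs_le.1 (hJd m u hu a ha)
      exact ⟨by linarith [this.1], by linarith [this.2]⟩
  choose a ha using hA
  set M := (finite_latticeVec_le (d := d) (2 * (1 + δ * R) + d)).toFinset with hM
  have hT : MeasurableSet {x' : UnitAddTorus (Fin d) |
      Hits δ ε (x, v) (x', v') ∧ Hits δ ε (y, w) (x', v')} :=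
    (measurableSet_hits_section δ ε (x, v) v').inter (measurableSet_hits_section δ ε (y, w) v')
  have key := setLIntegral_torus_le (h := fun _ => 1) measurable_const x hT
    (S := ⋃ m ∈ M, tube ε (v - v') (a m - ℓ) (a m + ℓ))
    (Finset.measurableSet_biUnion _ fun m _ => measurableSet_tube _ _ _ _) ?_
  · simp only [lintegral_const, one_mul, Measure.restrict_apply_univ] at key
    refine key.trans ((measure_biUnion_finset_le _ _).trans ?_)
    rw [← nsmul_eq_mul, ← Finset.sum_const]
    refine Finset.sum_le_sum fun m _ => ?_
    rw [volume_tube hd _ hε (by linarith)]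
    refine ENNReal.ofReal_le_ofReal ?_
    have hk := tubeConst_nonneg (d := d)
    have e3 : a m + ℓ - (a m - ℓ) = 8 * ε / (θ * ‖v - w‖) := by rw [hℓ]; ring
    rw [e3]
    gcongr
  · rintro x' ⟨h1, h2⟩
    obtain ⟨m, hm, X, hX, u, hu, u', hu', hXu, hm'⟩ := exists_lattice_of_hits hy hv hw h1 h2
    refine ⟨X, Set.mem_biUnion (x := m) ?_ ⟨u, ha m u ⟨hu, u', hu', hm'⟩, hXu⟩, hX⟩
    have : torusDist y x ≤ d := torusDist_le_dim _ _
    simp only [hM, Finset.mem_coe, Set.Finite.mem_toFinset, Set.mem_ofPred_eq]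
    linarith

/-- Two collision tubes with nearly equal directions, but with separated starting points, are
disjoint unless their direction is nearly parallel to the separation. -/
lemma exists_cylinder_of_hits {δ ε R K L : ℝ} (hε : 0 < ε) (hε1 : ε ≤ 1) (hδ : 0 ≤ δ)
    (hL : 2 * (2 + δ * K) ≤ L) (hL0 : 0 < L) {z y : Phase d} {v' : EuclideanSpace ℝ (Fin d)}
    {P : EuclideanSpace ℝ (Fin d)} (hP : y.1 = torusShift z.1 P) (hPd : ‖P‖ ≤ d)
    {x' : UnitAddTorus (Fin d)}
    (hv : ‖z.2 - v'‖ ≤ R) (hw : ‖y.2 - v'‖ ≤ R) (hq : ‖z.2 - y.2‖ ≤ K * ε)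
    (hsep : L * ε < torusDist z.1 y.1)
    (h1 : Hits δ ε z (x', v')) (h2 : Hits δ ε y (x', v')) :
    ∃ m ∈ (finite_latticeVec_le (d := d) (2 * (1 + δ * R) + d)).toFinset,
      y.2 - v' ∈ cylinder (2 * ((2 + δ * K) / L) * R) R (P + latticeVec m) := by
  obtain ⟨x, v⟩ := z
  obtain ⟨y, w⟩ := y
  simp only at hv hw hq hP hsep ⊢
  obtain ⟨m, hm, X, hX, u, hu, u', hu', hXu, hm'⟩ := exists_lattice_of_hits hP hv hw h1 h2
  refine ⟨m, ?_, hw, ?_⟩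
  · simp only [Set.Finite.mem_toFinset, Set.mem_ofPred_eq]
    linarith
  set p := P + latticeVec m with hp
  -- The torus distance is a lower bound for the norm of every lift of the separation.
  have hpn : L * ε < ‖p‖ := by
    refine hsep.trans_le ?_
    rw [torusDist_comm, hP, ← torusShift_add_latticeVec]
    exact torusDist_torusShift_le _ _
  have hp0 : p ≠ 0 := norm_pos_iff.1 ((mul_pos hL0 hε).trans hpn)
  -- The contact conditions cost 2 ε and the velocity difference at most δ K ε. Relative to ‖p‖ > L
  -- ε, the separation therefore makes an angle of order (2 + δ K) / L with w - v'.
  have hnear : ‖p - (u - u') • (w - v')‖ ≤ (2 + δ * K) / L * ‖p‖ := by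
    have e1 : p - (u - u') • (w - v') =
        u • (v - w) - (u • (v - v') - u' • (w - v') - p) := by module
    have h3 : ‖u • (v - w)‖ ≤ δ * (K * ε) := by
      rw [norm_smul, Real.norm_of_nonneg hu.1]
      exact mul_le_mul hu.2 hq (norm_nonneg _) hδ
    have h4 : ‖p - (u - u') • (w - v')‖ ≤ (2 + δ * K) * ε := by
      rw [e1]
      refine (norm_sub_le _ _).trans (by linarith)
    have h5 : (0 : ℝ) ≤ 2 + δ * K := nonneg_of_mul_nonneg_left ((norm_nonneg _).trans h4) hε
    rw [div_mul_eq_mul_div, le_div_iff₀ hL0]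
    calc _ ≤ (2 + δ * K) * ε * L := by gcongr
      _ = (2 + δ * K) * (L * ε) := by ring
      _ ≤ _ := by gcongr
  obtain ⟨s, hs⟩ := exists_norm_sub_smul_le hp0
    (by rw [div_le_iff₀ hL0]; linarith) hnear
  refine ⟨s, hs.trans ?_⟩
  have h5 : (0 : ℝ) ≤ (2 + δ * K) / L :=
    nonneg_of_mul_nonneg_left ((norm_nonneg _).trans hnear) (norm_pos_iff.2 hp0)
  gcongr

end HardSphere
end

/-! ### Integrals over thin tubes and line integrals -/

open MeasureTheory Filter Topology
open scoped ENNReal BigOperators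

noncomputable section

namespace HardSphere

variable {d : ℕ}

lemma tube_mono (ε : ℝ) (e : EuclideanSpace ℝ (Fin d)) {a s t : ℝ} (hst : s ≤ t) :
    tube ε e a s ⊆ tube ε e a t :=
  fun _ ⟨u, hu, h⟩ => ⟨u, ⟨hu.1, hu.2.trans hst⟩, h⟩

lemma integrableOn_tube {H : EuclideanSpace ℝ (Fin d) → ℝ} (hc : Continuous H) {M : ℝ}
    (hM : ∀ X, |H X| ≤ M) (ε : ℝ) (e : EuclideanSpace ℝ (Fin d)) (a b : ℝ) :
    IntegrableOn H (tube ε e a b) :=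
  Measure.integrableOn_of_bounded (volume_tube_lt_top ε e a b).ne hc.aestronglyMeasurable
    (Eventually.of_forall hM)

/-- Lengthening the tube from s to s' adds a region of volume exactly c (s' - s), with c the
coefficient in front of the line integral. This region lies within ρ of s • e, so both increments
equal c (s' - s) H (s • e) up to ω c (s' - s). -/
lemma abs_tube_increment_le (hd : 0 < d) {ε ρ t ω M : ℝ} (hε : 0 < ε)
    (e : EuclideanSpace ℝ (Fin d)) {H : EuclideanSpace ℝ (Fin d) → ℝ} (hc : Continuous H)
    (hM : ∀ X, |H X| ≤ M)
    (hω : ∀ u ∈ Set.Icc 0 t, ∀ X, ‖X - u • e‖ ≤ ρ → |H X - H (u • e)| ≤ ω)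
    {s s' : ℝ} (hs : 0 ≤ s) (hss : s ≤ s') (hst : s' ≤ t) (hρ : ε + (s' - s) * ‖e‖ ≤ ρ) :
    |((∫ X in tube ε e 0 s', H X) - tubeConst d * ε ^ (d - 1) * ‖e‖ * ∫ u in (0 : ℝ)..s', H (u • e))
      - ((∫ X in tube ε e 0 s, H X) - tubeConst d * ε ^ (d - 1) * ‖e‖ * ∫ u in (0 : ℝ)..s, H (u • e))|
      ≤ 2 * ω * (tubeConst d * ε ^ (d - 1) * ‖e‖) * (s' - s) := by
  set c := tubeConst d * ε ^ (d - 1) * ‖e‖ with hcdef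
  have hc0 : 0 ≤ c := by have := tubeConst_nonneg (d := d); positivity
  have hsub := tube_mono ε e (a := 0) hss
  set D := tube ε e 0 s' \ tube ε e 0 s with hD
  have hDm : MeasurableSet D := (measurableSet_tube _ _ _ _).diff (measurableSet_tube _ _ _ _)
  have hDf : volume D < ∞ := (measure_mono Set.sdiff_subset).trans_lt (volume_tube_lt_top ε e 0 s')
  have hDv : volume.real D = c * (s' - s) := by
    rw [hD, measureReal_sdiff hsub (measurableSet_tube _ _ _ _) (volume_tube_lt_top _ _ _ _).ne,
      volume_real_tube_zero hd e hε (hs.trans hss), volume_real_tube_zero hd e hε hs]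
    ring
  have hD1 : ∫ X in D, H X = (∫ X in tube ε e 0 s', H X) - ∫ X in tube ε e 0 s, H X :=
    setIntegral_sdiff (measurableSet_tube _ _ _ _) (integrableOn_tube hc hM _ _ _ _) hsub
  have hline : Continuous fun u : ℝ => H (u • e) := hc.comp (by fun_prop)
  have hD2 : (∫ u in (0 : ℝ)..s', H (u • e)) - (∫ u in (0 : ℝ)..s, H (u • e)) =
      ∫ u in s..s', H (u • e) :=
    intervalIntegral.integral_interval_sub_left (hline.intervalIntegrable _ _)
      (hline.intervalIntegrable _ _)
  have hsI : s ∈ Set.Icc 0 t := ⟨hs, hss.trans hst⟩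
  have hB1 : |(∫ X in D, H X) - c * (s' - s) * H (s • e)| ≤ ω * (c * (s' - s)) := by
    have : (∫ X in D, H X) - c * (s' - s) * H (s • e) = ∫ X in D, (H X - H (s • e)) := by
      rw [integral_sub ((integrableOn_tube hc hM ε e 0 s').mono_set Set.sdiff_subset)
        (integrableOn_const hDf.ne), setIntegral_const, hDv, smul_eq_mul]
    rw [this, ← hDv]
    refine norm_setIntegral_le_of_norm_le_const (f := fun X => H X - H (s • e)) hDf
      fun X hX => ?_
    refine hω s hsI X ?_
    obtain ⟨⟨u, hu, h⟩, hX'⟩ := hX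
    have hus : s ≤ u := by
      by_contra hlt
      exact hX' ⟨u, ⟨hu.1, (not_le.1 hlt).le⟩, h⟩
    have h3 : ‖X - s • e‖ ≤ ‖X - u • e‖ + ‖(u - s) • e‖ := by
      have : X - s • e = (X - u • e) + (u - s) • e := by rw [sub_smul]; abel
      rw [this]; exact norm_add_le _ _
    rw [norm_smul, Real.norm_of_nonneg (sub_nonneg.2 hus)] at h3
    have : (u - s) * ‖e‖ ≤ (s' - s) * ‖e‖ := by have := hu.2; gcongr
    linarith
  have hB2 : |(∫ u in s..s', H (u • e)) - (s' - s) * H (s • e)| ≤ ω * (s' - s) := by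
    have : (∫ u in s..s', H (u • e)) - (s' - s) * H (s • e) =
        ∫ u in s..s', (H (u • e) - H (s • e)) := by
      rw [intervalIntegral.integral_sub (hline.intervalIntegrable _ _)
        intervalIntegrable_const, intervalIntegral.integral_const, smul_eq_mul]
    rw [this]
    have h4 := intervalIntegral.norm_integral_le_of_norm_le_const (a := s) (b := s') (C := ω)
      (f := fun u => H (u • e) - H (s • e)) fun u hu => ?_
    · rwa [abs_of_nonneg (sub_nonneg.2 hss)] at h4
    · rw [Set.uIoc_of_le hss] at hu
      refine hω s hsI _ ?_
      rw [← sub_smul, norm_smul, Real.norm_of_nonneg (by linarith [hu.1])]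
      have : (u - s) * ‖e‖ ≤ (s' - s) * ‖e‖ := by have := hu.2; gcongr
      linarith
  have split : ((∫ X in tube ε e 0 s', H X) - c * ∫ u in (0 : ℝ)..s', H (u • e))
      - ((∫ X in tube ε e 0 s, H X) - c * ∫ u in (0 : ℝ)..s, H (u • e)) =
      ((∫ X in D, H X) - c * (s' - s) * H (s • e)) -
        c * ((∫ u in s..s', H (u • e)) - (s' - s) * H (s • e)) := by
    rw [hD1, ← hD2]; ring
  rw [split]
  refine (abs_sub _ _).trans ?_
  rw [abs_mul, abs_of_nonneg hc0]
  nlinarith [mul_le_mul_of_nonneg_left hB2 hc0]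

/-- The integral of a slowly varying function over a thin tube is close to a line integral. -/
theorem abs_tube_integral_sub_le (hd : 0 < d) {ε ρ t ω M : ℝ} (hε : 0 < ε) (hερ : ε < ρ)
    (ht : 0 ≤ t) (e : EuclideanSpace ℝ (Fin d)) {H : EuclideanSpace ℝ (Fin d) → ℝ}
    (hc : Continuous H) (hM : ∀ X, |H X| ≤ M)
    (hω : ∀ u ∈ Set.Icc 0 t, ∀ X, ‖X - u • e‖ ≤ ρ → |H X - H (u • e)| ≤ ω) :
    |(∫ X in tube ε e 0 t, H X) -
        tubeConst d * ε ^ (d - 1) * ‖e‖ * ∫ u in (0 : ℝ)..t, H (u • e)| ≤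
      M * (ballVol d * ε ^ d) + 2 * ω * (tubeConst d * ε ^ (d - 1) * ‖e‖) * t := by
  set c := tubeConst d * ε ^ (d - 1) * ‖e‖ with hcdef
  -- K is so large that each of the K steps has length (t / K) ‖e‖ ≤ ρ - ε, as the increment
  -- estimate requires; the errors of the steps sum to a quantity independent of K.
  obtain ⟨K, hK⟩ := exists_nat_gt (t * ‖e‖ / (ρ - ε))
  have hρε : 0 < ρ - ε := sub_pos.2 hερ
  have hK0 : (0 : ℝ) < K := lt_of_le_of_lt (by positivity) hK
  set Φ : ℝ → ℝ := fun s => (∫ X in tube ε e 0 s, H X) - c * ∫ u in (0 : ℝ)..s, H (u • e) with hΦ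
  have hstep : ∀ k : ℕ, k ≤ K → |Φ (k * (t / K)) - Φ 0| ≤ 2 * ω * c * (k * (t / K)) := by
    intro k
    induction k with
    | zero => intro _; simp
    | succ k ih =>
      intro hk
      have ih' := ih (by omega)
      have h1 : ((k + 1 : ℕ) : ℝ) * (t / K) - k * (t / K) = t / K := by push_cast; ring
      have h2 := abs_tube_increment_le hd (t := t) (ρ := ρ) hε e hc hM hω
        (s := k * (t / K)) (s' := ((k + 1 : ℕ) : ℝ) * (t / K)) (by positivity)
        (by push_cast; nlinarith [div_nonneg ht hK0.le])
        (by
          rw [← mul_div_assoc, div_le_iff₀ hK0, mul_comm]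
          have : ((k + 1 : ℕ) : ℝ) ≤ K := by exact_mod_cast hk
          gcongr)
        (by
          rw [h1]
          rw [div_lt_iff₀ hρε] at hK
          have : t / K * ‖e‖ ≤ ρ - ε := by
            rw [div_mul_eq_mul_div, div_le_iff₀ hK0]; nlinarith
          linarith)
      rw [h1] at h2
      have h3 : 2 * ω * c * (((k + 1 : ℕ) : ℝ) * (t / K)) =
        2 * ω * c * (t / K) + 2 * ω * c * (k * (t / K)) := by push_cast; ring
      rw [h3]
      have := abs_sub_le (Φ (((k + 1 : ℕ) : ℝ) * (t / K))) (Φ (k * (t / K))) (Φ 0)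
      refine this.trans (add_le_add h2 ih')
  have hend := hstep K le_rfl
  rw [mul_div_cancel₀ _ hK0.ne'] at hend
  -- What remains at s = 0 is the integral over the initial ball, of order ε^d.
  have hΦ0 : |Φ 0| ≤ M * (ballVol d * ε ^ d) := by
    have : Φ 0 = ∫ X in tube ε e 0 0, H X := by simp [hΦ]
    rw [this]
    have h5 := norm_setIntegral_le_of_norm_le_const (C := M) (volume_tube_lt_top ε e 0 0)
      (f := H) fun X _ => hM X
    rw [volume_real_tube_zero hd e hε le_rfl, mul_zero, add_zero] at h5
    exact h5
  have : |Φ t| ≤ |Φ t - Φ 0| + |Φ 0| := by simpa using abs_add_le (Φ t - Φ 0) (Φ 0)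
  have h6 : |Φ t| ≤ M * (ballVol d * ε ^ d) + 2 * ω * c * t := by linarith
  exact h6

/-- If the tube meets its translate by a nonzero lattice vector m, then m is within 2 ε of the line
spanned by e. As ‖m‖ ≥ 1, the direction e is nearly parallel to one of finitely many lattice
vectors; the excluded velocities avoid this. -/
lemma tube_covering_injective {δ ε R : ℝ} (hε1 : ε ≤ 1 / 4)
    {e : EuclideanSpace ℝ (Fin d)} (he : ‖e‖ ≤ R)
    (hcyl : ∀ m ∈ (finite_latticeVec_le (d := d) (2 * (1 + δ * R) + d)).toFinset,
      latticeVec m ≠ 0 → e ∉ cylinder (4 * ε * R) R (latticeVec m)) :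
    ∀ X ∈ tube ε e 0 δ, ∀ m : Fin d → ℤ, X + latticeVec m ∈ tube ε e 0 δ → latticeVec m = 0 := by
  rintro X ⟨u, hu, hX⟩ m ⟨u', hu', hX'⟩
  by_contra hm
  have h1 : ‖latticeVec m - (u' - u) • e‖ ≤ 2 * ε := by
    have : latticeVec m - (u' - u) • e = (X + latticeVec m - u' • e) - (X - u • e) := by
      rw [sub_smul]; abel
    rw [this]
    exact (norm_sub_le _ _).trans (by linarith)
  have hε0 : 0 ≤ ε := (norm_nonneg _).trans hX
  have hR : 0 ≤ R := (norm_nonneg _).trans he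
  have hδ : 0 ≤ δ := hu.1.trans hu.2
  have h2 : ‖latticeVec m‖ ≤ 2 * (1 + δ * R) + d := by
    have h3 : ‖latticeVec m‖ ≤ ‖latticeVec m - (u' - u) • e‖ + ‖(u' - u) • e‖ := by
      simpa using norm_add_le (latticeVec m - (u' - u) • e) ((u' - u) • e)
    have h4 : ‖(u' - u) • e‖ ≤ δ * R := by
      rw [norm_smul, Real.norm_eq_abs]
      refine mul_le_mul ?_ he (norm_nonneg _) hδ
      rw [abs_le]; constructor <;> linarith [hu.1, hu.2, hu'.1, hu'.2]
    have := mul_nonneg hδ hR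
    have : (0 : ℝ) ≤ d := Nat.cast_nonneg d
    linarith
  have hone := one_le_norm_latticeVec hm
  obtain ⟨s, hs⟩ := exists_norm_sub_smul_le (θ := 2 * ε) hm (by linarith)
    (h1.trans (by nlinarith))
  refine hcyl m (by simpa using h2) hm ⟨he, s, hs.trans ?_⟩
  nlinarith

/-- The integral of a slowly varying function over the particle positions colliding with `z`,
for a generic velocity. -/
theorem abs_setIntegral_hits_sub_le (hd : 0 < d) {δ ε ρ ω M R : ℝ} (hε : 0 < ε)
    (hε1 : ε ≤ 1 / 4) (hερ : ε < ρ) (hδ : 0 ≤ δ) {z : Phase d} {v' : EuclideanSpace ℝ (Fin d)}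
    (he : ‖z.2 - v'‖ ≤ R)
    (hcyl : ∀ m ∈ (finite_latticeVec_le (d := d) (2 * (1 + δ * R) + d)).toFinset,
      latticeVec m ≠ 0 → z.2 - v' ∉ cylinder (4 * ε * R) R (latticeVec m))
    {h : UnitAddTorus (Fin d) → ℝ} (hc : Continuous h) (h0 : ∀ x, 0 ≤ h x) (hM : ∀ x, h x ≤ M)
    (hω : ∀ x w, ‖w‖ ≤ ρ → |h (torusShift x w) - h x| ≤ ω) :
    |(∫ x' in {x' : UnitAddTorus (Fin d) | Hits δ ε z (x', v')}, h x') -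
      tubeConst d * ε ^ (d - 1) * ‖z.2 - v'‖ *
        ∫ u in (0 : ℝ)..δ, h (torusShift z.1 (u • (z.2 - v')))| ≤
      M * (ballVol d * ε ^ d) + 2 * ω * (tubeConst d * ε ^ (d - 1) * ‖z.2 - v'‖) * δ := by
  set e := z.2 - v' with hedef
  have hcomp : Continuous fun X : EuclideanSpace ℝ (Fin d) => h (torusShift z.1 X) :=
    hc.comp (continuous_torusShift.comp (Continuous.prodMk continuous_const continuous_id))
  have hT := measurableSet_hits_section δ ε z v'
  have heq : ∫ x' in {x' : UnitAddTorus (Fin d) | Hits δ ε z (x', v')}, h x' =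
      ∫ X in tube ε e 0 δ, h (torusShift z.1 X) := by
    rw [integral_eq_lintegral_of_nonneg_ae (Eventually.of_forall h0) hc.aestronglyMeasurable,
      integral_eq_lintegral_of_nonneg_ae (Eventually.of_forall fun X => h0 _)
        hcomp.aestronglyMeasurable]
    congr 1
    refine setLIntegral_torus_eq (h := fun x => ENNReal.ofReal (h x)) hc.measurable.ennreal_ofReal
      z.1 hT (measurableSet_tube ε e 0 δ) ?_ (tube_covering_injective hε1 he hcyl)
    intro y
    constructor
    · intro hy
      have hy' : Hits δ ε z (y, v') := hy
      obtain ⟨X, hX, hx⟩ := hits_iff.1 hy'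
      exact ⟨X, hX, hx⟩
    · rintro ⟨X, hX, hx⟩
      have : Hits δ ε z (y, v') := hits_iff.2 ⟨X, hX, hx⟩
      exact this
  rw [heq]
  refine abs_tube_integral_sub_le hd hε hερ hδ e hcomp (M := M) (fun X => ?_) fun u _ X hX => ?_
  · rw [abs_of_nonneg (h0 _)]; exact hM _
  · have : torusShift z.1 X = torusShift (torusShift z.1 (u • e)) (X - u • e) := by
      rw [← torusShift_add]; congr 1; abel
    rw [this]
    exact hω _ _ hX

end HardSphere
end

open MeasureTheory Filter Topology
open scoped ENNReal BigOperators

noncomputable section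

namespace HardSphere

/-! ### The collision operator -/

variable {d : ℕ} {β μ : ℝ} {f₀ : Phase d → ℝ}

/-- The Gaussian upper bound for the one-particle density. -/
def gaussWeight (β μ : ℝ) (v : EuclideanSpace ℝ (Fin d)) : ℝ := Real.exp (-(μ + β / 2 * ‖v‖ ^ 2))

/-- A continuous probability density with Gaussian velocity tails. -/
structure IsProfile (β μ : ℝ) (f₀ : Phase d → ℝ) : Prop where
  pos : 0 < β
  cont : Continuous f₀
  nonneg : ∀ z, 0 ≤ f₀ z
  integral_eq : ∫ z, f₀ z = 1
  le_gauss : ∀ z, f₀ z ≤ gaussWeight β μ z.2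

lemma IsProfile.integrable (hf : IsProfile β μ f₀) : Integrable f₀ := by
  by_contra h
  have := hf.integral_eq
  rw [integral_undef h] at this
  exact zero_ne_one this

lemma gaussWeight_pos (v : EuclideanSpace ℝ (Fin d)) : 0 < gaussWeight β μ v := Real.exp_pos _

lemma continuous_gaussWeight :
    Continuous (gaussWeight β μ : EuclideanSpace ℝ (Fin d) → ℝ) := by
  unfold gaussWeight; fun_prop

lemma integrable_gaussWeight_mul (hβ : 0 < β) :
    Integrable fun v : EuclideanSpace ℝ (Fin d) => gaussWeight β μ v * (1 + ‖v‖) ^ 2 := by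
  have hg : Integrable fun v : EuclideanSpace ℝ (Fin d) => Real.exp (-(β / 4) * ‖v‖ ^ 2) := by
    have h := (GaussianFourier.integrable_cexp_neg_mul_sq_norm_add (V := EuclideanSpace ℝ (Fin d))
      (b := ((β / 4 : ℝ) : ℂ)) (by simpa using hβ) 0 0).norm
    refine h.congr (Eventually.of_forall fun v => ?_)
    simp only [Complex.norm_exp]
    congr 1
    simp [← Complex.ofReal_pow]
  refine (hg.const_mul (Real.exp (-μ) * (2 + 8 / β))).mono'
    (by have := continuous_gaussWeight (d := d) (β := β) (μ := μ); fun_prop)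
    (Eventually.of_forall fun v => ?_)
  rw [Real.norm_of_nonneg (mul_nonneg (gaussWeight_pos v).le (by positivity))]
  have e1 : gaussWeight β μ v =
      Real.exp (-μ) * (Real.exp (-(β / 4) * ‖v‖ ^ 2) * Real.exp (-(β / 4 * ‖v‖ ^ 2))) := by
    rw [gaussWeight, ← Real.exp_add, ← Real.exp_add]; congr 1; ring
  -- Half of the Gaussian exponent absorbs the polynomial factor; the other half remains integrable.
  have e2 : (1 + ‖v‖) ^ 2 ≤ (2 + 8 / β) * Real.exp (β / 4 * ‖v‖ ^ 2) := by
    have h1 := Real.add_one_le_exp (β / 4 * ‖v‖ ^ 2)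
    have h2 : (2 + 8 / β) * (β / 4 * ‖v‖ ^ 2 + 1) =
        2 * ‖v‖ ^ 2 + 2 + (β / 2 * ‖v‖ ^ 2 + 8 / β) := by field_simp; ring
    have h3 : (0 : ℝ) ≤ β / 2 * ‖v‖ ^ 2 + 8 / β := by positivity
    have h4 : (0 : ℝ) ≤ 2 + 8 / β := by positivity
    nlinarith [mul_le_mul_of_nonneg_left h1 h4, sq_nonneg (1 - ‖v‖)]
  rw [e1, Real.exp_neg (β / 4 * ‖v‖ ^ 2)]
  have hp := Real.exp_pos (β / 4 * ‖v‖ ^ 2)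
  calc Real.exp (-μ) * (Real.exp (-(β / 4) * ‖v‖ ^ 2) * (Real.exp (β / 4 * ‖v‖ ^ 2))⁻¹) *
        (1 + ‖v‖) ^ 2 ≤
      Real.exp (-μ) * (Real.exp (-(β / 4) * ‖v‖ ^ 2) * (Real.exp (β / 4 * ‖v‖ ^ 2))⁻¹) *
        ((2 + 8 / β) * Real.exp (β / 4 * ‖v‖ ^ 2)) := by gcongr
    _ = _ := by field_simp

/-- The second velocity moment of the Gaussian weight. -/
def gaussMoment (d : ℕ) (β μ : ℝ) : ℝ :=
  ∫ v : EuclideanSpace ℝ (Fin d), gaussWeight β μ v * (1 + ‖v‖) ^ 2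

lemma gaussMoment_nonneg : 0 ≤ gaussMoment d β μ :=
  integral_nonneg fun v => mul_nonneg (gaussWeight_pos v).le (by positivity)

lemma lintegral_gaussWeight_mul (hβ : 0 < β) :
    ∫⁻ v : EuclideanSpace ℝ (Fin d), ENNReal.ofReal (gaussWeight β μ v * (1 + ‖v‖) ^ 2) =
      ENNReal.ofReal (gaussMoment d β μ) :=
  (ofReal_integral_eq_lintegral_ofReal (integrable_gaussWeight_mul hβ)
    (Eventually.of_forall fun v => mul_nonneg (gaussWeight_pos v).le (by positivity))).symm

lemma lintegral_gaussWeight_le (hβ : 0 < β) :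
    ∫⁻ v : EuclideanSpace ℝ (Fin d), ENNReal.ofReal (gaussWeight β μ v) ≤
      ENNReal.ofReal (gaussMoment d β μ) := by
  rw [← lintegral_gaussWeight_mul hβ]
  refine lintegral_mono fun v => ENNReal.ofReal_le_ofReal ?_
  exact le_mul_of_one_le_right (gaussWeight_pos v).le (by nlinarith [norm_nonneg v])

lemma lintegral_gaussWeight_mul_one_le (hβ : 0 < β) :
    ∫⁻ v : EuclideanSpace ℝ (Fin d), ENNReal.ofReal (gaussWeight β μ v * (1 + ‖v‖)) ≤
      ENNReal.ofReal (gaussMoment d β μ) := by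
  rw [← lintegral_gaussWeight_mul hβ]
  refine lintegral_mono fun v => ENNReal.ofReal_le_ofReal ?_
  exact mul_le_mul_of_nonneg_left (by nlinarith [norm_nonneg v]) (gaussWeight_pos v).le

/-- Tonelli with the velocity outside: phase-space estimates reduce to the volumes of position
sections at fixed velocity. -/
lemma lintegral_profile_le (hf : IsProfile β μ f₀) {T : Set (Phase d)} (hT : MeasurableSet T)
    {ψ : EuclideanSpace ℝ (Fin d) → ℝ≥0∞} (hψ : Measurable ψ) :
    ∫⁻ z' in T, ENNReal.ofReal (f₀ z') * ψ z'.2 ≤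
      ∫⁻ v', ENNReal.ofReal (gaussWeight β μ v') * ψ v' *
        volume {x' : UnitAddTorus (Fin d) | (x', v') ∈ T} := by
  have hm : Measurable (T.indicator fun z' : Phase d => ENNReal.ofReal (f₀ z') * ψ z'.2) :=
    (hf.cont.measurable.ennreal_ofReal.mul (hψ.comp measurable_snd)).indicator hT
  rw [← lintegral_indicator hT, Measure.volume_eq_prod, lintegral_prod_symm' _ hm]
  refine lintegral_mono fun v' => ?_
  have hTv : MeasurableSet {x' : UnitAddTorus (Fin d) | (x', v') ∈ T} :=
    measurable_prodMk_right hT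
  rw [← lintegral_indicator_const hTv]
  refine lintegral_mono fun x' => ?_
  by_cases h : (x', v') ∈ T
  · rw [Set.indicator_of_mem h, Set.indicator_of_mem (by exact h)]
    gcongr
    exact hf.le_gauss _
  · rw [Set.indicator_of_notMem h]; exact zero_le

/-- The phase points colliding with `z`. -/
def hitSet (δ ε : ℝ) (z : Phase d) : Set (Phase d) := {z' | Hits δ ε z z'}

lemma measurableSet_hitSet (δ ε : ℝ) (z : Phase d) : MeasurableSet (hitSet δ ε z) :=
  measurable_prodMk_left (measurableSet_hits δ ε)

/-- The collision operator `φ ↦ ∫ μ_ε f₀(z') 𝟙(z, z' collide) φ(z') dz'`. -/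
def collisionOp (f₀ : Phase d → ℝ) (δ ε : ℝ) (φ : Phase d → ℝ≥0∞) (z : Phase d) : ℝ≥0∞ :=
  ∫⁻ z' in hitSet δ ε z, ENNReal.ofReal (activity d ε) * (ENNReal.ofReal (f₀ z') * φ z')

lemma collisionOp_mono {δ ε : ℝ} {φ φ' : Phase d → ℝ≥0∞} (h : ∀ z, φ z ≤ φ' z) (z : Phase d) :
    collisionOp f₀ δ ε φ z ≤ collisionOp f₀ δ ε φ' z :=
  lintegral_mono fun z' => by have := h z'; gcongr

lemma collisionOp_add {δ ε : ℝ} (hf : IsProfile β μ f₀) {φ φ' : Phase d → ℝ≥0∞}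
    (h : Measurable φ) (z : Phase d) : collisionOp f₀ δ ε (fun z => φ z + φ' z) z =
      collisionOp f₀ δ ε φ z + collisionOp f₀ δ ε φ' z := by
  unfold collisionOp
  have hm : Measurable fun z' => ENNReal.ofReal (activity d ε) * (ENNReal.ofReal (f₀ z') * φ z') :=
    (hf.cont.measurable.ennreal_ofReal.mul h).const_mul _
  simp_rw [mul_add]
  exact lintegral_add_left hm _

lemma collisionOp_const_mul {δ ε : ℝ} (hf : IsProfile β μ f₀) {φ : Phase d → ℝ≥0∞}
    (h : Measurable φ) (c : ℝ≥0∞) (z : Phase d) :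
    collisionOp f₀ δ ε (fun z => c * φ z) z = c * collisionOp f₀ δ ε φ z := by
  unfold collisionOp
  have hm : Measurable fun z' => ENNReal.ofReal (activity d ε) * (ENNReal.ofReal (f₀ z') * φ z') :=
    (hf.cont.measurable.ennreal_ofReal.mul h).const_mul _
  rw [← lintegral_const_mul _ hm]
  refine lintegral_congr fun z' => ?_
  ring

lemma activity_pos {ε : ℝ} (hε : 0 < ε) : 0 < activity d ε := by unfold activity; positivity

lemma activity_mul_pow_pred {ε : ℝ} (hε : 0 < ε) : activity d ε * ε ^ (d - 1) = 1 := by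
  unfold activity; exact inv_mul_cancel₀ (by positivity)

lemma activity_mul_pow (hd : 0 < d) {ε : ℝ} (hε : 0 < ε) : activity d ε * ε ^ d = ε := by
  have : ε ^ d = ε ^ (d - 1) * ε := by rw [← pow_succ, Nat.sub_add_cancel hd]
  rw [this, ← mul_assoc, activity_mul_pow_pred hε, one_mul]

/-- The geometric constant in the bound for collision tubes. -/
def tubeBound (d : ℕ) : ℝ := ballVol d + tubeConst d

lemma tubeBound_nonneg : 0 ≤ tubeBound d := add_nonneg ballVol_nonneg tubeConst_nonneg

/-- The activity cancels the cross-section ε^{d-1}; the end ball leaves ε, which is at most δ. The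
bound is thus linear in δ and uniform in ε, and a short time horizon makes the collision operator
small. -/
lemma activity_mul_volume_hits_le (hd : 0 < d) {δ ε : ℝ} (hε : 0 < ε) (hεδ : ε ≤ δ) (z : Phase d)
    (v' : EuclideanSpace ℝ (Fin d)) :
    ENNReal.ofReal (activity d ε) * volume {x' : UnitAddTorus (Fin d) | Hits δ ε z (x', v')} ≤
      ENNReal.ofReal (tubeBound d * δ * (1 + ‖z.2‖)) * ENNReal.ofReal (1 + ‖v'‖) := by
  have hδ : 0 ≤ δ := hε.le.trans hεδ
  have hb := ballVol_nonneg (d := d)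
  have hk := tubeConst_nonneg (d := d)
  have ha := (activity_pos (d := d) hε).le
  calc _ ≤ ENNReal.ofReal (activity d ε) * ENNReal.ofReal
        (ballVol d * ε ^ d + tubeConst d * ε ^ (d - 1) * ‖z.2 - v'‖ * δ) := by
        gcongr; exact volume_hits_section_le hd hδ hε z v'
    _ = ENNReal.ofReal (ballVol d * ε + tubeConst d * ‖z.2 - v'‖ * δ) := by
        rw [← ENNReal.ofReal_mul ha]
        congr 1
        calc _ = ballVol d * (activity d ε * ε ^ d) +
              tubeConst d * (activity d ε * ε ^ (d - 1)) * ‖z.2 - v'‖ * δ := by ring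
          _ = _ := by rw [activity_mul_pow hd hε, activity_mul_pow_pred hε]; ring
    _ ≤ ENNReal.ofReal (tubeBound d * δ * (1 + ‖z.2‖) * (1 + ‖v'‖)) := by
        refine ENNReal.ofReal_le_ofReal ?_
        have h1 : ‖z.2 - v'‖ ≤ (1 + ‖z.2‖) * (1 + ‖v'‖) := by
          have := norm_sub_le z.2 v'
          nlinarith [norm_nonneg z.2, norm_nonneg v', mul_nonneg (norm_nonneg z.2) (norm_nonneg v')]
        have h2 : (1 : ℝ) ≤ (1 + ‖z.2‖) * (1 + ‖v'‖) := by
          nlinarith [norm_nonneg z.2, norm_nonneg v', mul_nonneg (norm_nonneg z.2) (norm_nonneg v')]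
        have h3 : ballVol d * ε ≤ ballVol d * δ * ((1 + ‖z.2‖) * (1 + ‖v'‖)) := by
          calc ballVol d * ε ≤ ballVol d * δ * 1 := by rw [mul_one]; gcongr
            _ ≤ _ := by gcongr
        have h4 : tubeConst d * ‖z.2 - v'‖ * δ ≤ tubeConst d * ((1 + ‖z.2‖) * (1 + ‖v'‖)) * δ := by
          gcongr
        unfold tubeBound
        nlinarith
    _ = _ := by
        have := tubeBound_nonneg (d := d)
        rw [ENNReal.ofReal_mul (by positivity)]

/-- The basic bound for the collision operator. -/
theorem collisionOp_le (hd : 0 < d) (hf : IsProfile β μ f₀) {δ ε : ℝ} (hε : 0 < ε) (hεδ : ε ≤ δ)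
    {φ : Phase d → ℝ≥0∞} {ψ : EuclideanSpace ℝ (Fin d) → ℝ≥0∞} (hψ : Measurable ψ)
    (hφ : ∀ z, φ z ≤ ψ z.2) (z : Phase d) :
    collisionOp f₀ δ ε φ z ≤ ENNReal.ofReal (tubeBound d * δ * (1 + ‖z.2‖)) *
      ∫⁻ v', ENNReal.ofReal (gaussWeight β μ v' * (1 + ‖v'‖)) * ψ v' := by
  have hw : Measurable fun v' : EuclideanSpace ℝ (Fin d) =>
      ENNReal.ofReal (gaussWeight β μ v' * (1 + ‖v'‖)) * ψ v' :=
    ((continuous_gaussWeight.measurable.mul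
      (measurable_const.add measurable_norm)).ennreal_ofReal).mul hψ
  calc collisionOp f₀ δ ε φ z ≤ collisionOp f₀ δ ε (fun z => ψ z.2) z := collisionOp_mono hφ z
    _ = ENNReal.ofReal (activity d ε) *
        ∫⁻ z' in hitSet δ ε z, ENNReal.ofReal (f₀ z') * ψ z'.2 :=
        lintegral_const_mul _ (hf.cont.measurable.ennreal_ofReal.mul (hψ.comp measurable_snd))
    _ ≤ ENNReal.ofReal (activity d ε) * ∫⁻ v', ENNReal.ofReal (gaussWeight β μ v') * ψ v' *
        volume {x' : UnitAddTorus (Fin d) | (x', v') ∈ hitSet δ ε z} := by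
        gcongr
        exact lintegral_profile_le hf (measurableSet_hitSet δ ε z) hψ
    _ = ∫⁻ v', ENNReal.ofReal (activity d ε) * (ENNReal.ofReal (gaussWeight β μ v') * ψ v' *
        volume {x' : UnitAddTorus (Fin d) | (x', v') ∈ hitSet δ ε z}) :=
        (lintegral_const_mul' _ _ ENNReal.ofReal_ne_top).symm
    _ ≤ ∫⁻ v', ENNReal.ofReal (tubeBound d * δ * (1 + ‖z.2‖)) *
        (ENNReal.ofReal (gaussWeight β μ v' * (1 + ‖v'‖)) * ψ v') := by
        refine lintegral_mono fun v' => ?_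
        have h := activity_mul_volume_hits_le hd hε hεδ z v'
        calc _ = (ENNReal.ofReal (gaussWeight β μ v') * ψ v') * (ENNReal.ofReal (activity d ε) *
              volume {x' : UnitAddTorus (Fin d) | Hits δ ε z (x', v')}) := by
              simp only [hitSet, Set.mem_ofPred_eq]; ring
          _ ≤ (ENNReal.ofReal (gaussWeight β μ v') * ψ v') *
              (ENNReal.ofReal (tubeBound d * δ * (1 + ‖z.2‖)) * ENNReal.ofReal (1 + ‖v'‖)) := by
              gcongr
          _ = _ := by
              rw [ENNReal.ofReal_mul (gaussWeight_pos v').le]; ring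
    _ = _ := lintegral_const_mul _ hw

end HardSphere
end

open MeasureTheory Filter Topology
open scoped ENNReal BigOperators

noncomputable section

namespace HardSphere

/-! ### Smallness of recollisions -/

variable {d : ℕ} {β μ : ℝ} {f₀ : Phase d → ℝ}

/-- Markov's inequality: on the tail one factor 1 + ‖v‖ exceeds 1 + R' and is traded for the second
moment. -/
lemma lintegral_gaussWeight_tail_le (hβ : 0 < β) {R' : ℝ} (hR' : 0 ≤ R') :
    ∫⁻ v in {v : EuclideanSpace ℝ (Fin d) | R' < ‖v‖},
      ENNReal.ofReal (gaussWeight β μ v * (1 + ‖v‖)) ≤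
      ENNReal.ofReal (gaussMoment d β μ / (1 + R')) := by
  have hm : MeasurableSet {v : EuclideanSpace ℝ (Fin d) | R' < ‖v‖} :=
    measurableSet_lt measurable_const measurable_norm
  calc _ ≤ ∫⁻ v in {v : EuclideanSpace ℝ (Fin d) | R' < ‖v‖}, ENNReal.ofReal (1 + R')⁻¹ *
        ENNReal.ofReal (gaussWeight β μ v * (1 + ‖v‖) ^ 2) := by
        refine setLIntegral_mono' hm fun v hv => ?_
        have hv' : R' < ‖v‖ := hv
        rw [← ENNReal.ofReal_mul (by positivity)]
        refine ENNReal.ofReal_le_ofReal ?_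
        have hg := (gaussWeight_pos (β := β) (μ := μ) v).le
        rw [← div_eq_inv_mul, le_div_iff₀ (by positivity)]
        have : (1 + ‖v‖) * (1 + R') ≤ (1 + ‖v‖) ^ 2 := by nlinarith
        calc _ = gaussWeight β μ v * ((1 + ‖v‖) * (1 + R')) := by ring
          _ ≤ _ := by gcongr
    _ ≤ ∫⁻ v : EuclideanSpace ℝ (Fin d), ENNReal.ofReal (1 + R')⁻¹ *
        ENNReal.ofReal (gaussWeight β μ v * (1 + ‖v‖) ^ 2) := setLIntegral_le_lintegral _ _
    _ = _ := by
        rw [lintegral_const_mul' _ _ ENNReal.ofReal_ne_top, lintegral_gaussWeight_mul hβ,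
          ← ENNReal.ofReal_mul (by positivity)]
        congr 1; ring

/-- Small sets of velocities have small weight, uniformly up to large velocities. -/
theorem exists_setLIntegral_gaussWeight_le (hβ : 0 < β) {τ : ℝ} (hτ : 0 < τ) :
    ∃ R' > 0, ∃ ρ > 0, ∀ E : Set (EuclideanSpace ℝ (Fin d)),
      volume (E ∩ Metric.closedBall 0 R') ≤ ENNReal.ofReal ρ →
      ∫⁻ v in E, ENNReal.ofReal (gaussWeight β μ v * (1 + ‖v‖)) ≤ ENNReal.ofReal τ := by
  set M := gaussMoment d β μ
  have hM : 0 ≤ M := gaussMoment_nonneg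
  set τ' := τ / 2 with hτ'
  have hτ'0 : 0 < τ' := by positivity
  set W : EuclideanSpace ℝ (Fin d) → ℝ≥0∞ := fun v => ENNReal.ofReal (gaussWeight β μ v * (1 + ‖v‖))
  have hW : ∫⁻ v, W v ≠ ⊤ :=
    ((lintegral_gaussWeight_mul_one_le hβ).trans_lt ENNReal.ofReal_lt_top).ne
  obtain ⟨η, hη, hη'⟩ := exists_pos_setLIntegral_lt_of_measure_lt hW
    (ε := ENNReal.ofReal τ') (by simpa using hτ'0)
  obtain ⟨ρ, hρ0, hρη⟩ := ENNReal.lt_iff_exists_real_btwn.1 hη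
  refine ⟨M / τ' + 1, by positivity, ρ, by simpa using hρη.1, fun E hvol => ?_⟩
  set R' := M / τ' + 1 with hR'
  have hR'0 : 0 ≤ R' := by positivity
  have htail : ∫⁻ v in {v : EuclideanSpace ℝ (Fin d) | R' < ‖v‖}, W v ≤ ENNReal.ofReal τ' := by
    refine (lintegral_gaussWeight_tail_le hβ hR'0).trans (ENNReal.ofReal_le_ofReal ?_)
    rw [div_le_iff₀ (by positivity)]
    have : τ' * (M / τ') = M := by field_simp
    rw [hR']; nlinarith
  have hsub : E ⊆ (E ∩ Metric.closedBall 0 R') ∪ {v | R' < ‖v‖} := fun v hv => by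
    by_cases h : R' < ‖v‖
    · exact Or.inr h
    · exact Or.inl ⟨hv, by simpa using h⟩
  calc ∫⁻ v in E, W v ≤ ∫⁻ v in (E ∩ Metric.closedBall 0 R') ∪ {v | R' < ‖v‖}, W v :=
        lintegral_mono_set hsub
    _ ≤ _ := lintegral_union_le _ _ _
    _ ≤ _ := add_le_add (hη' _ (hvol.trans_lt hρη.2)).le htail
    _ = ENNReal.ofReal τ := by rw [← ENNReal.ofReal_add hτ'0.le hτ'0.le, hτ', add_halves]

/-- Collisions with velocities in a small set, or with large velocities, are rare. -/
theorem exists_collisionOp_velocity_le (hd : 0 < d) (hf : IsProfile β μ f₀) {δ : ℝ} (hδ : 0 < δ)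
    {R τ : ℝ} (hR : 0 ≤ R) (hτ : 0 < τ) : ∃ R' > 0, ∃ ρ > 0, ∀ ε, 0 < ε → ε ≤ δ →
      ∀ z : Phase d, ‖z.2‖ ≤ R → ∀ E : Set (EuclideanSpace ℝ (Fin d)), MeasurableSet E →
      volume (E ∩ Metric.closedBall 0 R') ≤ ENNReal.ofReal ρ →
      collisionOp f₀ δ ε (fun z' => E.indicator 1 z'.2) z ≤ ENNReal.ofReal τ := by
  set c := tubeBound d * δ * (1 + R)
  have hc : 0 ≤ c := mul_nonneg (mul_nonneg tubeBound_nonneg hδ.le) (by linarith)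
  obtain ⟨R', hR', ρ, hρ, H⟩ := exists_setLIntegral_gaussWeight_le (d := d) (μ := μ) hf.pos
    (τ := τ / (c + 1)) (by positivity)
  refine ⟨R', hR', ρ, hρ, fun ε hε hεδ z hz E hE hvol => ?_⟩
  calc collisionOp f₀ δ ε (fun z' => E.indicator 1 z'.2) z ≤
      ENNReal.ofReal (tubeBound d * δ * (1 + ‖z.2‖)) *
        ∫⁻ v', ENNReal.ofReal (gaussWeight β μ v' * (1 + ‖v'‖)) * E.indicator 1 v' :=
        collisionOp_le hd hf hε hεδ (measurable_one.indicator hE) (fun _ => le_rfl) z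
    _ ≤ ENNReal.ofReal c * ENNReal.ofReal (τ / (c + 1)) := by
        have h2 : ∫⁻ v', ENNReal.ofReal (gaussWeight β μ v' * (1 + ‖v'‖)) * E.indicator 1 v' =
            ∫⁻ v' in E, ENNReal.ofReal (gaussWeight β μ v' * (1 + ‖v'‖)) := by
          rw [← lintegral_indicator hE]
          refine lintegral_congr fun v => ?_
          by_cases h : v ∈ E <;> simp [h]
        rw [h2]
        refine mul_le_mul' (ENNReal.ofReal_le_ofReal ?_) (H E hvol)
        exact mul_le_mul_of_nonneg_left (by linarith) (mul_nonneg tubeBound_nonneg hδ.le)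
    _ = ENNReal.ofReal (c * (τ / (c + 1))) := by rw [← ENNReal.ofReal_mul hc]
    _ ≤ ENNReal.ofReal τ := by
        refine ENNReal.ofReal_le_ofReal ?_
        have : (c + 1) * (τ / (c + 1)) = τ := by field_simp
        have h3 : 0 < τ / (c + 1) := by positivity
        nlinarith

/-- Simultaneous collisions with two particles are rare as soon as they are rare for all but few
velocities. -/
theorem exists_collisionOp_hitSet_le (hd : 0 < d) (hf : IsProfile β μ f₀) {δ : ℝ} (hδ : 0 < δ)
    {R τ : ℝ} (hR : 0 ≤ R) (hτ : 0 < τ) : ∃ R' > 0, ∃ ρ > 0, ∃ τ' > 0, ∀ ε, 0 < ε → ε ≤ δ →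
      ∀ z : Phase d, ‖z.2‖ ≤ R → ∀ (y : Phase d) (E : Set (EuclideanSpace ℝ (Fin d))),
      volume E ≤ ENNReal.ofReal ρ →
      (∀ v', ‖v'‖ ≤ R' → v' ∉ E → ENNReal.ofReal (activity d ε) *
        volume {x' : UnitAddTorus (Fin d) | Hits δ ε z (x', v') ∧ Hits δ ε y (x', v')} ≤
          ENNReal.ofReal τ') →
      collisionOp f₀ δ ε ((hitSet δ ε y).indicator 1) z ≤ ENNReal.ofReal τ := by
  obtain ⟨R', hR', ρ, hρ, H⟩ := exists_collisionOp_velocity_le hd hf hδ hR (half_pos hτ)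
  set M := gaussMoment d β μ
  have hM : 0 ≤ M := gaussMoment_nonneg
  refine ⟨R', hR', ρ, hρ, τ / (2 * (M + 1)), by positivity, fun ε hε hεδ z hz y E hE hv => ?_⟩
  set τ' := τ / (2 * (M + 1)) with hτ'
  have hτ'0 : 0 < τ' := by positivity
  -- E need not be measurable, so it is replaced by a measurable hull, enlarged by the large
  -- velocities.
  set E' : Set (EuclideanSpace ℝ (Fin d)) := toMeasurable volume E ∪ {v | R' < ‖v‖}
  have hE' : MeasurableSet E' := (measurableSet_toMeasurable _ _).union
    (measurableSet_lt measurable_const measurable_norm)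
  have h1 : collisionOp f₀ δ ε (fun z' => E'.indicator 1 z'.2) z ≤ ENNReal.ofReal (τ / 2) := by
    refine H ε hε hεδ z hz E' hE' (le_trans (measure_mono ?_) ((measure_toMeasurable E).trans_le hE))
    rintro v ⟨h | h, hb⟩
    · exact h
    · exact absurd (show R' < ‖v‖ from h) (by simpa using hb)
  set T := hitSet δ ε z ∩ hitSet δ ε y
  have hT : MeasurableSet T := (measurableSet_hitSet δ ε z).inter (measurableSet_hitSet δ ε y)
  have h2 : collisionOp f₀ δ ε (fun z' => (hitSet δ ε y).indicator 1 z' *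
      E'ᶜ.indicator 1 z'.2) z ≤ ENNReal.ofReal (τ / 2) := by
    have hi : Measurable fun z' : Phase d => ENNReal.ofReal (f₀ z') * E'ᶜ.indicator 1 z'.2 :=
      hf.cont.measurable.ennreal_ofReal.mul
        ((measurable_one.indicator hE'.compl).comp measurable_snd)
    calc _ = ENNReal.ofReal (activity d ε) *
          ∫⁻ z' in T, ENNReal.ofReal (f₀ z') * E'ᶜ.indicator 1 z'.2 := by
          rw [← lintegral_const_mul _ hi, ← lintegral_indicator hT, collisionOp,
            ← lintegral_indicator (measurableSet_hitSet δ ε z)]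
          refine lintegral_congr fun z' => ?_
          by_cases ha : z' ∈ hitSet δ ε z <;> by_cases hb : z' ∈ hitSet δ ε y <;> simp [T, ha, hb]
      _ ≤ ENNReal.ofReal (activity d ε) * ∫⁻ v', ENNReal.ofReal (gaussWeight β μ v') *
          E'ᶜ.indicator 1 v' * volume {x' : UnitAddTorus (Fin d) | (x', v') ∈ T} := by
          gcongr
          exact lintegral_profile_le hf hT (measurable_one.indicator hE'.compl)
      _ = ∫⁻ v', ENNReal.ofReal (activity d ε) * (ENNReal.ofReal (gaussWeight β μ v') *
          E'ᶜ.indicator 1 v' * volume {x' : UnitAddTorus (Fin d) | (x', v') ∈ T}) :=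
          (lintegral_const_mul' _ _ ENNReal.ofReal_ne_top).symm
      _ ≤ ∫⁻ v' : EuclideanSpace ℝ (Fin d),
          ENNReal.ofReal (gaussWeight β μ v') * ENNReal.ofReal τ' := by
          refine lintegral_mono fun v' => ?_
          by_cases hv' : v' ∈ E'
          · simp [hv']
          · have h3 : v' ∉ E := fun h => hv' (Or.inl (subset_toMeasurable _ _ h))
            have h4 : ‖v'‖ ≤ R' := not_lt.1 fun h => hv' (Or.inr h)
            have h5 := hv v' h4 h3
            rw [Set.indicator_of_mem (by exact hv')]
            calc _ = ENNReal.ofReal (gaussWeight β μ v') * (ENNReal.ofReal (activity d ε) *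
                volume {x' : UnitAddTorus (Fin d) |
                  Hits δ ε z (x', v') ∧ Hits δ ε y (x', v')}) := by
                  simp only [T, hitSet, Set.mem_inter_iff, Set.mem_ofPred_eq, Pi.one_apply]; ring
              _ ≤ _ := by gcongr
      _ = (∫⁻ v' : EuclideanSpace ℝ (Fin d), ENNReal.ofReal (gaussWeight β μ v')) *
          ENNReal.ofReal τ' := lintegral_mul_const' _ _ ENNReal.ofReal_ne_top
      _ ≤ ENNReal.ofReal M * ENNReal.ofReal τ' := by
          gcongr; exact lintegral_gaussWeight_le hf.pos
      _ ≤ ENNReal.ofReal (τ / 2) := by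
          rw [← ENNReal.ofReal_mul hM]
          refine ENNReal.ofReal_le_ofReal ?_
          have : (M + 1) * τ' = τ / 2 := by rw [hτ']; field_simp
          nlinarith
  calc collisionOp f₀ δ ε ((hitSet δ ε y).indicator 1) z ≤
      collisionOp f₀ δ ε (fun z' => E'.indicator 1 z'.2 + (hitSet δ ε y).indicator 1 z' *
        E'ᶜ.indicator 1 z'.2) z := by
        refine collisionOp_mono (fun z' => ?_) z
        by_cases h : z'.2 ∈ E'
        · by_cases hy : z' ∈ hitSet δ ε y <;> simp [h, hy]
        · by_cases hy : z' ∈ hitSet δ ε y <;> simp [h, hy]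
    _ = _ := collisionOp_add hf ((measurable_one.indicator hE').comp measurable_snd) z
    _ ≤ ENNReal.ofReal (τ / 2) + ENNReal.ofReal (τ / 2) := add_le_add h1 h2
    _ = ENNReal.ofReal τ := by
        rw [← ENNReal.ofReal_add (by linarith) (by linarith), add_halves]

/-- The geometric constant in the volume of a cylinder. -/
def cylinderBound (d : ℕ) (R : ℝ) : ℝ := ballVol d + tubeConst d * (2 * (R + 1))

lemma cylinderBound_nonneg {R : ℝ} (hR : 0 ≤ R) : 0 ≤ cylinderBound d R :=
  add_nonneg ballVol_nonneg (mul_nonneg tubeConst_nonneg (by linarith))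

lemma volume_sub_mem_cylinder_le (hd : 2 ≤ d) {θ R : ℝ} (hθ : 0 < θ) (hθ1 : θ ≤ 1) (hR : 0 ≤ R)
    (w n : EuclideanSpace ℝ (Fin d)) :
    volume {v' | w - v' ∈ cylinder θ R n} ≤ ENNReal.ofReal (cylinderBound d R * θ) := by
  have h := (Measure.measurePreserving_sub_left
    (volume : Measure (EuclideanSpace ℝ (Fin d))) w).measure_preimage_equiv
    (f := MeasurableEquiv.subLeft w) (cylinder θ R n)
  exact h.trans_le (volume_cylinder_le hd hθ hθ1 hR n)

/-- Particles with well separated velocities rarely collide with a third one. -/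
theorem exists_collisionOp_hitSet_le_of_velocity (hd : 2 ≤ d) (hf : IsProfile β μ f₀) {δ : ℝ}
    (hδ : 0 < δ) {R τ : ℝ} (hR : 0 ≤ R) (hτ : 0 < τ) : ∃ K > 0, ∃ ε₀ > 0, ∀ ε, 0 < ε → ε < ε₀ →
      ∀ z y : Phase d, ‖z.2‖ ≤ R → ‖y.2‖ ≤ R → K * ε ≤ ‖z.2 - y.2‖ →
      collisionOp f₀ δ ε ((hitSet δ ε y).indicator 1) z ≤ ENNReal.ofReal τ := by
  obtain ⟨R', hR', ρ, hρ, τ', hτ', H⟩ :=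
    exists_collisionOp_hitSet_le (by omega) hf hδ hR hτ
  set R₂ := R + R'
  have hR₂ : 0 < R₂ := by positivity
  have hC := cylinderBound_nonneg (d := d) hR₂.le
  set C := cylinderBound d R₂
  set n := (finite_latticeVec_le (d := d) (2 * (1 + δ * R₂) + d)).toFinset.card
  have hb := ballVol_nonneg (d := d)
  have hk := tubeConst_nonneg (d := d)
  -- The third velocities for which the two tubes are not θ-transversal form a cylinder of radius 2
  -- θ R₂; θ makes its volume at most ρ.
  obtain ⟨θ, hθ, hθ2, hθ1, hθρ⟩ : ∃ θ > 0, θ ≤ 1 / 2 ∧ 2 * θ * R₂ ≤ 1 ∧ C * (2 * θ * R₂) ≤ ρ := by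
    refine ⟨min (1 / 2) (min (1 / (2 * R₂)) (ρ / ((C + 1) * (2 * R₂)))), by positivity,
      min_le_left _ _, ?_, ?_⟩
    · have h := (min_le_right (1 / 2 : ℝ) (min (1 / (2 * R₂)) (ρ / ((C + 1) * (2 * R₂))))).trans
        (min_le_left _ _)
      rw [le_div_iff₀ (by positivity)] at h
      linarith
    · have h := (min_le_right (1 / 2 : ℝ) (min (1 / (2 * R₂)) (ρ / ((C + 1) * (2 * R₂))))).trans
        (min_le_right _ _)
      have h0 : 0 < min (1 / 2 : ℝ) (min (1 / (2 * R₂)) (ρ / ((C + 1) * (2 * R₂)))) := by positivity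
      rw [le_div_iff₀ (by positivity)] at h
      nlinarith [mul_pos h0 hR₂]
  -- The overlap length 8 ε / (θ ‖z.2 - y.2‖) is at most 8 / (θ K), and this K makes its total
  -- contribution at most τ' / 2. The other half of τ' is left for the end balls, of order ε.
  set K := 16 * (n * tubeConst d * R₂) / (θ * τ') + 1 with hK
  have hK0 : 0 < K := by positivity
  refine ⟨K, hK0, min (min δ 1) (τ' / (2 * (n * ballVol d + 1))), by positivity,
    fun ε hε hε₀ z y hz hy hq => ?_⟩
  have hε₁ : ε ≤ δ := hε₀.le.trans ((min_le_left _ _).trans (min_le_left _ _))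
  have hε₂ : ε ≤ 1 := hε₀.le.trans ((min_le_left _ _).trans (min_le_right _ _))
  have hε₃ : ε ≤ τ' / (2 * (n * ballVol d + 1)) := hε₀.le.trans (min_le_right _ _)
  have hq0 : 0 < ‖z.2 - y.2‖ := (mul_pos hK0 hε).trans_le hq
  refine H ε hε hε₁ z hz y {v' | y.2 - v' ∈ cylinder (2 * θ * R₂) R₂ (z.2 - y.2)}
    ((volume_sub_mem_cylinder_le hd (by positivity) hθ1 hR₂.le _ _).trans
      (ENNReal.ofReal_le_ofReal hθρ)) fun v' hv' hE => ?_
  have hzv : ‖z.2 - v'‖ ≤ R₂ := (norm_sub_le _ _).trans (add_le_add hz hv')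
  have hyv : ‖y.2 - v'‖ ≤ R₂ := (norm_sub_le _ _).trans (add_le_add hy hv')
  have hsep : ∀ t : ℝ, θ * ‖z.2 - y.2‖ ≤ ‖(z.2 - y.2) - t • (y.2 - v')‖ := by
    intro t
    by_contra! h
    obtain ⟨s, hs⟩ := exists_norm_sub_smul_le (norm_pos_iff.1 hq0) hθ2 h.le
    exact hE ⟨hyv, s, hs.trans (by gcongr)⟩
  have hv := volume_hits_inter_le (δ := δ) (by omega) hε hε₂ hzv hyv (mul_pos hθ hq0) hsep
  have ha := (activity_pos (d := d) hε).le
  calc _ ≤ ENNReal.ofReal (activity d ε) * (n * ENNReal.ofReal (ballVol d * ε ^ d +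
        tubeConst d * ε ^ (d - 1) * R₂ * (8 * ε / (θ * ‖z.2 - y.2‖)))) := by gcongr
    _ = ENNReal.ofReal (activity d ε * (n * (ballVol d * ε ^ d +
        tubeConst d * ε ^ (d - 1) * R₂ * (8 * ε / (θ * ‖z.2 - y.2‖))))) := by
        rw [ENNReal.ofReal_mul ha, ENNReal.ofReal_mul (Nat.cast_nonneg n), ENNReal.ofReal_natCast]
    _ ≤ ENNReal.ofReal τ' := by
        refine ENNReal.ofReal_le_ofReal ?_
        have e1 : activity d ε * (n * (ballVol d * ε ^ d +
            tubeConst d * ε ^ (d - 1) * R₂ * (8 * ε / (θ * ‖z.2 - y.2‖)))) =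
            n * ballVol d * ε + n * tubeConst d * R₂ * (8 * ε / (θ * ‖z.2 - y.2‖)) := by
          calc _ = n * ballVol d * (activity d ε * ε ^ d) + n * tubeConst d *
                (activity d ε * ε ^ (d - 1)) * R₂ * (8 * ε / (θ * ‖z.2 - y.2‖)) := by ring
            _ = _ := by rw [activity_mul_pow (by omega) hε, activity_mul_pow_pred hε]; ring
        rw [e1]
        have h1 : n * ballVol d * ε ≤ τ' / 2 := by
          rw [le_div_iff₀ (by positivity)] at hε₃
          nlinarith
        have h2 : n * tubeConst d * R₂ * (8 * ε / (θ * ‖z.2 - y.2‖)) ≤ τ' / 2 := by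
          have h3 : 8 * ε / (θ * ‖z.2 - y.2‖) ≤ 8 / (θ * K) := by
            rw [div_le_div_iff₀ (by positivity) (by positivity)]
            nlinarith
          have h4 : n * tubeConst d * R₂ * (8 / (θ * K)) ≤ τ' / 2 := by
            rw [← mul_div_assoc, div_le_iff₀ (by positivity), hK]
            have : τ' / 2 * (θ * (16 * (n * tubeConst d * R₂) / (θ * τ') + 1)) =
              n * tubeConst d * R₂ * 8 + τ' / 2 * θ := by field_simp; ring
            rw [this]
            have := mul_pos hτ' hθ
            linarith
          exact (mul_le_mul_of_nonneg_left h3 (by positivity)).trans h4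
        linarith

/-- Particles which stay apart from each other rarely collide with a third one. -/
theorem exists_collisionOp_hitSet_le_of_not_hits (hd : 2 ≤ d) (hf : IsProfile β μ f₀) {δ : ℝ}
    (hδ : 0 < δ) {R τ : ℝ} (hR : 0 ≤ R) (hτ : 0 < τ) : ∃ ε₀ > 0, ∀ ε, 0 < ε → ε < ε₀ →
      ∀ z y : Phase d, ‖z.2‖ ≤ R → ‖y.2‖ ≤ R → ¬ Hits δ (ε * |Real.log ε|) z y →
      collisionOp f₀ δ ε ((hitSet δ ε y).indicator 1) z ≤ ENNReal.ofReal τ := by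
  obtain ⟨K, hK, ε₁, hε₁, HK⟩ := exists_collisionOp_hitSet_le_of_velocity hd hf hδ hR hτ
  obtain ⟨R', hR', ρ, hρ, τ', hτ', H⟩ :=
    exists_collisionOp_hitSet_le (by omega) hf hδ hR hτ
  set R₂ := R + R'
  have hR₂ : 0 < R₂ := by positivity
  have hC := cylinderBound_nonneg (d := d) hR₂.le
  set C := cylinderBound d R₂
  set F := (finite_latticeVec_le (d := d) (2 * (1 + δ * R₂) + d)).toFinset
  set n := F.card
  set A := 2 * (2 + δ * K) * R₂
  have hA : 0 < A := by positivity
  -- For L ≥ L₀ the cylinders of radius A / L are thin (radius at most 1), their union over F has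
  -- volume at most ρ, and the disjointness criterion for nearly equal velocities applies with L =
  -- |log ε|.
  set L₀ := max (max 1 (2 * (2 + δ * K))) (max A (n * C * A / ρ))
  have hL₀ : 1 ≤ L₀ := (le_max_left _ _).trans (le_max_left _ _)
  refine ⟨min (min δ 1) (min ε₁ (Real.exp (-L₀))), by positivity,
    fun ε hε hε₀ z y hz hy hh => ?_⟩
  have hεδ : ε ≤ δ := hε₀.le.trans ((min_le_left _ _).trans (min_le_left _ _))
  have hε1 : ε ≤ 1 := hε₀.le.trans ((min_le_left _ _).trans (min_le_right _ _))
  have hεε : ε < ε₁ := hε₀.trans_le ((min_le_right _ _).trans (min_le_left _ _))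
  have hεe : ε < Real.exp (-L₀) := hε₀.trans_le ((min_le_right _ _).trans (min_le_right _ _))
  -- Velocities separated by K ε are covered by transversality. Otherwise the separation ε |log ε|
  -- of the positions at time 0 is decisive.
  rcases le_total (K * ε) ‖z.2 - y.2‖ with hq | hq
  · exact HK ε hε hεε z y hz hy hq
  have hlog : Real.log ε < -L₀ := (Real.log_lt_iff_lt_exp hε).2 hεe
  set L := |Real.log ε|
  have hL : L₀ ≤ L := by
    have := neg_le_abs (Real.log ε); simp only [L]; linarith
  have hL1 : 1 ≤ L := hL₀.trans hL
  have hL2 : 2 * (2 + δ * K) ≤ L := ((le_max_right _ _).trans (le_max_left _ _)).trans hL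
  have hL3 : A ≤ L := ((le_max_left _ _).trans (le_max_right _ _)).trans hL
  have hL4 : n * C * A / ρ ≤ L := ((le_max_right _ _).trans (le_max_right _ _)).trans hL
  have hθ : 2 * ((2 + δ * K) / L) * R₂ = A / L := by simp only [A]; ring
  have hsep : L * ε < torusDist z.1 y.1 := by
    by_contra! h
    refine hh ⟨0, ⟨le_rfl, hδ.le⟩, ?_⟩
    simpa [advance, torusShift_zero, mul_comm] using h
  obtain ⟨P, hPn, hP⟩ := exists_torusShift_eq y.1 z.1
  refine H ε hε hεδ z hz y (⋃ m ∈ F, {v' | y.2 - v' ∈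
    cylinder (2 * ((2 + δ * K) / L) * R₂) R₂ (P + latticeVec m)}) ?_ fun v' hv' hE => ?_
  · refine (measure_biUnion_finset_le _ _).trans ?_
    rw [hθ]
    calc _ ≤ ∑ m ∈ F, ENNReal.ofReal (C * (A / L)) := by
          refine Finset.sum_le_sum fun m _ => ?_
          exact volume_sub_mem_cylinder_le hd (by positivity) ((div_le_one (by linarith)).2 hL3)
            hR₂.le _ _
      _ = ENNReal.ofReal (n * (C * (A / L))) := by
          rw [Finset.sum_const, nsmul_eq_mul, ENNReal.ofReal_mul (Nat.cast_nonneg n),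
            ENNReal.ofReal_natCast]
      _ ≤ ENNReal.ofReal ρ := by
          refine ENNReal.ofReal_le_ofReal ?_
          rw [div_le_iff₀ hρ] at hL4
          rw [← mul_div_assoc, ← mul_div_assoc, div_le_iff₀ (by linarith)]
          linarith
  · have hempty : {x' : UnitAddTorus (Fin d) | Hits δ ε z (x', v') ∧ Hits δ ε y (x', v')} = ∅ := by
      refine Set.eq_empty_of_forall_notMem fun x' hx' => hE ?_
      have hx1 : Hits δ ε z (x', v') := hx'.1
      have hx2 : Hits δ ε y (x', v') := hx'.2
      obtain ⟨m, hm, hc⟩ := exists_cylinder_of_hits hε hε1 hδ.le hL2 (by linarith) hP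
        (hPn.trans_le (torusDist_le_dim _ _))
        ((norm_sub_le _ _).trans (add_le_add hz hv')) ((norm_sub_le _ _).trans (add_le_add hy hv'))
        hq hsep hx1 hx2
      exact Set.mem_biUnion (Finset.mem_coe.2 hm) hc
    rw [hempty, measure_empty, mul_zero]
    exact zero_le

end HardSphere
end

open MeasureTheory Filter Topology
open scoped ENNReal BigOperators

noncomputable section

namespace HardSphere

/-! ### The limiting collision operator -/

variable {d : ℕ} {β μ : ℝ} {f₀ : Phase d → ℝ}

/-- The collision operator acting on real functions. -/
def collisionInt (f₀ : Phase d → ℝ) (δ ε : ℝ) (g : Phase d → ℝ) (z : Phase d) : ℝ :=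
  ∫ z', (1 - avoid (Hits δ ε) z z') * (activity d ε * f₀ z') * g z'

/-- The contribution of the velocity `v'` to the collision operator. -/
def collisionSlice (f₀ : Phase d → ℝ) (δ ε : ℝ) (g : Phase d → ℝ) (z : Phase d)
    (v' : EuclideanSpace ℝ (Fin d)) : ℝ :=
  activity d ε * ∫ x' in {x' : UnitAddTorus (Fin d) | Hits δ ε z (x', v')}, f₀ (x', v') * g (x', v')

/-- The limit of the collision slices in the Boltzmann-Grad scaling. -/
def limitKernel (f₀ : Phase d → ℝ) (δ : ℝ) (g : Phase d → ℝ) (z : Phase d)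
    (v' : EuclideanSpace ℝ (Fin d)) : ℝ :=
  tubeConst d * ‖z.2 - v'‖ * ∫ u in (0 : ℝ)..δ,
    f₀ (torusShift z.1 (u • (z.2 - v')), v') * g (torusShift z.1 (u • (z.2 - v')), v')

/-- The limit of the collision operators in the Boltzmann-Grad scaling. -/
def limitOp (f₀ : Phase d → ℝ) (δ : ℝ) (g : Phase d → ℝ) (z : Phase d) : ℝ :=
  ∫ v', limitKernel f₀ δ g z v'

lemma continuous_limitKernel (hf : Continuous f₀) {g : Phase d → ℝ} (hg : Continuous g) (δ : ℝ) :
    Continuous fun p : Phase d × EuclideanSpace ℝ (Fin d) => limitKernel f₀ δ g p.1 p.2 := by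
  have hs : Continuous fun q : (Phase d × EuclideanSpace ℝ (Fin d)) × ℝ =>
      ((torusShift q.1.1.1 (q.2 • (q.1.1.2 - q.1.2)), q.1.2) : Phase d) :=
    (continuous_torusShift.comp (f := fun q : (Phase d × EuclideanSpace ℝ (Fin d)) × ℝ =>
      (q.1.1.1, q.2 • (q.1.1.2 - q.1.2))) (by fun_prop)).prodMk (by fun_prop)
  have hi : Continuous fun p : Phase d × EuclideanSpace ℝ (Fin d) => ∫ u in (0 : ℝ)..δ,
      f₀ (torusShift p.1.1 (u • (p.1.2 - p.2)), p.2) *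
        g (torusShift p.1.1 (u • (p.1.2 - p.2)), p.2) :=
    intervalIntegral.continuous_parametric_intervalIntegral_of_continuous'
      (f := fun (p : Phase d × EuclideanSpace ℝ (Fin d)) (u : ℝ) =>
        f₀ (torusShift p.1.1 (u • (p.1.2 - p.2)), p.2) *
        g (torusShift p.1.1 (u • (p.1.2 - p.2)), p.2)) ((hf.comp hs).mul (hg.comp hs)) 0 δ
  unfold limitKernel
  fun_prop

lemma profile_mul_nonneg (hf : IsProfile β μ f₀) {g : Phase d → ℝ} (h0 : ∀ z, 0 ≤ g z)
    (z : Phase d) : 0 ≤ f₀ z * g z := mul_nonneg (hf.nonneg z) (h0 z)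

lemma profile_mul_le (hf : IsProfile β μ f₀) {g : Phase d → ℝ} (h1 : ∀ z, g z ≤ 1)
    (z : Phase d) : f₀ z * g z ≤ gaussWeight β μ z.2 :=
  (mul_le_of_le_one_right (hf.nonneg z) (h1 z)).trans (hf.le_gauss z)

lemma limitKernel_nonneg (hf : IsProfile β μ f₀) {g : Phase d → ℝ} (h0 : ∀ z, 0 ≤ g z) {δ : ℝ}
    (hδ : 0 ≤ δ) (z : Phase d) (v' : EuclideanSpace ℝ (Fin d)) : 0 ≤ limitKernel f₀ δ g z v' :=
  mul_nonneg (mul_nonneg tubeConst_nonneg (norm_nonneg _))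
    (intervalIntegral.integral_nonneg hδ fun _ _ => profile_mul_nonneg hf h0 _)

lemma norm_sub_le_mul (v v' : EuclideanSpace ℝ (Fin d)) : ‖v - v'‖ ≤ (1 + ‖v‖) * (1 + ‖v'‖) := by
  have := norm_sub_le v v'
  nlinarith [mul_nonneg (norm_nonneg v) (norm_nonneg v')]

lemma limitKernel_le (hf : IsProfile β μ f₀) {g : Phase d → ℝ} (h0 : ∀ z, 0 ≤ g z)
    (h1 : ∀ z, g z ≤ 1) {δ : ℝ} (hδ : 0 ≤ δ) (z : Phase d) (v' : EuclideanSpace ℝ (Fin d)) :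
    limitKernel f₀ δ g z v' ≤
      tubeBound d * δ * (1 + ‖z.2‖) * (gaussWeight β μ v' * (1 + ‖v'‖)) := by
  have hk := tubeConst_nonneg (d := d)
  have hb := ballVol_nonneg (d := d)
  have hg := (gaussWeight_pos (β := β) (μ := μ) v').le
  have hI : ∫ u in (0 : ℝ)..δ, f₀ (torusShift z.1 (u • (z.2 - v')), v') *
      g (torusShift z.1 (u • (z.2 - v')), v') ≤ gaussWeight β μ v' * δ := by
    have h := intervalIntegral.norm_integral_le_of_norm_le_const (a := 0) (b := δ)
      (C := gaussWeight β μ v') (f := fun u => f₀ (torusShift z.1 (u • (z.2 - v')), v') *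
      g (torusShift z.1 (u • (z.2 - v')), v')) fun u _ => by
        rw [Real.norm_of_nonneg (profile_mul_nonneg hf h0 _)]
        exact profile_mul_le hf h1 (torusShift z.1 (u • (z.2 - v')), v')
    rw [sub_zero, abs_of_nonneg hδ] at h
    exact (le_abs_self _).trans h
  calc limitKernel f₀ δ g z v' ≤ tubeConst d * ‖z.2 - v'‖ * (gaussWeight β μ v' * δ) := by
        unfold limitKernel; gcongr
    _ ≤ tubeBound d * ((1 + ‖z.2‖) * (1 + ‖v'‖)) * (gaussWeight β μ v' * δ) := by
        have h1 := norm_sub_le_mul z.2 v'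
        have h2 : tubeConst d ≤ tubeBound d := by unfold tubeBound; linarith
        have := tubeBound_nonneg (d := d)
        gcongr
    _ = _ := by ring

lemma integrable_gaussWeight_mul_one (hβ : 0 < β) :
    Integrable fun v : EuclideanSpace ℝ (Fin d) => gaussWeight β μ v * (1 + ‖v‖) := by
  refine (integrable_gaussWeight_mul (μ := μ) hβ).mono'
    (by have := continuous_gaussWeight (d := d) (β := β) (μ := μ); fun_prop)
    (Eventually.of_forall fun v => ?_)
  have hg := (gaussWeight_pos (β := β) (μ := μ) v).le
  rw [Real.norm_of_nonneg (by positivity)]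
  exact mul_le_mul_of_nonneg_left (by nlinarith [norm_nonneg v]) hg

/-- Continuity lets the limit operator be iterated, since the tube asymptotics require a continuous
integrand. -/
lemma continuous_limitOp (hf : IsProfile β μ f₀) {g : Phase d → ℝ} (hg : Continuous g)
    (h0 : ∀ z, 0 ≤ g z) (h1 : ∀ z, g z ≤ 1) {δ : ℝ} (hδ : 0 ≤ δ) : Continuous (limitOp f₀ δ g) := by
  rw [continuous_iff_continuousAt]
  intro z₀
  have hk := continuous_limitKernel hf.cont hg δ
  refine continuousAt_of_dominated (bound := fun v' =>
    tubeBound d * δ * (2 + ‖z₀.2‖) * (gaussWeight β μ v' * (1 + ‖v'‖))) ?_ ?_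
    ((integrable_gaussWeight_mul_one hf.pos).const_mul _) ?_
  · exact Eventually.of_forall fun z => (hk.comp (Continuous.prodMk_right z)).aestronglyMeasurable
  · have hn : ∀ᶠ z : Phase d in 𝓝 z₀, ‖z.2‖ < ‖z₀.2‖ + 1 :=
      (continuous_snd.norm.tendsto z₀).eventually_lt_const (lt_add_one _)
    filter_upwards [hn] with z hz
    refine Eventually.of_forall fun v' => ?_
    rw [Real.norm_of_nonneg (limitKernel_nonneg hf h0 hδ z v')]
    refine (limitKernel_le hf h0 h1 hδ z v').trans ?_
    have hg := (gaussWeight_pos (β := β) (μ := μ) v').le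
    have := tubeBound_nonneg (d := d)
    have h2 : 1 + ‖z.2‖ ≤ 2 + ‖z₀.2‖ := by linarith
    gcongr
  · exact Eventually.of_forall fun v' => (hk.comp (Continuous.prodMk_left v')).continuousAt

lemma limitOp_nonneg (hf : IsProfile β μ f₀) {g : Phase d → ℝ} (h0 : ∀ z, 0 ≤ g z) {δ : ℝ}
    (hδ : 0 ≤ δ) (z : Phase d) : 0 ≤ limitOp f₀ δ g z :=
  integral_nonneg fun v' => limitKernel_nonneg hf h0 hδ z v'

lemma integrable_limitKernel (hf : IsProfile β μ f₀) {g : Phase d → ℝ} (hg : Continuous g)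
    (h0 : ∀ z, 0 ≤ g z) (h1 : ∀ z, g z ≤ 1) {δ : ℝ} (hδ : 0 ≤ δ) (z : Phase d) :
    Integrable (limitKernel f₀ δ g z) := by
  refine ((integrable_gaussWeight_mul_one (μ := μ) hf.pos).const_mul
    (tubeBound d * δ * (1 + ‖z.2‖))).mono'
    ((continuous_limitKernel hf.cont hg δ).comp (Continuous.prodMk_right z)).aestronglyMeasurable
    (Eventually.of_forall fun v' => ?_)
  rw [Real.norm_of_nonneg (limitKernel_nonneg hf h0 hδ z v')]
  exact limitKernel_le hf h0 h1 hδ z v'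

lemma integrable_collision_integrand (hf : IsProfile β μ f₀) {g : Phase d → ℝ} (hg : Measurable g)
    (h0 : ∀ z, 0 ≤ g z) (h1 : ∀ z, g z ≤ 1) {δ ε : ℝ} (hε : 0 < ε) (z : Phase d) :
    Integrable fun z' => (1 - avoid (Hits δ ε) z z') * (activity d ε * f₀ z') * g z' := by
  refine (hf.integrable.const_mul (activity d ε)).mono' ?_ (Eventually.of_forall fun z' => ?_)
  · exact (((measurable_const.sub (measurable_avoid_right (measurableSet_hits δ ε) z)).mul
      (hf.cont.measurable.const_mul _)).mul hg).aestronglyMeasurable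
  · have ha := (activity_pos (d := d) hε).le
    have h2 : 0 ≤ activity d ε * f₀ z' := mul_nonneg ha (hf.nonneg z')
    have h3 : 0 ≤ 1 - avoid (Hits δ ε) z z' := sub_nonneg.2 (avoid_le_one _ _)
    rw [Real.norm_of_nonneg (mul_nonneg (mul_nonneg h3 h2) (h0 z'))]
    refine (mul_le_of_le_one_right (mul_nonneg h3 h2) (h1 z')).trans
      (mul_le_of_le_one_left h2 ?_)
    linarith [avoid_nonneg (H := Hits δ ε) z z']

lemma collisionSlice_eq (f₀ : Phase d → ℝ) (δ ε : ℝ) (g : Phase d → ℝ) (z : Phase d)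
    (v' : EuclideanSpace ℝ (Fin d)) : collisionSlice f₀ δ ε g z v' =
      ∫ x', (1 - avoid (Hits δ ε) z (x', v')) * (activity d ε * f₀ (x', v')) * g (x', v') := by
  have hs : MeasurableSet {x' : UnitAddTorus (Fin d) | Hits δ ε z (x', v')} :=
    measurableSet_hits_section δ ε z v'
  unfold collisionSlice
  rw [← integral_indicator hs, ← integral_const_mul]
  refine integral_congr_ae (Eventually.of_forall fun x' => ?_)
  by_cases h : Hits δ ε z (x', v')
  · simp only [Set.indicator, Set.mem_ofPred_eq, avoid, h, if_true]; ring
  · simp [Set.indicator, avoid, h]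

lemma collisionInt_eq (hf : IsProfile β μ f₀) {g : Phase d → ℝ} (hg : Measurable g)
    (h0 : ∀ z, 0 ≤ g z) (h1 : ∀ z, g z ≤ 1) {δ ε : ℝ} (hε : 0 < ε) (z : Phase d) :
    Integrable (collisionSlice f₀ δ ε g z) ∧
      collisionInt f₀ δ ε g z = ∫ v', collisionSlice f₀ δ ε g z v' := by
  have hi := integrable_collision_integrand hf hg h0 h1 (δ := δ) hε z
  rw [Measure.volume_eq_prod] at hi
  have e : collisionSlice f₀ δ ε g z = fun v' => ∫ x', (1 - avoid (Hits δ ε) z (x', v')) *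
      (activity d ε * f₀ (x', v')) * g (x', v') := funext fun v' => collisionSlice_eq _ _ _ _ _ _
  rw [e]
  exact ⟨hi.integral_prod_right, integral_prod_symm _ hi⟩

lemma collisionSlice_nonneg (hf : IsProfile β μ f₀) {g : Phase d → ℝ} (h0 : ∀ z, 0 ≤ g z) {δ ε : ℝ}
    (hε : 0 < ε) (z : Phase d) (v' : EuclideanSpace ℝ (Fin d)) : 0 ≤ collisionSlice f₀ δ ε g z v' :=
  mul_nonneg (activity_pos hε).le (integral_nonneg fun _ => profile_mul_nonneg hf h0 _)

lemma collisionSlice_le (hd : 0 < d) (hf : IsProfile β μ f₀) {g : Phase d → ℝ} (h0 : ∀ z, 0 ≤ g z)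
    (h1 : ∀ z, g z ≤ 1) {δ ε : ℝ} (hε : 0 < ε) (hεδ : ε ≤ δ) (z : Phase d)
    (v' : EuclideanSpace ℝ (Fin d)) : collisionSlice f₀ δ ε g z v' ≤
      tubeBound d * δ * (1 + ‖z.2‖) * (gaussWeight β μ v' * (1 + ‖v'‖)) := by
  set S : Set (UnitAddTorus (Fin d)) := {x' | Hits δ ε z (x', v')}
  have ha := (activity_pos (d := d) hε).le
  have hg := (gaussWeight_pos (β := β) (μ := μ) v').le
  have hI : ∫ x' in S, f₀ (x', v') * g (x', v') ≤ gaussWeight β μ v' * volume.real S := by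
    have h := norm_setIntegral_le_of_norm_le_const (C := gaussWeight β μ v')
      (f := fun x' => f₀ (x', v') * g (x', v')) (measure_lt_top volume S) fun x' _ => by
        rw [Real.norm_of_nonneg (profile_mul_nonneg hf h0 _)]
        exact profile_mul_le hf h1 (x', v')
    exact (le_abs_self _).trans h
  have hv : activity d ε * volume.real S ≤ tubeBound d * δ * (1 + ‖z.2‖) * (1 + ‖v'‖) := by
    have h := activity_mul_volume_hits_le hd hε hεδ z v'
    have hc : 0 ≤ tubeBound d * δ * (1 + ‖z.2‖) :=
      mul_nonneg (mul_nonneg tubeBound_nonneg (hε.le.trans hεδ)) (by positivity)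
    rw [← ENNReal.ofReal_mul hc] at h
    have h2 := ENNReal.toReal_mono ENNReal.ofReal_ne_top h
    rwa [ENNReal.toReal_mul, ENNReal.toReal_ofReal ha, ENNReal.toReal_ofReal
      (by positivity)] at h2
  calc collisionSlice f₀ δ ε g z v' ≤ activity d ε * (gaussWeight β μ v' * volume.real S) := by
        unfold collisionSlice; gcongr
    _ = gaussWeight β μ v' * (activity d ε * volume.real S) := by ring
    _ ≤ gaussWeight β μ v' * (tubeBound d * δ * (1 + ‖z.2‖) * (1 + ‖v'‖)) := by gcongr
    _ = _ := by ring

/-- Uniform continuity on the compact product of the torus with a ball of velocities; the sup metric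
of the torus is dominated by the Euclidean norm of the shift. -/
lemma exists_torusShift_modulus {h : Phase d → ℝ} (hc : Continuous h) (R' : ℝ) {ω : ℝ}
    (hω : 0 < ω) : ∃ ρ > 0, ∀ v' : EuclideanSpace ℝ (Fin d), ‖v'‖ ≤ R' →
      ∀ (x : UnitAddTorus (Fin d)) (w : EuclideanSpace ℝ (Fin d)), ‖w‖ ≤ ρ →
        |h (torusShift x w, v') - h (x, v')| ≤ ω := by
  have hK : IsCompact ((Set.univ : Set (UnitAddTorus (Fin d))) ×ˢ
      Metric.closedBall (0 : EuclideanSpace ℝ (Fin d)) R') :=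
    isCompact_univ.prod (isCompact_closedBall _ _)
  have hu := hK.uniformContinuousOn_of_continuous hc.continuousOn
  obtain ⟨ρ, hρ, H⟩ := Metric.uniformContinuousOn_iff.1 hu ω hω
  refine ⟨ρ / 2, half_pos hρ, fun v' hv' x w hw => ?_⟩
  have hm : ∀ y : UnitAddTorus (Fin d), (y, v') ∈ (Set.univ : Set (UnitAddTorus (Fin d))) ×ˢ
      Metric.closedBall (0 : EuclideanSpace ℝ (Fin d)) R' := fun y => ⟨trivial, by simpa using hv'⟩
  refine (H _ (hm _) _ (hm _) ?_).le
  rw [Prod.dist_eq, dist_self, max_lt_iff]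
  refine ⟨lt_of_le_of_lt ((dist_pi_le_iff (norm_nonneg w)).2 fun a => ?_) (hw.trans_lt (half_lt_self hρ)),
    hρ⟩
  rw [dist_eq_norm]
  simp only [torusShift, add_sub_cancel_left]
  refine le_trans ?_ (PiLp.norm_apply_le w a)
  rw [UnitAddCircle.norm_eq]
  simpa using round_le (w a) 0

/-- Convergence of the collision operator in the Boltzmann-Grad scaling. -/
theorem exists_abs_collisionInt_sub_limitOp_le (hd : 2 ≤ d) (hf : IsProfile β μ f₀)
    {g : Phase d → ℝ} (hg : Continuous g) (h0 : ∀ z, 0 ≤ g z) (h1 : ∀ z, g z ≤ 1) {δ : ℝ}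
    (hδ : 0 < δ) {R η : ℝ} (hR : 0 ≤ R) (hη : 0 < η) : ∃ ε₀ > 0, ∀ ε, 0 < ε → ε < ε₀ →
      ∀ z : Phase d, ‖z.2‖ ≤ R → |collisionInt f₀ δ ε g z - limitOp f₀ δ g z| ≤ η := by
  set c := tubeBound d * δ * (1 + R)
  have hc : 0 ≤ c := mul_nonneg (mul_nonneg tubeBound_nonneg hδ.le) (by linarith)
  obtain ⟨R', hR', ρ, hρ, HE⟩ := exists_setLIntegral_gaussWeight_le (d := d) (μ := μ) hf.pos
    (τ := η / (2 * (c + 1))) (by positivity)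
  set R₂ := R + R'
  have hR₂ : 0 < R₂ := by positivity
  set V := volume.real (Metric.closedBall (0 : EuclideanSpace ℝ (Fin d)) R')
  have hV : 0 ≤ V := measureReal_nonneg
  set η' := η / (2 * (V + 1))
  have hη' : 0 < η' := by positivity
  have hk := tubeConst_nonneg (d := d)
  have hb := ballVol_nonneg (d := d)
  set ω := η' / (4 * (tubeConst d * R₂ * δ + 1))
  have hω : 0 < ω := by positivity
  obtain ⟨r, hr, Hr⟩ := exists_torusShift_modulus (hf.cont.mul hg) R' hω
  have hC := cylinderBound_nonneg (d := d) hR₂.le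
  set C := cylinderBound d R₂
  set F := (finite_latticeVec_le (d := d) (2 * (1 + δ * R₂) + d)).toFinset
  set M := Real.exp (-μ)
  have hM : 0 < M := Real.exp_pos _
  refine ⟨min (min δ (1 / 4)) (min r (min (1 / (4 * R₂)) (min (ρ / (F.card * C * (4 * R₂) + 1))
    (η' / (2 * (M * ballVol d + 1)))))), by positivity, fun ε hε hε₀ z hz => ?_⟩
  obtain ⟨⟨hε1, hε2⟩, hε3, hε4, hε5, hε6⟩ := (lt_min_iff.1 hε₀).imp lt_min_iff.1 fun h =>
    (lt_min_iff.1 h).imp id fun h => (lt_min_iff.1 h).imp id lt_min_iff.1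
  rw [lt_div_iff₀ (by positivity)] at hε4 hε5 hε6
  -- These are the velocities whose collision tube with z may overlap itself on the torus; their
  -- volume is O(ε).
  set E : Set (EuclideanSpace ℝ (Fin d)) := ⋃ m ∈ F.filter (fun m => latticeVec m ≠ 0),
    {v' | z.2 - v' ∈ cylinder (4 * ε * R₂) R₂ (latticeVec m)}
  have hE : volume E ≤ ENNReal.ofReal ρ := by
    refine (measure_biUnion_finset_le _ _).trans ?_
    calc _ ≤ ∑ m ∈ F.filter (fun m => latticeVec m ≠ 0), ENNReal.ofReal (C * (4 * ε * R₂)) := by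
          refine Finset.sum_le_sum fun m _ => ?_
          exact volume_sub_mem_cylinder_le hd (by positivity) (by linarith) hR₂.le _ _
      _ ≤ ∑ m ∈ F, ENNReal.ofReal (C * (4 * ε * R₂)) :=
          Finset.sum_le_sum_of_subset (Finset.filter_subset _ _)
      _ = ENNReal.ofReal (F.card * (C * (4 * ε * R₂))) := by
          rw [Finset.sum_const, nsmul_eq_mul, ENNReal.ofReal_mul (Nat.cast_nonneg _),
            ENNReal.ofReal_natCast]
      _ ≤ ENNReal.ofReal ρ := ENNReal.ofReal_le_ofReal (by nlinarith)
  set E' : Set (EuclideanSpace ℝ (Fin d)) := toMeasurable volume E ∪ {v | R' < ‖v‖}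
  have hE'm : MeasurableSet E' := (measurableSet_toMeasurable _ _).union
    (measurableSet_lt measurable_const measurable_norm)
  have hE' : volume (E' ∩ Metric.closedBall 0 R') ≤ ENNReal.ofReal ρ := by
    refine (le_trans (measure_mono ?_) ((measure_toMeasurable E).trans_le hE))
    rintro v ⟨h | h, hb⟩
    · exact h
    · exact absurd (show R' < ‖v‖ from h) (by simpa using hb)
  obtain ⟨hi, hI⟩ := collisionInt_eq hf hg.measurable h0 h1 (δ := δ) hε z
  have hi' := integrable_limitKernel hf hg h0 h1 hδ.le z
  -- On the exceptional set E' only the majorant common to slices and limit kernel is available,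
  -- which suffices because E' has small Gaussian weight. Off E' the tube asymptotics apply.
  have hcrude : ∀ v', |collisionSlice f₀ δ ε g z v' - limitKernel f₀ δ g z v'| ≤
      c * (gaussWeight β μ v' * (1 + ‖v'‖)) := by
    intro v'
    have hg := (gaussWeight_pos (β := β) (μ := μ) v').le
    have hle : tubeBound d * δ * (1 + ‖z.2‖) * (gaussWeight β μ v' * (1 + ‖v'‖)) ≤
        c * (gaussWeight β μ v' * (1 + ‖v'‖)) := by
      have := tubeBound_nonneg (d := d)
      simp only [c]
      gcongr
    have a1 := collisionSlice_nonneg hf h0 (δ := δ) hε z v'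
    have a2 := collisionSlice_le (by omega) hf h0 h1 hε hε1.le z v'
    have a3 := limitKernel_nonneg hf h0 hδ.le z v'
    have a4 := limitKernel_le hf h0 h1 hδ.le z v'
    rw [abs_le]
    constructor <;> linarith
  have hfine : ∀ v', v' ∉ E' →
      |collisionSlice f₀ δ ε g z v' - limitKernel f₀ δ g z v'| ≤ η' := by
    intro v' hv'
    have hvR : ‖v'‖ ≤ R' := not_lt.1 fun h => hv' (Or.inr h)
    have hvE : v' ∉ E := fun h => hv' (Or.inl (subset_toMeasurable _ _ h))
    have hzv : ‖z.2 - v'‖ ≤ R₂ := (norm_sub_le _ _).trans (add_le_add hz hvR)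
    have hcyl : ∀ m ∈ F, latticeVec m ≠ 0 → z.2 - v' ∉ cylinder (4 * ε * R₂) R₂ (latticeVec m) :=
      fun m hm hm0 h => hvE (Set.mem_biUnion (Finset.mem_coe.2 (Finset.mem_filter.2 ⟨hm, hm0⟩)) h)
    have hcs : Continuous fun x' : UnitAddTorus (Fin d) => f₀ (x', v') * g (x', v') :=
      (hf.cont.mul hg).comp (Continuous.prodMk_left v')
    have hgM : gaussWeight β μ v' ≤ M := by
      refine Real.exp_le_exp.2 ?_
      have := hf.pos
      have : 0 ≤ β / 2 * ‖v'‖ ^ 2 := by positivity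
      linarith
    have key := abs_setIntegral_hits_sub_le (by omega) hε hε2.le hε3 hδ.le hzv hcyl hcs
      (fun x => profile_mul_nonneg hf h0 (x, v'))
      (fun x => (profile_mul_le hf h1 (x, v')).trans hgM) (fun x w hw => Hr v' hvR x w hw)
    have ha := activity_pos (d := d) hε
    have e : collisionSlice f₀ δ ε g z v' - limitKernel f₀ δ g z v' = activity d ε *
        ((∫ x' in {x' : UnitAddTorus (Fin d) | Hits δ ε z (x', v')}, f₀ (x', v') * g (x', v')) -
        tubeConst d * ε ^ (d - 1) * ‖z.2 - v'‖ * ∫ u in (0 : ℝ)..δ,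
          f₀ (torusShift z.1 (u • (z.2 - v')), v') * g (torusShift z.1 (u • (z.2 - v')), v')) := by
      rw [mul_sub]
      unfold collisionSlice limitKernel
      congr 1
      calc _ = (activity d ε * ε ^ (d - 1)) * (tubeConst d * ‖z.2 - v'‖ * ∫ u in (0 : ℝ)..δ,
          f₀ (torusShift z.1 (u • (z.2 - v')), v') *
            g (torusShift z.1 (u • (z.2 - v')), v')) := by
            rw [activity_mul_pow_pred hε, one_mul]
        _ = _ := by ring
    rw [e, abs_mul, abs_of_pos ha]
    refine (mul_le_mul_of_nonneg_left key ha.le).trans ?_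
    have e2 : activity d ε * (M * (ballVol d * ε ^ d) +
        2 * ω * (tubeConst d * ε ^ (d - 1) * ‖z.2 - v'‖) * δ) =
        M * ballVol d * ε + 2 * ω * (tubeConst d * ‖z.2 - v'‖ * δ) := by
      calc _ = M * ballVol d * (activity d ε * ε ^ d) +
            2 * ω * (tubeConst d * ‖z.2 - v'‖ * δ) * (activity d ε * ε ^ (d - 1)) := by ring
        _ = _ := by rw [activity_mul_pow (by omega) hε, activity_mul_pow_pred hε, mul_one]
    rw [e2]
    have h3 : ω * (tubeConst d * ‖z.2 - v'‖ * δ) ≤ η' / 4 := by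
      have h4 : ω * (tubeConst d * R₂ * δ + 1) = η' / 4 := by
        simp only [ω]; field_simp
      have h5 : tubeConst d * ‖z.2 - v'‖ * δ ≤ tubeConst d * R₂ * δ := by gcongr
      nlinarith
    nlinarith
  have hW0 : ∀ v' : EuclideanSpace ℝ (Fin d), 0 ≤ gaussWeight β μ v' * (1 + ‖v'‖) := fun v' =>
    mul_nonneg (gaussWeight_pos v').le (by positivity)
  have hlint : ∫⁻ v', ‖collisionSlice f₀ δ ε g z v' - limitKernel f₀ δ g z v'‖ₑ ≤
      ENNReal.ofReal η := by
    rw [← lintegral_add_compl _ hE'm]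
    have b1 : ∫⁻ v' in E', ‖collisionSlice f₀ δ ε g z v' - limitKernel f₀ δ g z v'‖ₑ ≤
        ENNReal.ofReal (η / 2) := by
      calc _ ≤ ∫⁻ v' in E', ENNReal.ofReal c *
            ENNReal.ofReal (gaussWeight β μ v' * (1 + ‖v'‖)) := by
            refine lintegral_mono fun v' => ?_
            rw [← ENNReal.ofReal_mul hc, Real.enorm_eq_ofReal_abs]
            exact ENNReal.ofReal_le_ofReal (hcrude v')
        _ = ENNReal.ofReal c * ∫⁻ v' in E', ENNReal.ofReal (gaussWeight β μ v' * (1 + ‖v'‖)) :=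
            lintegral_const_mul' _ _ ENNReal.ofReal_ne_top
        _ ≤ ENNReal.ofReal c * ENNReal.ofReal (η / (2 * (c + 1))) := by gcongr; exact HE E' hE'
        _ ≤ _ := by
            rw [← ENNReal.ofReal_mul hc]
            refine ENNReal.ofReal_le_ofReal ?_
            have : (c + 1) * (η / (2 * (c + 1))) = η / 2 := by field_simp
            have h3 : 0 < η / (2 * (c + 1)) := by positivity
            nlinarith
    have b2 : ∫⁻ v' in E'ᶜ, ‖collisionSlice f₀ δ ε g z v' - limitKernel f₀ δ g z v'‖ₑ ≤
        ENNReal.ofReal (η / 2) := by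
      calc _ ≤ ∫⁻ v' in E'ᶜ, ENNReal.ofReal η' := by
            refine setLIntegral_mono' hE'm.compl fun v' hv' => ?_
            rw [Real.enorm_eq_ofReal_abs]
            exact ENNReal.ofReal_le_ofReal (hfine v' hv')
        _ = ENNReal.ofReal η' * volume E'ᶜ := setLIntegral_const _ _
        _ ≤ ENNReal.ofReal η' * volume (Metric.closedBall (0 : EuclideanSpace ℝ (Fin d)) R') := by
            gcongr
            intro v' hv'
            have : ‖v'‖ ≤ R' := not_lt.1 fun h => hv' (Or.inr h)
            simpa using this
        _ = ENNReal.ofReal (η' * V) := by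
            rw [ENNReal.ofReal_mul hη'.le, ofReal_measureReal measure_closedBall_lt_top.ne]
        _ ≤ _ := by
            refine ENNReal.ofReal_le_ofReal ?_
            have : η' * (V + 1) = η / 2 := by simp only [η']; field_simp
            nlinarith
    refine (add_le_add b1 b2).trans ?_
    rw [← ENNReal.ofReal_add (by linarith) (by linarith), add_halves]
  rw [hI, limitOp, ← integral_sub hi hi']
  have := (enorm_integral_le_lintegral_enorm _).trans hlint
  rw [Real.enorm_eq_ofReal_abs] at this
  exact (ENNReal.ofReal_le_ofReal_iff hη.le).1 this

end HardSphere
end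

open MeasureTheory Filter Topology
open scoped ENNReal BigOperators

noncomputable section

namespace HardSphere

/-! ### Convergence of the ratios of partition functions -/

variable {d : ℕ} {β μ : ℝ} {f₀ : Phase d → ℝ}

/-- This is the contraction, and the place where δ must be small. One factor 1 + ‖v'‖ comes from the
relative speed and one from the weight, whence the second moment. -/
lemma collisionOp_one_add_norm_le (hd : 0 < d) (hf : IsProfile β μ f₀) {δ ε : ℝ} (hε : 0 < ε)
    (hεδ : ε ≤ δ) (hsmall : tubeBound d * δ * gaussMoment d β μ ≤ 1 / 2) (z : Phase d) :
    collisionOp f₀ δ ε (fun z' => ENNReal.ofReal (1 + ‖z'.2‖)) z ≤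
      ENNReal.ofReal ((1 + ‖z.2‖) / 2) := by
  have hψ : Measurable fun v : EuclideanSpace ℝ (Fin d) => ENNReal.ofReal (1 + ‖v‖) :=
    (measurable_const.add measurable_norm).ennreal_ofReal
  have hδ : 0 ≤ δ := hε.le.trans hεδ
  have hb := tubeBound_nonneg (d := d)
  calc _ ≤ ENNReal.ofReal (tubeBound d * δ * (1 + ‖z.2‖)) *
        ∫⁻ v' : EuclideanSpace ℝ (Fin d), ENNReal.ofReal (gaussWeight β μ v' * (1 + ‖v'‖)) *
          ENNReal.ofReal (1 + ‖v'‖) := collisionOp_le hd hf hε hεδ hψ (fun _ => le_rfl) z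
    _ = ENNReal.ofReal (tubeBound d * δ * (1 + ‖z.2‖)) * ENNReal.ofReal (gaussMoment d β μ) := by
        rw [← lintegral_gaussWeight_mul hf.pos]
        congr 1
        refine lintegral_congr fun v => ?_
        rw [← ENNReal.ofReal_mul (mul_nonneg (gaussWeight_pos v).le (by positivity))]
        congr 1; ring
    _ = ENNReal.ofReal (tubeBound d * δ * (1 + ‖z.2‖) * gaussMoment d β μ) :=
        (ENNReal.ofReal_mul (by positivity)).symm
    _ ≤ _ := ENNReal.ofReal_le_ofReal (by nlinarith [norm_nonneg z.2])

lemma collisionOp_list_sum_le (hf : IsProfile β μ f₀) {δ ε : ℝ} {τ : ℝ≥0∞} (z : Phase d)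
    (l : List (Phase d)) (h : ∀ p ∈ l, collisionOp f₀ δ ε ((hitSet δ ε p).indicator 1) z ≤ τ) :
    collisionOp f₀ δ ε (fun z' => (l.map fun p => (hitSet δ ε p).indicator 1 z').sum) z ≤
      l.length * τ := by
  induction l with
  | nil => simp [collisionOp]
  | cons p l ih =>
    simp only [List.map_cons, List.sum_cons, List.length_cons]
    rw [collisionOp_add hf (measurable_one.indicator (measurableSet_hitSet δ ε p))]
    have h1 := h p (by simp)
    have h2 := ih fun q hq => h q (by simp [hq])
    push_cast
    rw [add_mul, one_mul, add_comm]
    exact add_le_add h2 h1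

lemma abs_integral_collision_le (hf : IsProfile β μ f₀) {δ ε : ℝ} (hε : 0 < ε) {h : Phase d → ℝ}
    {C : ℝ} (hC : 0 ≤ C) (z : Phase d)
    (hh : collisionOp f₀ δ ε (fun z' => ENNReal.ofReal |h z'|) z ≤ ENNReal.ofReal C) :
    |∫ z', (1 - avoid (Hits δ ε) z z') * (activity d ε * f₀ z') * h z'| ≤ C := by
  have ha := (activity_pos (d := d) hε).le
  have h1 : ∫⁻ z', ‖(1 - avoid (Hits δ ε) z z') * (activity d ε * f₀ z') * h z'‖ₑ =
      collisionOp f₀ δ ε (fun z' => ENNReal.ofReal |h z'|) z := by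
    rw [collisionOp, ← lintegral_indicator (measurableSet_hitSet δ ε z)]
    refine lintegral_congr fun z' => ?_
    by_cases hz : Hits δ ε z z'
    · have hz' : z' ∈ hitSet δ ε z := hz
      rw [Set.indicator_of_mem hz', ← ENNReal.ofReal_mul (hf.nonneg z'), ← ENNReal.ofReal_mul ha,
        Real.enorm_eq_ofReal_abs, abs_mul, abs_mul, abs_mul, abs_of_nonneg ha,
        abs_of_nonneg (hf.nonneg z')]
      simp [avoid, hz, mul_assoc]
    · have hz' : z' ∉ hitSet δ ε z := hz
      rw [Set.indicator_of_notMem hz']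
      simp [avoid, hz]
  have h2 := ((enorm_integral_le_lintegral_enorm _).trans_eq h1).trans hh
  rw [Real.enorm_eq_ofReal_abs] at h2
  exact (ENNReal.ofReal_le_ofReal_iff hC).1 h2

lemma volume_exists_norm_sub_lt_le {r : ℝ} (hr : 0 ≤ r) (l : List (Phase d)) :
    volume {v : EuclideanSpace ℝ (Fin d) | ∃ p ∈ l, ‖v - p.2‖ < r} ≤
      ENNReal.ofReal (l.length * (ballVol d * r ^ d)) := by
  have hb := ballVol_nonneg (d := d)
  induction l with
  | nil => simp
  | cons p l ih =>
    have hsub : {v : EuclideanSpace ℝ (Fin d) | ∃ q ∈ p :: l, ‖v - q.2‖ < r} ⊆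
        Metric.closedBall p.2 r ∪ {v | ∃ q ∈ l, ‖v - q.2‖ < r} := by
      rintro v ⟨q, hq, hv⟩
      rcases List.mem_cons.1 hq with rfl | hq
      · exact Or.inl (by simpa [dist_eq_norm] using hv.le)
      · exact Or.inr ⟨q, hq, hv⟩
    have hball : volume (Metric.closedBall p.2 r) = ENNReal.ofReal (ballVol d * r ^ d) := by
      rw [Measure.addHaar_closedBall' _ _ hr, finrank_euclideanSpace_fin, mul_comm (ballVol d),
        ENNReal.ofReal_mul (by positivity), ballVol,
        ofReal_measureReal measure_closedBall_lt_top.ne]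
    calc _ ≤ _ := measure_mono hsub
      _ ≤ _ := measure_union_le _ _
      _ ≤ ENNReal.ofReal (ballVol d * r ^ d) + ENNReal.ofReal (l.length * (ballVol d * r ^ d)) :=
          add_le_add hball.le ih
      _ = _ := by
          rw [← ENNReal.ofReal_add (by positivity) (by positivity), List.length_cons]
          congr 1; push_cast; ring

/-- The iterates of the limiting fixed point equation `r = exp (- A r)`. -/
def limitRatio (f₀ : Phase d → ℝ) (δ : ℝ) : ℕ → Phase d → ℝ
  | 0 => fun _ => 1
  | N + 1 => fun z => Real.exp (-limitOp f₀ δ (limitRatio f₀ δ N) z)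

lemma limitRatio_spec (hf : IsProfile β μ f₀) {δ : ℝ} (hδ : 0 ≤ δ) (N : ℕ) :
    Continuous (limitRatio f₀ δ N) ∧ (∀ z, 0 ≤ limitRatio f₀ δ N z) ∧
      ∀ z, limitRatio f₀ δ N z ≤ 1 := by
  induction N with
  | zero => exact ⟨continuous_const, fun _ => zero_le_one, fun _ => le_rfl⟩
  | succ N ih =>
    exact ⟨Real.continuous_exp.comp (continuous_limitOp hf ih.1 ih.2.1 ih.2.2 hδ).neg,
      fun z => (Real.exp_pos _).le,
      fun z => Real.exp_le_one_iff.2 (neg_nonpos.2 (limitOp_nonneg hf ih.2.1 hδ z))⟩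

lemma abs_exp_neg_sub_exp_neg_le {a b : ℝ} (ha : 0 ≤ a) (hb : 0 ≤ b) :
    |Real.exp (-a) - Real.exp (-b)| ≤ |a - b| := by
  wlog hab : a ≤ b generalizing a b
  · rw [abs_sub_comm, abs_sub_comm a]; exact this hb ha (le_of_not_ge hab)
  have h1 : Real.exp (-b) ≤ Real.exp (-a) := Real.exp_le_exp.2 (by linarith)
  rw [abs_of_nonneg (by linarith), abs_of_nonpos (by linarith)]
  have h2 : Real.exp (-b) = Real.exp (-a) * Real.exp (-(b - a)) := by
    rw [← Real.exp_add]; congr 1; ring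
  have h3 := Real.add_one_le_exp (-(b - a))
  have h4 : Real.exp (-a) ≤ 1 := Real.exp_le_one_iff.2 (by linarith)
  have h5 := Real.exp_pos (-a)
  rw [h2]
  nlinarith

lemma one_sub_avoid_eq (δ ε : ℝ) (p w : Phase d) :
    ENNReal.ofReal (1 - avoid (Hits δ ε) p w) = (hitSet δ ε p).indicator 1 w := by
  by_cases h : Hits δ ε p w
  · have h' : w ∈ hitSet δ ε p := h
    simp [avoid, h, h']
  · have h' : w ∉ hitSet δ ε p := h
    simp [avoid, h, h']

lemma ofReal_list_sum_one_sub_avoid (δ ε : ℝ) (w : Phase d) (l : List (Phase d)) :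
    ENNReal.ofReal ((l.map fun p => 1 - avoid (Hits δ ε) p w).sum) =
      (l.map fun p => (hitSet δ ε p).indicator (1 : Phase d → ℝ≥0∞) w).sum := by
  induction l with
  | nil => simp
  | cons p l ih =>
    simp only [List.map_cons, List.sum_cons]
    rw [ENNReal.ofReal_add (sub_nonneg.2 (avoid_le_one _ _)), ih, one_sub_avoid_eq]
    refine List.sum_nonneg fun x hx => ?_
    obtain ⟨q, _, rfl⟩ := List.mem_map.1 hx
    exact sub_nonneg.2 (avoid_le_one _ _)

/-- The ratios of partition functions converge, uniformly on bounded sets of velocities, even in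
the presence of finitely many additional obstacles with few simultaneous collisions. -/
theorem exists_abs_hcRatio_sub_limitRatio_le (hd : 2 ≤ d) (hf : IsProfile β μ f₀) {δ : ℝ}
    (hδ : 0 < δ) (hsmall : tubeBound d * δ * gaussMoment d β μ ≤ 1 / 2) (N : ℕ) :
    ∀ (k : ℕ) {R η : ℝ}, 0 ≤ R → 0 < η → ∃ τ > 0, ∃ ε₀ > 0, ∀ ε, 0 < ε → ε < ε₀ →
      ∀ z : Phase d, ‖z.2‖ ≤ R → ∀ l : List (Phase d), l.length ≤ k → (∀ p ∈ l, ‖p.2‖ ≤ R) →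
      (∀ p ∈ l, collisionOp f₀ δ ε ((hitSet δ ε p).indicator 1) z ≤ ENNReal.ofReal τ) →
      ∀ χ : Phase d → ℝ, Measurable χ → (∀ w, 0 ≤ χ w) → (∀ w, χ w ≤ 1) →
      (∀ w, 1 - χ w ≤ (l.map fun p => 1 - avoid (Hits δ ε) p w).sum) →
      |hcRatio (Hits δ ε) (fun w => activity d ε * f₀ w * χ w) z - limitRatio f₀ δ N z| ≤
        (1 / 2) ^ N * (1 + ‖z.2‖) + η := by
  have hwt : ∀ {ε : ℝ}, 0 < ε → ∀ {χ : Phase d → ℝ}, Measurable χ → (∀ w, 0 ≤ χ w) →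
      (∀ w, χ w ≤ 1) → Measurable (fun w => activity d ε * f₀ w * χ w) ∧
      Integrable (fun w => activity d ε * f₀ w * χ w) ∧ ∀ w, 0 ≤ activity d ε * f₀ w * χ w := by
    intro ε hε χ hχ h0 h1
    have ha : ∀ w, 0 ≤ activity d ε * f₀ w := fun w => mul_nonneg (activity_pos hε).le (hf.nonneg w)
    have hm : Measurable (fun w => activity d ε * f₀ w * χ w) :=
      (hf.cont.measurable.const_mul _).mul hχ
    refine ⟨hm, (hf.integrable.const_mul (activity d ε)).mono' hm.aestronglyMeasurable
      (Eventually.of_forall fun w => ?_), fun w => mul_nonneg (ha w) (h0 w)⟩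
    rw [Real.norm_of_nonneg (mul_nonneg (ha w) (h0 w))]
    exact mul_le_of_le_one_right (ha w) (h1 w)
  induction N with
  | zero =>
    intro k R η hR hη
    -- Both quantities lie in [0, 1], while the right-hand side is at least 1.
    refine ⟨1, one_pos, 1, one_pos, fun ε hε _ z hz l _ _ _ χ hχ h0 h1 _ => ?_⟩
    obtain ⟨w1, w2, w3⟩ := hwt hε hχ h0 h1
    have b0 := hcRatio_nonneg (measurableSet_hits δ ε) w1 w2 w3 z
    have b1 := hcRatio_le_one (measurableSet_hits δ ε) w1 w2 w3 z
    simp only [limitRatio, pow_zero, one_mul]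
    rw [abs_le]
    constructor <;> nlinarith [norm_nonneg z.2]
  | succ N ih =>
    intro k R η hR hη
    obtain ⟨R', hR', ρ, hρ, HV⟩ := exists_collisionOp_velocity_le (by omega) hf hδ hR
      (τ := η / 4) (by positivity)
    set R₁ := max R R'
    have hR₁ : 0 ≤ R₁ := hR.trans (le_max_left _ _)
    set η' := η / (2 * (1 + R))
    have hη' : 0 < η' := by positivity
    -- The frozen z becomes one more obstacle and z' may have larger velocity than z, so the
    -- hypothesis is needed for k + 1 obstacles and for R₁. The constant η' is such that η' (1 + R)
    -- / 2 = η / 4.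
    obtain ⟨τ', hτ', ε₁, hε₁, HN⟩ := ih (k + 1) hR₁ hη'
    obtain ⟨K, hK, ε₂, hε₂, HK⟩ := exists_collisionOp_hitSet_le_of_velocity hd hf hδ hR₁ hτ'
    obtain ⟨rc, r0, r1⟩ := limitRatio_spec hf hδ.le N
    obtain ⟨ε₃, hε₃, HC⟩ := exists_abs_collisionInt_sub_limitOp_le hd hf rc r0 r1 hδ hR
      (η := η / 4) (by positivity)
    have hb := ballVol_nonneg (d := d)
    refine ⟨η / (4 * (k + 1)), by positivity, min (min δ ε₁) (min (min ε₂ ε₃)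
      (min (1 / K) (ρ / ((k + 1) * ballVol d * K + 1)))), by positivity, ?_⟩
    intro ε hε hε₀ z hz l hl hlR hlτ χ hχ h0 h1 hχl
    obtain ⟨⟨hεδ, hεε₁⟩, ⟨hεε₂, hεε₃⟩, hεK, hερ⟩ := (lt_min_iff.1 hε₀).imp lt_min_iff.1 fun h =>
      (lt_min_iff.1 h).imp lt_min_iff.1 lt_min_iff.1
    rw [lt_div_iff₀ (by positivity)] at hεK hερ
    have hm := measurableSet_hits (d := d) δ ε
    obtain ⟨w1, w2, w3⟩ := hwt hε hχ h0 h1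
    obtain ⟨s, hs, hexp⟩ := exists_hcRatio_eq_exp hm w1 w2 w3 Hits.symm z
    -- The intermediate weight is again f₀ times a cutoff, now with z among the obstacles: 1 - χ' is
    -- bounded by the sum over z :: l. Fractional cutoffs are allowed in the claim because of the
    -- factor s.
    set χ' : Phase d → ℝ := fun w => χ w * (1 - s * (1 - avoid (Hits δ ε) z w)) with hχ'
    have hav : ∀ p w : Phase d, 0 ≤ 1 - avoid (Hits δ ε) p w := fun p w =>
      sub_nonneg.2 (avoid_le_one _ _)
    have hav1 : ∀ p w : Phase d, 1 - avoid (Hits δ ε) p w ≤ 1 := fun p w => by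
      linarith [avoid_nonneg (H := Hits δ ε) p w]
    have hf0 : ∀ w, 0 ≤ 1 - s * (1 - avoid (Hits δ ε) z w) := fun w => by
      nlinarith [hav z w, hav1 z w, hs.1, hs.2]
    have hf1 : ∀ w, 1 - s * (1 - avoid (Hits δ ε) z w) ≤ 1 := fun w => by
      nlinarith [hav z w, hav1 z w, hs.1, hs.2]
    have hχ'm : Measurable χ' := hχ.mul (measurable_const.sub
      ((measurable_const.sub (measurable_avoid_right hm z)).const_mul s))
    have hχ'0 : ∀ w, 0 ≤ χ' w := fun w => mul_nonneg (h0 w) (hf0 w)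
    have hχ'1 : ∀ w, χ' w ≤ 1 := fun w => mul_le_one₀ (h1 w) (hf0 w) (hf1 w)
    have hχ'l : ∀ w, 1 - χ' w ≤ ((z :: l).map fun p => 1 - avoid (Hits δ ε) p w).sum := by
      intro w
      rw [List.map_cons, List.sum_cons]
      have e : 1 - χ' w = (1 - χ w) + χ w * (s * (1 - avoid (Hits δ ε) z w)) := by
        simp only [hχ']; ring
      have h2 : χ w * (s * (1 - avoid (Hits δ ε) z w)) ≤ 1 - avoid (Hits δ ε) z w := by
        have h3 : s * (1 - avoid (Hits δ ε) z w) ≤ 1 - avoid (Hits δ ε) z w :=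
          mul_le_of_le_one_left (hav z w) hs.2.le
        exact (mul_le_of_le_one_left (mul_nonneg hs.1.le (hav z w)) (h1 w)).trans h3
      linarith [hχl w]
    obtain ⟨u1, u2, u3⟩ := hwt hε hχ'm hχ'0 hχ'1
    set r : Phase d → ℝ := hcRatio (Hits δ ε) (fun w => activity d ε * f₀ w * χ' w)
    have hr0 : ∀ w, 0 ≤ r w := fun w => hcRatio_nonneg hm u1 u2 u3 w
    have hr1 : ∀ w, r w ≤ 1 := fun w => hcRatio_le_one hm u1 u2 u3 w
    have hrm : Measurable r := measurable_hcRatio hm u1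
    have hI : (∫ z', (1 - avoid (Hits δ ε) z z') * (activity d ε * f₀ z' * χ z') *
        hcRatio (Hits δ ε) (fun w => (1 - s * (1 - avoid (Hits δ ε) z w)) *
          (activity d ε * f₀ w * χ w)) z') = collisionInt f₀ δ ε (fun z' => χ z' * r z') z := by
      have e : (fun w => (1 - s * (1 - avoid (Hits δ ε) z w)) * (activity d ε * f₀ w * χ w)) =
          fun w => activity d ε * f₀ w * χ' w := by
        funext w; simp only [hχ']; ring
      rw [e]
      exact integral_congr_ae (Eventually.of_forall fun z' => by simp only [r]; ring)
    rw [hI] at hexp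
    have hχr0 : ∀ w, 0 ≤ χ w * r w := fun w => mul_nonneg (h0 w) (hr0 w)
    have hχr1 : ∀ w, χ w * r w ≤ 1 := fun w => mul_le_one₀ (h1 w) (hr0 w) (hr1 w)
    have hcI0 : 0 ≤ collisionInt f₀ δ ε (fun z' => χ z' * r z') z :=
      integral_nonneg fun z' => mul_nonneg (mul_nonneg (hav z z')
        (mul_nonneg (activity_pos hε).le (hf.nonneg z'))) (hχr0 z')
    -- Outside E the velocity of z' is bounded and differs by at least K ε from that of every
    -- obstacle, so simultaneous collisions with z' and an obstacle are rare. E itself is a union of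
    -- at most k + 1 small balls and the large velocities.
    set E : Set (EuclideanSpace ℝ (Fin d)) :=
      {v | R' < ‖v‖} ∪ {v | ∃ p ∈ z :: l, ‖v - p.2‖ < K * ε} with hE
    have hEo : IsOpen {v : EuclideanSpace ℝ (Fin d) | ∃ p ∈ z :: l, ‖v - p.2‖ < K * ε} := by
      have : {v : EuclideanSpace ℝ (Fin d) | ∃ p ∈ z :: l, ‖v - p.2‖ < K * ε} =
          ⋃ p ∈ z :: l, {v | ‖v - p.2‖ < K * ε} := by ext v; simp
      rw [this]
      exact isOpen_iUnion fun p => isOpen_iUnion fun _ =>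
        isOpen_lt (by fun_prop) continuous_const
    have hEm : MeasurableSet E :=
      (measurableSet_lt measurable_const measurable_norm).union hEo.measurableSet
    have hEv : volume (E ∩ Metric.closedBall 0 R') ≤ ENNReal.ofReal ρ := by
      have hsub : E ∩ Metric.closedBall 0 R' ⊆ {v | ∃ p ∈ z :: l, ‖v - p.2‖ < K * ε} := by
        rintro v ⟨h | h, hb⟩
        · exact absurd (show R' < ‖v‖ from h) (by simpa using hb)
        · exact h
      refine (measure_mono hsub).trans ((volume_exists_norm_sub_lt_le (by positivity) _).trans
        (ENNReal.ofReal_le_ofReal ?_))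
      have hKε : (K * ε) ^ d ≤ K * ε := by
        have := pow_le_pow_of_le_one (a := K * ε) (by positivity) (by linarith)
          (show 1 ≤ d by omega)
        simpa using this
      have hlen : (((z :: l).length : ℕ) : ℝ) ≤ k + 1 := by
        rw [List.length_cons]; exact_mod_cast Nat.succ_le_succ hl
      calc _ ≤ ((k : ℝ) + 1) * (ballVol d * (K * ε)) := by gcongr
        _ ≤ ρ := by nlinarith
    have hgood : ∀ z' : Phase d, z'.2 ∉ E →
        |r z' - limitRatio f₀ δ N z'| ≤ (1 / 2) ^ N * (1 + ‖z'.2‖) + η' := by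
      intro z' hz'
      have hz'R : ‖z'.2‖ ≤ R' := not_lt.1 fun h => hz' (Or.inl h)
      have hlR' : ∀ p ∈ z :: l, ‖p.2‖ ≤ R₁ := by
        intro p hp
        rcases List.mem_cons.1 hp with rfl | hp
        · exact hz.trans (le_max_left _ _)
        · exact (hlR p hp).trans (le_max_left _ _)
      refine HN ε hε hεε₁ z' (hz'R.trans (le_max_right _ _)) (z :: l)
        (by rw [List.length_cons]; omega) hlR' (fun p hp => ?_) χ' hχ'm hχ'0 hχ'1 hχ'l
      exact HK ε hε hεε₂ z' p (hz'R.trans (le_max_right _ _)) (hlR' p hp)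
        (not_lt.1 fun h => hz' (Or.inr ⟨p, hp, h⟩))
    -- Three errors: the obstacles already present, rare by hypothesis on z; the induction
    -- hypothesis, halved by the contraction; and the exceptional velocities, where the trivial
    -- bound 1 is used. Together with the passage from collisions at scale ε to the limit operator,
    -- the excess over 2^{-(N+1)} (1 + ‖v‖) is 4 · η/4.
    have hpt : ∀ z' : Phase d, ENNReal.ofReal |χ z' * r z' - limitRatio f₀ δ N z'| ≤
        (l.map fun p => (hitSet δ ε p).indicator (1 : Phase d → ℝ≥0∞) z').sum +
        (ENNReal.ofReal ((1 / 2) ^ N + η') * ENNReal.ofReal (1 + ‖z'.2‖) + E.indicator 1 z'.2) := by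
      intro z'
      have hsum0 : 0 ≤ (l.map fun p => 1 - avoid (Hits δ ε) p z').sum :=
        (sub_nonneg.2 (h1 z')).trans (hχl z')
      have hsplit : |χ z' * r z' - limitRatio f₀ δ N z'| ≤
          (l.map fun p => 1 - avoid (Hits δ ε) p z').sum + |r z' - limitRatio f₀ δ N z'| := by
        have e : χ z' * r z' - limitRatio f₀ δ N z' =
            -((1 - χ z') * r z') + (r z' - limitRatio f₀ δ N z') := by ring
        rw [e]
        refine (abs_add_le _ _).trans (add_le_add ?_ le_rfl)
        rw [abs_neg, abs_of_nonneg (mul_nonneg (sub_nonneg.2 (h1 z')) (hr0 z'))]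
        exact (mul_le_of_le_one_right (sub_nonneg.2 (h1 z')) (hr1 z')).trans (hχl z')
      refine (ENNReal.ofReal_le_ofReal hsplit).trans ?_
      rw [ENNReal.ofReal_add hsum0 (abs_nonneg _), ofReal_list_sum_one_sub_avoid]
      gcongr
      by_cases hz' : z'.2 ∈ E
      · rw [Set.indicator_of_mem hz']
        refine le_trans ?_ le_add_self
        refine (ENNReal.ofReal_le_ofReal ?_).trans_eq ENNReal.ofReal_one
        rw [abs_le]
        constructor <;> linarith [hr0 z', hr1 z', r0 z', r1 z']
      · refine le_trans ?_ le_self_add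
        rw [← ENNReal.ofReal_mul (by positivity)]
        refine ENNReal.ofReal_le_ofReal ((hgood z' hz').trans ?_)
        nlinarith [mul_nonneg hη'.le (norm_nonneg z'.2)]
    have hop : collisionOp f₀ δ ε (fun z' => ENNReal.ofReal
        |χ z' * r z' - limitRatio f₀ δ N z'|) z ≤
        ENNReal.ofReal ((1 / 2) ^ (N + 1) * (1 + ‖z.2‖) + 3 * (η / 4)) := by
      refine (collisionOp_mono hpt z).trans ?_
      have m1 : Measurable fun z' : Phase d =>
          (l.map fun p => (hitSet δ ε p).indicator (1 : Phase d → ℝ≥0∞) z').sum := by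
        clear hpt hχ'l hχl hgood hEv hEm hEo hE E hlR hlτ hl
        induction l with
        | nil => simp
        | cons p l ih =>
          simp only [List.map_cons, List.sum_cons]
          exact (measurable_one.indicator (measurableSet_hitSet δ ε p)).add ih
      have m2 : Measurable fun z' : Phase d => ENNReal.ofReal (1 + ‖z'.2‖) :=
        (measurable_const.add measurable_snd.norm).ennreal_ofReal
      rw [collisionOp_add hf m1, collisionOp_add hf (m2.const_mul _), collisionOp_const_mul hf m2]
      have c1 : collisionOp f₀ δ ε (fun z' =>
          (l.map fun p => (hitSet δ ε p).indicator (1 : Phase d → ℝ≥0∞) z').sum) z ≤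
          ENNReal.ofReal (η / 4) := by
        refine (collisionOp_list_sum_le hf z l hlτ).trans ?_
        rw [← ENNReal.ofReal_natCast, ← ENNReal.ofReal_mul (Nat.cast_nonneg _)]
        refine ENNReal.ofReal_le_ofReal ?_
        have hlen : ((l.length : ℕ) : ℝ) ≤ k + 1 := by exact_mod_cast hl.trans (Nat.le_succ k)
        calc _ ≤ ((k : ℝ) + 1) * (η / (4 * (k + 1))) := by gcongr
          _ = η / 4 := by field_simp
      have c2 : ENNReal.ofReal ((1 / 2) ^ N + η') *
          collisionOp f₀ δ ε (fun z' => ENNReal.ofReal (1 + ‖z'.2‖)) z ≤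
          ENNReal.ofReal ((1 / 2) ^ (N + 1) * (1 + ‖z.2‖) + η / 4) := by
        calc _ ≤ ENNReal.ofReal ((1 / 2) ^ N + η') * ENNReal.ofReal ((1 + ‖z.2‖) / 2) := by
              gcongr; exact collisionOp_one_add_norm_le (by omega) hf hε hεδ.le hsmall z
          _ = ENNReal.ofReal (((1 / 2) ^ N + η') * ((1 + ‖z.2‖) / 2)) :=
              (ENNReal.ofReal_mul (by positivity)).symm
          _ ≤ _ := by
              refine ENNReal.ofReal_le_ofReal ?_
              have h3 : η' * (1 + R) = η / 2 := by simp only [η']; field_simp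
              have h4 : η' * (1 + ‖z.2‖) ≤ η' * (1 + R) := by gcongr
              rw [pow_succ]
              nlinarith
      refine (add_le_add c1 (add_le_add c2 (HV ε hε hεδ.le z hz E hEm hEv))).trans ?_
      rw [← ENNReal.ofReal_add (by positivity) (by positivity),
        ← ENNReal.ofReal_add (by positivity) (by positivity)]
      exact ENNReal.ofReal_le_ofReal (by linarith)
    have hdiff : |collisionInt f₀ δ ε (fun z' => χ z' * r z') z -
        collisionInt f₀ δ ε (limitRatio f₀ δ N) z| ≤
        (1 / 2) ^ (N + 1) * (1 + ‖z.2‖) + 3 * (η / 4) := by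
      have i1 := integrable_collision_integrand (g := fun z' => χ z' * r z') hf (hχ.mul hrm) hχr0 hχr1 (δ := δ) hε z
      have i2 := integrable_collision_integrand hf rc.measurable r0 r1 (δ := δ) hε z
      have e : collisionInt f₀ δ ε (fun z' => χ z' * r z') z -
          collisionInt f₀ δ ε (limitRatio f₀ δ N) z =
          ∫ z', (1 - avoid (Hits δ ε) z z') * (activity d ε * f₀ z') *
            (χ z' * r z' - limitRatio f₀ δ N z') := by
        unfold collisionInt
        rw [← integral_sub i1 i2]
        exact integral_congr_ae (Eventually.of_forall fun z' => by ring)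
      rw [e]
      exact abs_integral_collision_le hf hε (by positivity) z hop
    have hconv := HC ε hε hεε₃ z hz
    rw [hexp]
    simp only [limitRatio]
    -- The map a ↦ exp(-a) is 1-Lipschitz on the half-line, so the exponential does not spoil the
    -- contraction.
    refine (abs_exp_neg_sub_exp_neg_le hcI0 (limitOp_nonneg hf r0 hδ.le z)).trans ?_
    have := abs_sub_le (collisionInt f₀ δ ε (fun z' => χ z' * r z') z)
      (collisionInt f₀ δ ε (limitRatio f₀ δ N) z) (limitOp f₀ δ (limitRatio f₀ δ N) z)
    linarith

end HardSphere
end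

open MeasureTheory Filter Topology
open scoped ENNReal BigOperators

noncomputable section

namespace HardSphere

/-! ### Limits of the correlation functions -/

variable {d : ℕ} {β μ : ℝ} {f₀ : Phase d → ℝ}

/-- The j frozen particles contribute μ_ε^j, which the rescaling removes. -/
lemma rescaledCorrelation_gcDensity (f₀ : Phase d → ℝ) (δ : ℝ) {ε : ℝ} (hε : 0 < ε) (j : ℕ)
    (Z : Config d j) : rescaledCorrelation ε (gcDensity f₀ δ ε) j Z = hcWeight (Hits δ ε) f₀ j Z *
      (hcPartition (Hits δ ε) (fun w => (∏ i, avoid (Hits δ ε) (Z i) w) * (activity d ε * f₀ w)) /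
        hcPartition (Hits δ ε) (fun w => activity d ε * f₀ w)) := by
  have ha := (activity_pos (d := d) hε).ne'
  have hw : hcWeight (Hits δ ε) (fun w => activity d ε * f₀ w) j Z =
      activity d ε ^ j * hcWeight (Hits δ ε) f₀ j Z := by
    unfold hcWeight
    split_ifs <;> simp [Finset.prod_mul_distrib]
  unfold rescaledCorrelation correlation
  have e : ∀ n, ((n.factorial : ℝ))⁻¹ * ∫ Y : Config d n, gcDensity f₀ δ ε (j + n) (Fin.append Z Y) =
      (hcPartition (Hits δ ε) (fun z => activity d ε * f₀ z))⁻¹ * (((n.factorial : ℝ))⁻¹ *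
        ∫ Y : Config d n, hcWeight (Hits δ ε) (fun z => activity d ε * f₀ z) (j + n)
          (Fin.append Z Y)) := fun n => by
    simp_rw [gcDensity_eq, integral_const_mul]
    ring
  rw [tsum_congr e, tsum_mul_left, tsum_integral_hcWeight_append Hits.symm, hw]
  field_simp

lemma rescaledCorrelation_one (f₀ : Phase d → ℝ) (δ : ℝ) {ε : ℝ} (hε : 0 < ε) (z : Phase d) :
    rescaledCorrelation ε (gcDensity f₀ δ ε) 1 (fun _ => z) =
      f₀ z * hcRatio (Hits δ ε) (fun w => activity d ε * f₀ w) z := by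
  rw [rescaledCorrelation_gcDensity f₀ δ hε, hcWeight, if_pos, hcRatio]
  · simp
  · exact fun i k hik => absurd (Subsingleton.elim i k) hik


lemma activity_mul_profile (hf : IsProfile β μ f₀) {ε : ℝ} (hε : 0 < ε) :
    Measurable (fun w => activity d ε * f₀ w) ∧ Integrable (fun w => activity d ε * f₀ w) ∧
      ∀ w, 0 ≤ activity d ε * f₀ w :=
  ⟨hf.cont.measurable.const_mul _, hf.integrable.const_mul _,
    fun w => mul_nonneg (activity_pos hε).le (hf.nonneg w)⟩

/-- The one-particle ratios converge uniformly on bounded sets of velocities. -/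
theorem exists_limit_hcRatio (hd : 2 ≤ d) (hf : IsProfile β μ f₀) {δ : ℝ}
    (hδ : 0 < δ) (hsmall : tubeBound d * δ * gaussMoment d β μ ≤ 1 / 2) :
    ∃ r : Phase d → ℝ, Measurable r ∧ (∀ z, 0 ≤ r z) ∧ (∀ z, r z ≤ 1) ∧
      ∀ R η : ℝ, 0 ≤ R → 0 < η → ∃ ε₀ > 0, ∀ ε, 0 < ε → ε < ε₀ → ∀ z : Phase d, ‖z.2‖ ≤ R →
        |hcRatio (Hits δ ε) (fun w => activity d ε * f₀ w) z - r z| ≤ η := by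
  have key : ∀ (N : ℕ) {R η : ℝ}, 0 ≤ R → 0 < η → ∃ ε₀ > 0, ∀ ε, 0 < ε → ε < ε₀ →
      ∀ z : Phase d, ‖z.2‖ ≤ R →
      |hcRatio (Hits δ ε) (fun w => activity d ε * f₀ w) z - limitRatio f₀ δ N z| ≤
        (1 / 2) ^ N * (1 + ‖z.2‖) + η := by
    intro N R η hR hη
    obtain ⟨τ, hτ, ε₀, hε₀, H⟩ :=
      exists_abs_hcRatio_sub_limitRatio_le hd hf hδ hsmall N 0 hR hη
    refine ⟨ε₀, hε₀, fun ε hε hε' z hz => ?_⟩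
    simpa using H ε hε hε' z hz [] (by simp) (by simp) (by simp) (fun _ => 1) measurable_const
      (fun _ => zero_le_one) (fun _ => le_rfl) (by simp)
  -- Two iterates are compared through the true ratio at one small ε, to which both are close. This
  -- yields the Cauchy property without a contraction estimate for the limit operator.
  have hdist : ∀ (N m : ℕ), N ≤ m → ∀ z : Phase d,
      |limitRatio f₀ δ N z - limitRatio f₀ δ m z| ≤ 2 * ((1 / 2) ^ N * (1 + ‖z.2‖)) := by
    intro N m hNm z
    refine le_of_forall_pos_le_add fun η hη => ?_
    obtain ⟨ε₁, hε₁, H₁⟩ := key N (norm_nonneg z.2) (half_pos hη)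
    obtain ⟨ε₂, hε₂, H₂⟩ := key m (norm_nonneg z.2) (half_pos hη)
    have hm : 0 < min ε₁ ε₂ := lt_min hε₁ hε₂
    have h1 := H₁ (min ε₁ ε₂ / 2) (by positivity)
      ((half_lt_self hm).trans_le (min_le_left _ _)) z le_rfl
    have h2 := H₂ (min ε₁ ε₂ / 2) (by positivity)
      ((half_lt_self hm).trans_le (min_le_right _ _)) z le_rfl
    have h3 := abs_sub_le (limitRatio f₀ δ N z)
      (hcRatio (Hits δ (min ε₁ ε₂ / 2)) (fun w => activity d (min ε₁ ε₂ / 2) * f₀ w) z)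
      (limitRatio f₀ δ m z)
    rw [abs_sub_comm] at h1
    have h4 : ((1 : ℝ) / 2) ^ m * (1 + ‖z.2‖) ≤ (1 / 2) ^ N * (1 + ‖z.2‖) :=
      mul_le_mul_of_nonneg_right (pow_le_pow_of_le_one (by norm_num) (by norm_num) hNm)
        (by positivity)
    linarith
  have hgeom : ∀ c : ℝ, Tendsto (fun N : ℕ => 2 * ((1 / 2 : ℝ) ^ N * c)) atTop (𝓝 0) := fun c => by
    simpa using ((tendsto_pow_atTop_nhds_zero_of_lt_one (r := (1 / 2 : ℝ)) (by norm_num)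
      (by norm_num)).mul_const c).const_mul 2
  have hcauchy : ∀ z : Phase d, ∃ a, Tendsto (fun N => limitRatio f₀ δ N z) atTop (𝓝 a) :=
    fun z => cauchySeq_tendsto_of_complete (cauchySeq_of_le_tendsto_0'
      (fun N => 2 * ((1 / 2) ^ N * (1 + ‖z.2‖))) (fun N m h => hdist N m h z) (hgeom _))
  choose r hr using hcauchy
  have hspec := limitRatio_spec hf hδ.le
  refine ⟨r, measurable_of_tendsto_metrizable (fun N => (hspec N).1.measurable)
    (tendsto_pi_nhds.2 hr), fun z => ge_of_tendsto' (hr z) fun N => (hspec N).2.1 z,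
    fun z => le_of_tendsto' (hr z) fun N => (hspec N).2.2 z, fun R η hR hη => ?_⟩
  have hlim : ∀ N z, |limitRatio f₀ δ N z - r z| ≤ 2 * ((1 / 2) ^ N * (1 + ‖z.2‖)) := fun N z =>
    le_of_tendsto ((tendsto_const_nhds.sub (hr z)).abs)
      (eventually_atTop.2 ⟨N, fun m h => hdist N m h z⟩)
  obtain ⟨N, hN⟩ := ((hgeom (1 + R)).eventually_lt_const (show 0 < η / 4 by positivity)).exists
  obtain ⟨ε₀, hε₀, H⟩ := key N hR (show 0 < η / 4 by positivity)
  refine ⟨ε₀, hε₀, fun ε hε hε' z hz => ?_⟩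
  have h1 := H ε hε hε' z hz
  have h2 := hlim N z
  have h3 := abs_sub_le (hcRatio (Hits δ ε) (fun w => activity d ε * f₀ w) z)
    (limitRatio f₀ δ N z) (r z)
  have h4 : ((1 : ℝ) / 2) ^ N * (1 + ‖z.2‖) ≤ (1 / 2) ^ N * (1 + R) := by gcongr
  linarith

lemma gaussWeight_le (hβ : 0 < β) (v : EuclideanSpace ℝ (Fin d)) :
    gaussWeight β μ v ≤ Real.exp (-μ) := by
  refine Real.exp_le_exp.2 ?_
  have : 0 ≤ β / 2 * ‖v‖ ^ 2 := by positivity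
  linarith

lemma exists_gaussWeight_le (hβ : 0 < β) {η : ℝ} (hη : 0 < η) : ∃ R : ℝ, 0 ≤ R ∧
    ∀ v : EuclideanSpace ℝ (Fin d), R < ‖v‖ → gaussWeight β μ v ≤ η := by
  refine ⟨max 1 (2 / β * (-μ - Real.log η)), zero_le_one.trans (le_max_left _ _), fun v hv => ?_⟩
  have h1 : 1 < ‖v‖ := (le_max_left _ _).trans_lt hv
  have h2 : 2 / β * (-μ - Real.log η) < ‖v‖ := (le_max_right _ _).trans_lt hv
  have h3 : -μ - Real.log η < β / 2 * ‖v‖ := by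
    have : β / 2 * (2 / β * (-μ - Real.log η)) = -μ - Real.log η := by field_simp
    rw [← this]; gcongr
  have h4 : β / 2 * ‖v‖ ≤ β / 2 * ‖v‖ ^ 2 := by
    have : ‖v‖ ≤ ‖v‖ ^ 2 := by nlinarith
    gcongr
  rw [gaussWeight, ← Real.exp_log hη]
  exact Real.exp_le_exp.2 (by linarith)

/-- For bounded velocities the ratios converge uniformly; for large ones f₀ is uniformly small and
the ratios stay in [0, 1]. -/
theorem tendsto_iSup_rescaledCorrelation_one (hd : 2 ≤ d) (hf : IsProfile β μ f₀) {δ : ℝ}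
    (hδ : 0 < δ) (hsmall : tubeBound d * δ * gaussMoment d β μ ≤ 1 / 2) :
    ∃ f₁ : Phase d → ℝ, Measurable f₁ ∧ (∀ z, 0 ≤ f₁ z) ∧
      Tendsto (fun ε : ℝ => ⨆ z : Phase d, ENNReal.ofReal
        |rescaledCorrelation ε (gcDensity f₀ δ ε) 1 (fun _ => z) - f₁ z|) (𝓝[>] 0) (𝓝 0) := by
  obtain ⟨r, hrm, hr0, hr1, H⟩ := exists_limit_hcRatio hd hf hδ hsmall
  refine ⟨fun z => f₀ z * r z, hf.cont.measurable.mul hrm,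
    fun z => mul_nonneg (hf.nonneg z) (hr0 z), ENNReal.tendsto_nhds_zero.2 fun e he => ?_⟩
  obtain ⟨η, hη0, hη⟩ := ENNReal.lt_iff_exists_real_btwn.1 he
  have hη' : 0 < η := by simpa using hη.1
  obtain ⟨R, hR, hgR⟩ := exists_gaussWeight_le (d := d) (μ := μ) hf.pos hη'
  obtain ⟨ε₀, hε₀, H₀⟩ := H R (η / Real.exp (-μ)) hR (by positivity)
  filter_upwards [Ioo_mem_nhdsGT hε₀] with ε hε
  refine (iSup_le fun z => ?_).trans hη.2.le
  refine ENNReal.ofReal_le_ofReal ?_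
  rw [rescaledCorrelation_one f₀ δ hε.1, ← mul_sub, abs_mul, abs_of_nonneg (hf.nonneg z)]
  rcases le_or_gt ‖z.2‖ R with hz | hz
  · calc _ ≤ Real.exp (-μ) * (η / Real.exp (-μ)) := mul_le_mul
          ((hf.le_gauss z).trans (gaussWeight_le hf.pos _)) (H₀ ε hε.1 hε.2 z hz) (abs_nonneg _)
          (Real.exp_pos _).le
      _ = η := by field_simp
  · obtain ⟨w1, w2, w3⟩ := activity_mul_profile hf hε.1
    have b0 := hcRatio_nonneg (measurableSet_hits δ ε) w1 w2 w3 z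
    have b1 := hcRatio_le_one (measurableSet_hits δ ε) w1 w2 w3 z
    have : |hcRatio (Hits δ ε) (fun w => activity d ε * f₀ w) z - r z| ≤ 1 := by
      rw [abs_le]; constructor <;> linarith [hr0 z, hr1 z]
    exact (mul_le_of_le_one_right (hf.nonneg z) this).trans ((hf.le_gauss z).trans (hgR _ hz))

lemma one_sub_prod_le_sum {ι : Type*} (s : Finset ι) (a : ι → ℝ) (h0 : ∀ i, 0 ≤ a i)
    (h1 : ∀ i, a i ≤ 1) : 1 - ∏ i ∈ s, a i ≤ ∑ i ∈ s, (1 - a i) := by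
  classical
  induction s using Finset.induction_on with
  | empty => simp
  | insert i s hi ih =>
    rw [Finset.prod_insert hi, Finset.sum_insert hi]
    have hp1 : ∏ i ∈ s, a i ≤ 1 := Finset.prod_le_one (fun i _ => h0 i) fun i _ => h1 i
    nlinarith [h0 i, h1 i]

/-- The ratios of partition functions of several well separated particles factorize. -/
theorem exists_abs_hcPartition_div_sub_prod_le (hd : 2 ≤ d) (hf : IsProfile β μ f₀) {δ : ℝ}
    (hδ : 0 < δ) (hsmall : tubeBound d * δ * gaussMoment d β μ ≤ 1 / 2) (j : ℕ) {R η : ℝ}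
    (hR : 0 ≤ R) (hη : 0 < η) : ∃ ε₀ > 0, ∀ ε, 0 < ε → ε < ε₀ → ∀ Z : Config d j,
      Admissible (Hits δ (ε * |Real.log ε|)) Z → (∀ i, ‖(Z i).2‖ ≤ R) →
      |hcPartition (Hits δ ε) (fun w => (∏ i, avoid (Hits δ ε) (Z i) w) * (activity d ε * f₀ w)) /
        hcPartition (Hits δ ε) (fun w => activity d ε * f₀ w) -
        ∏ i, hcRatio (Hits δ ε) (fun w => activity d ε * f₀ w) (Z i)| ≤ η := by
  set η' := η / (4 * (j + 1)) with hη'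
  have hη'0 : 0 < η' := by positivity
  obtain ⟨N, hN⟩ : ∃ N : ℕ, ((1 : ℝ) / 2) ^ N * (1 + R) < η' := by
    have h : Tendsto (fun N : ℕ => ((1 : ℝ) / 2) ^ N * (1 + R)) atTop (𝓝 0) := by
      simpa using (tendsto_pow_atTop_nhds_zero_of_lt_one (r := (1 / 2 : ℝ)) (by norm_num)
        (by norm_num)).mul_const (1 + R)
    exact (h.eventually_lt_const hη'0).exists
  obtain ⟨τ, hτ, ε₁, hε₁, H⟩ :=
    exists_abs_hcRatio_sub_limitRatio_le hd hf hδ hsmall N j hR hη'0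
  obtain ⟨ε₂, hε₂, H'⟩ := exists_collisionOp_hitSet_le_of_not_hits hd hf hδ hR hτ
  refine ⟨min ε₁ ε₂, lt_min hε₁ hε₂, fun ε hε hε' Z hZ hZR => ?_⟩
  have hm := measurableSet_hits (d := d) δ ε
  obtain ⟨w1, w2, w3⟩ := activity_mul_profile hf hε
  -- The particles in s act as obstacles for a; their mutual separation makes simultaneous
  -- collisions rare. The cases s and ∅ are both close to the same iterate, so the ratios with and
  -- without s differ by at most 4 η'.
  have hclose : ∀ (s : Finset (Fin j)) (a : Fin j), a ∉ s →
      |hcRatio (Hits δ ε) (fun w => (∏ i ∈ s, avoid (Hits δ ε) (Z i) w) * (activity d ε * f₀ w))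
        (Z a) - limitRatio f₀ δ N (Z a)| ≤ 2 * η' := by
    intro s a ha
    have h := H ε hε (hε'.trans_le (min_le_left _ _)) (Z a) (hZR a) (s.toList.map Z)
      (by simpa using s.card_le_univ) (fun p hp => ?_) (fun p hp => ?_)
      (fun w => ∏ i ∈ s, avoid (Hits δ ε) (Z i) w)
      (Finset.measurable_prod _ fun i _ => measurable_avoid_right hm (Z i))
      (fun w => Finset.prod_nonneg fun i _ => avoid_nonneg _ _)
      (fun w => Finset.prod_le_one (fun i _ => avoid_nonneg _ _) fun i _ => avoid_le_one _ _)
      (fun w => ?_)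
    · have h2 : ((1 : ℝ) / 2) ^ N * (1 + ‖(Z a).2‖) ≤ (1 / 2) ^ N * (1 + R) := by
        have := hZR a
        gcongr
      have e : (fun w => activity d ε * f₀ w * ∏ i ∈ s, avoid (Hits δ ε) (Z i) w) =
          fun w => (∏ i ∈ s, avoid (Hits δ ε) (Z i) w) * (activity d ε * f₀ w) :=
        funext fun w => mul_comm _ _
      rw [e] at h
      linarith
    · obtain ⟨i, _, rfl⟩ := List.mem_map.1 hp
      exact hZR i
    · obtain ⟨i, hi, rfl⟩ := List.mem_map.1 hp
      have hai : a ≠ i := fun h => ha (h ▸ Finset.mem_toList.1 hi)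
      exact H' ε hε (hε'.trans_le (min_le_right _ _)) (Z a) (Z i) (hZR a) (hZR i) (hZ a i hai)
    · rw [List.map_map]
      refine (one_sub_prod_le_sum s _ (fun i => avoid_nonneg _ _) fun i => avoid_le_one _ _).trans_eq ?_
      exact (Finset.sum_map_toList s fun i => 1 - avoid (Hits δ ε) (Z i) w).symm
  refine (abs_hcPartition_div_sub_prod_le hm w1 w2 w3 Z (η := 4 * η') Finset.univ
    fun s _ a _ ha => ?_).trans ?_
  · have h1 := hclose s a ha
    have h2 := hclose ∅ a (Finset.notMem_empty a)
    simp only [Finset.prod_empty, one_mul] at h2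
    rw [abs_sub_comm] at h2
    have h3 := abs_sub_le (hcRatio (Hits δ ε) (fun w => (∏ i ∈ s, avoid (Hits δ ε) (Z i) w) *
      (activity d ε * f₀ w)) (Z a)) (limitRatio f₀ δ N (Z a))
      (hcRatio (Hits δ ε) (fun w => activity d ε * f₀ w) (Z a))
    linarith
  · rw [Finset.card_univ, Fintype.card_fin]
    have : (4 * ((j : ℝ) + 1)) * η' = η := by rw [hη']; field_simp
    nlinarith

/-- For bounded velocities the ratios factorize. If one velocity is large, its factor f₀ is at most
η / M^j, the others are at most M, and both ratio terms lie in [0, 1]. -/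
theorem tendsto_iSup_rescaledCorrelation_sub_prod (hd : 2 ≤ d) (hf : IsProfile β μ f₀) {δ : ℝ}
    (hδ : 0 < δ) (hsmall : tubeBound d * δ * gaussMoment d β μ ≤ 1 / 2) (j : ℕ) :
    Tendsto (fun ε : ℝ => ⨆ Z ∈ (badSet d δ (ε * |Real.log ε|) j)ᶜ, ENNReal.ofReal
      |rescaledCorrelation ε (gcDensity f₀ δ ε) j Z -
        ∏ i, rescaledCorrelation ε (gcDensity f₀ δ ε) 1 (fun _ => Z i)|) (𝓝[>] 0) (𝓝 0) := by
  refine ENNReal.tendsto_nhds_zero.2 fun e he => ?_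
  obtain ⟨η, hη0, hη⟩ := ENNReal.lt_iff_exists_real_btwn.1 he
  have hη' : 0 < η := by simpa using hη.1
  set M := max 1 (Real.exp (-μ))
  have hM : 1 ≤ M := le_max_left _ _
  have hfM : ∀ z, f₀ z ≤ M := fun z =>
    ((hf.le_gauss z).trans (gaussWeight_le hf.pos _)).trans (le_max_right _ _)
  obtain ⟨R, hR, hgR⟩ := exists_gaussWeight_le (d := d) (μ := μ) hf.pos
    (η := η / M ^ j) (by positivity)
  obtain ⟨ε₀, hε₀, H⟩ := exists_abs_hcPartition_div_sub_prod_le hd hf hδ hsmall j hR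
    (η := η / M ^ j) (by positivity)
  -- For ε < 1/e one has |log ε| ≥ 1, so the separation at scale ε |log ε| implies admissibility at
  -- scale ε.
  filter_upwards [Ioo_mem_nhdsGT hε₀, Ioo_mem_nhdsGT (Real.exp_pos (-1))] with ε hε hεe
  refine (iSup₂_le fun Z hZ => ?_).trans hη.2.le
  refine ENNReal.ofReal_le_ofReal ?_
  have hZ' : Admissible (Hits δ (ε * |Real.log ε|)) Z := notMem_badSet_iff.1 hZ
  have hlog : 1 ≤ |Real.log ε| := by
    have : Real.log ε < -1 := (Real.log_lt_iff_lt_exp hε.1).2 hεe.2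
    have := neg_le_abs (Real.log ε)
    linarith
  have hadm : Admissible (Hits δ ε) Z := fun i k hik h => by
    obtain ⟨u, hu, hle⟩ := h
    exact hZ' i k hik ⟨u, hu, hle.trans (le_mul_of_one_le_right hε.1.le hlog)⟩
  rw [rescaledCorrelation_gcDensity f₀ δ hε.1, hcWeight, if_pos hadm]
  simp_rw [rescaledCorrelation_one f₀ δ hε.1]
  rw [Finset.prod_mul_distrib, ← mul_sub, abs_mul,
    abs_of_nonneg (Finset.prod_nonneg fun i _ => hf.nonneg _)]
  set X := hcPartition (Hits δ ε) (fun w => (∏ i, avoid (Hits δ ε) (Z i) w) * (activity d ε * f₀ w)) /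
        hcPartition (Hits δ ε) (fun w => activity d ε * f₀ w)
  set P := ∏ i, hcRatio (Hits δ ε) (fun w => activity d ε * f₀ w) (Z i)
  by_cases hZR : ∀ i, ‖(Z i).2‖ ≤ R
  · have hprod : ∏ i, f₀ (Z i) ≤ M ^ j := by
      refine (Finset.prod_le_prod (fun i _ => hf.nonneg _) fun i _ => hfM (Z i)).trans ?_
      simp
    calc _ ≤ M ^ j * (η / M ^ j) := mul_le_mul hprod (H ε hε.1 hε.2 Z hZ' hZR) (abs_nonneg _)
          (by positivity)
      _ = η := by field_simp
  · push Not at hZR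
    obtain ⟨i, hi⟩ := hZR
    have hm := measurableSet_hits (d := d) δ ε
    obtain ⟨w1, w2, w3⟩ := activity_mul_profile hf hε.1
    have hprod : ∏ i, f₀ (Z i) ≤ η := by
      rw [← Finset.mul_prod_erase _ _ (Finset.mem_univ i)]
      have h1 : ∏ k ∈ Finset.univ.erase i, f₀ (Z k) ≤ M ^ j := by
        refine (Finset.prod_le_prod (fun i _ => hf.nonneg _) fun i _ => hfM (Z i)).trans ?_
        rw [Finset.prod_const]
        refine pow_le_pow_right₀ hM ?_
        exact (Finset.card_le_univ _).trans_eq (Fintype.card_fin j)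
      calc _ ≤ (η / M ^ j) * M ^ j := mul_le_mul ((hf.le_gauss _).trans (hgR _ hi)) h1
            (Finset.prod_nonneg fun k _ => hf.nonneg _) (by positivity)
        _ = η := by field_simp
    have hpos := hcPartition_pos hm w1 w2 w3
    have hav0 : ∀ w, 0 ≤ ∏ i, avoid (Hits δ ε) (Z i) w := fun w =>
      Finset.prod_nonneg fun i _ => avoid_nonneg _ _
    have hav1 : ∀ w, ∏ i, avoid (Hits δ ε) (Z i) w ≤ 1 := fun w =>
      Finset.prod_le_one (fun i _ => avoid_nonneg _ _) fun i _ => avoid_le_one _ _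
    have v1 := measurable_prod_avoid_mul hm w1 Finset.univ Z
    have v2 := integrable_prod_avoid_mul hm w2 Finset.univ Z
    have v3 : ∀ w, 0 ≤ (∏ i, avoid (Hits δ ε) (Z i) w) * (activity d ε * f₀ w) := fun w =>
      mul_nonneg (hav0 w) (w3 w)
    have hX0 : 0 ≤ X := div_nonneg (hcPartition_pos hm v1 v2 v3).le hpos.le
    have hX1 : X ≤ 1 := div_le_one_of_le₀ (hcPartition_mono hm v1 v2 w1 w2 v3 fun w =>
      mul_le_of_le_one_left (w3 w) (hav1 w)) hpos.le
    have hP0 : 0 ≤ P := Finset.prod_nonneg fun i _ => hcRatio_nonneg hm w1 w2 w3 _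
    have hP1 : P ≤ 1 := Finset.prod_le_one (fun i _ => hcRatio_nonneg hm w1 w2 w3 _)
      fun i _ => hcRatio_le_one hm w1 w2 w3 _
    have hXP : |X - P| ≤ 1 := by rw [abs_le]; constructor <;> linarith
    exact (mul_le_of_le_one_right (Finset.prod_nonneg fun i _ => hf.nonneg _) hXP).trans hprod

end HardSphere
end

/-! ### The main theorem -/

theorem proposition4p1 (d : ℕ) (hd : 2 ≤ d) (β μ : ℝ) (hβ : 0 < β) :
    ∃ δ₀ : ℝ, 0 < δ₀ ∧ ∀ f₀ : HardSphere.Phase d → ℝ,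
      Continuous f₀ → (∀ z, 0 ≤ f₀ z) → ∫ z, f₀ z = 1 →
      (∀ z, f₀ z * Real.exp (μ + β / 2 * ‖z.2‖ ^ 2) ≤ 1) →
      ∀ δ : ℝ, 0 < δ → δ ≤ δ₀ →
        -- uniform convergence of the one-particle function, and uniform factorization
        (∃ f₁ : HardSphere.Phase d → ℝ, Measurable f₁ ∧ (∀ z, 0 ≤ f₁ z) ∧
          Tendsto (fun ε : ℝ => ⨆ z : HardSphere.Phase d,
              ENNReal.ofReal
                |HardSphere.rescaledCorrelation ε (HardSphere.gcDensity f₀ δ ε) 1 (fun _ => z)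
                  - f₁ z|)
            (𝓝[>] 0) (𝓝 0)) ∧
        (∀ j : ℕ, 2 ≤ j →
          Tendsto (fun ε : ℝ =>
              ⨆ Z ∈ (HardSphere.badSet d δ (ε * |Real.log ε|) j)ᶜ,
              ENNReal.ofReal
                |HardSphere.rescaledCorrelation ε (HardSphere.gcDensity f₀ δ ε) j Z
                  - ∏ i, HardSphere.rescaledCorrelation ε (HardSphere.gcDensity f₀ δ ε) 1
                      (fun _ => Z i)|)
            (𝓝[>] 0) (𝓝 0)) ∧
        -- on `[0, δ]` the hard-sphere dynamics acts on the state as free transport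
        (∀ ε : ℝ, 0 < ε →
          (∀ (n : ℕ) (Z : HardSphere.Config d n), HardSphere.gcDensity f₀ δ ε n Z ≠ 0 →
            ∀ Y : ℝ → HardSphere.Config d n,
              (Y 0 = Z ∧ HardSphere.IsHardSphereTrajectory ε δ Y) ↔
                ∀ t ∈ Set.Icc (0 : ℝ) δ, Y t = HardSphere.freeFlow t Z) ∧
          ∀ t ∈ Set.Icc (0 : ℝ) δ,
            (∀ (n : ℕ) (Φ : HardSphere.Config d n → HardSphere.Config d n),
              (∀ Z, HardSphere.gcDensity f₀ δ ε n Z ≠ 0 →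
                ∃ Y : ℝ → HardSphere.Config d n,
                  Y 0 = Z ∧ HardSphere.IsHardSphereTrajectory ε δ Y ∧ Y t = Φ Z) →
              Measure.map Φ (volume.withDensity
                  (fun Z => ENNReal.ofReal (HardSphere.gcDensity f₀ δ ε n Z))) =
                volume.withDensity (fun Z => ENNReal.ofReal
                  (HardSphere.gcDensity f₀ δ ε n (HardSphere.freeFlow (-t) Z)))) ∧
            ∀ (j : ℕ) (Z : HardSphere.Config d j),
              HardSphere.rescaledCorrelation ε
                  (fun n Y => HardSphere.gcDensity f₀ δ ε n (HardSphere.freeFlow (-t) Y)) j Z =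
                HardSphere.rescaledCorrelation ε (HardSphere.gcDensity f₀ δ ε) j
                  (HardSphere.freeFlow (-t) Z)) := by
  have hM := HardSphere.gaussMoment_nonneg (d := d) (β := β) (μ := μ)
  have hb := HardSphere.tubeBound_nonneg (d := d)
  -- This choice makes the contraction factor at most 1/2; the summand 1 keeps the denominator
  -- positive. It involves only d, β and μ.
  refine ⟨1 / (2 * (HardSphere.tubeBound d * HardSphere.gaussMoment d β μ + 1)), by positivity, ?_⟩
  intro f₀ hc h0 h1 hexp δ hδ hδ₀
  have hf : HardSphere.IsProfile β μ f₀ := ⟨hβ, hc, h0, h1, fun z => by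
    rw [HardSphere.gaussWeight, Real.exp_neg, ← one_div, le_div_iff₀ (Real.exp_pos _)]
    exact hexp z⟩
  have hsmall : HardSphere.tubeBound d * δ * HardSphere.gaussMoment d β μ ≤ 1 / 2 := by
    rw [le_div_iff₀ (by positivity)] at hδ₀
    nlinarith
  refine ⟨HardSphere.tendsto_iSup_rescaledCorrelation_one hd hf hδ hsmall,
    fun j _ => HardSphere.tendsto_iSup_rescaledCorrelation_sub_prod hd hf hδ hsmall j,
    fun ε _ => ⟨fun n Z hZ Y => HardSphere.isHardSphereTrajectory_iff hδ.le
      (HardSphere.admissible_of_gcDensity_ne_zero hZ) Y, fun t ht =>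
      ⟨fun n Φ hΦ => HardSphere.map_withDensity_gcDensity hc.measurable hδ.le ht Φ hΦ,
        fun j Z => HardSphere.rescaledCorrelation_freeFlow ε _ (-t) j Z⟩⟩⟩
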